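/- Let $\Delta$ be the discrete Laplacian on $\ell^2(\mathbb Z^d)$, $(\Delta f)_n=\frac12\sum_{j=1}^d (f_{n+e_j}+f_{n-e_j})$. For a bounded sequence $u:\mathbb Z^d\to\mathbb C$ write $u$ also for the operator of multiplication by $u$ on $\ell^2(\mathbb Z^d)$, and let $\|\cdot\|$ be the operator norm on $\ell^2(\mathbb Z^d)$. Let $\rho_n=\prod_{j=1}^d(1+|n_j|)^{-1}$ and, for $\kappa\ge 0$, let $\ell^q_\kappa(\mathbb Z^d)$ be the space of sequences $u:\mathbb Z^d\to\mathbb C$ with finite norm $\|u\|_{q,\kappa}=\|(\rho_n^{-\kappa}u_n)_n\|_{\ell^q(\mathbb Z^d)}$; in particular $\|u\|_{\infty,\kappa}=\sup_n\rho_n^{-\kappa}|u_n|$. Let $C_L$ be Landau's optimal constant, that is, the least constant $C$ such that the Bessel functions $J_\nu$ of the first kind satisfy $|J_\nu(t)|\le C\,t^{-1/3}$ for all real $\nu\ge 0$ and $t>0$. Theorem. The constant $C_L$ exists and $C_L<4/5$. Moreover, for every $d\ge 1$ the following holds, with $1/q=0$ if $q=\infty$. (a) Let $2\le q\le\infty$.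 Then for all $t\in\mathbb R$ with $|t|\ge 1$ and all $u,v\in\ell^q(\mathbb Z^d)$, $$\|u\,e^{it\Delta}\,v\|\le C_L^{\frac{2d}{q}}\,|t|^{-\frac{2d}{3q}}\,\|u\|_q\,\|v\|_q .$$ (b) Let $a>1/2$, $2\le q\le\infty$ and $0\le\kappa\le a\bigl(1-\frac2q\bigr)$. Then for all $t\in\mathbb R$ with $|t|\ge 1$ and all $u,v\in\ell^q_\kappa(\mathbb Z^d)$, $$\|u\,e^{it\Delta}\,v\|\le C_L^{\frac{2d}{q}}\,C_a^{\frac{d\kappa}{a}}\,|t|^{-d\left(\frac{2}{3q}+\frac{\kappa}{2a}\right)}\,\|u\|_{q,\kappa}\,\|v\|_{q,\kappa},\qquad C_a=3\Bigl(1+\frac{2a}{2a-1}\Bigr).$$ -/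

import Mathlib

open scoped ENNReal

noncomputable section

/-- The cubic lattice `ℤ^d`. -/
abbrev CubicLattice (d : ℕ) : Type := Fin d → ℤ

/-- The Hilbert space `ℓ²(ℤ^d)` of square summable complex sequences. -/
abbrev EllTwo (d : ℕ) : Type := lp (fun _ : CubicLattice d => ℂ) 2

/-- The standard basis vector `e_j` of `ℤ^d`. -/
def stdVec {d : ℕ} (j : Fin d) : CubicLattice d := Pi.single j 1

theorem memlp_shift {d : ℕ} (e : CubicLattice d) (f : EllTwo d) :
    Memℓp (fun n : CubicLattice d => f (n + e)) 2 := by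
  have h2 : 0 < (2 : ℝ≥0∞).toReal := by norm_num
  rw [memℓp_gen_iff h2]
  exact ((lp.memℓp f).summable h2).comp_injective (add_left_injective e)

/-- The shift `(S_e f)_n = f_{n+e}` as a bounded operator on `ℓ²(ℤ^d)`. -/
def shiftOp {d : ℕ} (e : CubicLattice d) : EllTwo d →L[ℂ] EllTwo d :=
  LinearMap.mkContinuous
    { toFun := fun f => ⟨fun n => f (n + e), memlp_shift e f⟩
      map_add' := fun _ _ => rfl
      map_smul' := fun _ _ => rfl } 1 (by
    intro f
    have h2 : 0 < (2 : ℝ≥0∞).toReal := by norm_num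
    rw [one_mul, lp.norm_eq_tsum_rpow h2, lp.norm_eq_tsum_rpow h2]
    exact le_of_eq (congrArg (fun x : ℝ => x ^ (1 / (2 : ℝ≥0∞).toReal))
      ((Equiv.addRight e).tsum_eq (fun n => ‖f n‖ ^ (2 : ℝ≥0∞).toReal))))

theorem shiftOp_apply {d : ℕ} (e : CubicLattice d) (f : EllTwo d) (n : CubicLattice d) :
    shiftOp e f n = f (n + e) := rfl

/-- The discrete Laplacian `(Δ f)_n = ½ ∑_j (f_{n+e_j} + f_{n-e_j})` on `ℓ²(ℤ^d)`. -/
def discreteLaplacian (d : ℕ) : EllTwo d →L[ℂ] EllTwo d :=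
  (1 / 2 : ℂ) • ∑ j : Fin d, (shiftOp (stdVec j) + shiftOp (-stdVec j))

theorem discreteLaplacian_apply {d : ℕ} (f : EllTwo d) (n : CubicLattice d) :
    discreteLaplacian d f n = (1 / 2 : ℂ) * ∑ j : Fin d, (f (n + stdVec j) + f (n - stdVec j)) := by
  let E : EllTwo d →L[ℂ] ℂ := lp.evalCLM ℂ (fun _ : CubicLattice d => ℂ) 2 n
  have hE : ∀ (j : Fin d), E ((shiftOp (stdVec j) + shiftOp (-stdVec j)) f) =
      f (n + stdVec j) + f (n - stdVec j) := fun j => by rw [sub_eq_add_neg]; rfl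
  change E (discreteLaplacian d f) = _
  rw [discreteLaplacian, smul_apply, sum_apply, map_smul, map_sum,
    smul_eq_mul, Finset.sum_congr rfl fun j _ => hE j]

/-- The propagator `e^{itΔ}`, as the norm convergent exponential series of the bounded operator
`itΔ` on `ℓ²(ℤ^d)`. -/
def propagator (d : ℕ) (t : ℝ) : EllTwo d →L[ℂ] EllTwo d :=
  NormedSpace.exp ((Complex.I * (t : ℂ)) • discreteLaplacian d)

/-- Multiplication by a bounded sequence `u`, as a bounded operator on `ℓ²(ℤ^d)`. -/
def mulOp {d : ℕ} (u : CubicLattice d → ℂ) (hu : Memℓp u ∞) : EllTwo d →L[ℂ] EllTwo d :=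
  lp.mapCLM 2 (fun n : CubicLattice d => u n • ContinuousLinearMap.id ℂ ℂ)
    (K := ‖(⟨u, hu⟩ : lp (fun _ : CubicLattice d => ℂ) ∞)‖) (norm_nonneg _) (fun n => by
      rw [norm_smul, ContinuousLinearMap.norm_id, mul_one]
      exact lp.norm_apply_le_norm (by simp) (⟨u, hu⟩ : lp (fun _ : CubicLattice d => ℂ) ∞) n)

theorem mulOp_apply {d : ℕ} (u : CubicLattice d → ℂ) (hu : Memℓp u ∞) (f : EllTwo d)
    (n : CubicLattice d) : mulOp u hu f n = u n * f n := by
  simp [mulOp, lp.mapCLM]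

/-- The weight `ρ_n = ∏_j (1 + |n_j|)⁻¹`. -/
def rho {d : ℕ} (n : CubicLattice d) : ℝ := ∏ j : Fin d, (1 + |(n j : ℝ)|)⁻¹

/-- The sequence `(ρ_n^{-κ} u_n)_n`. -/
def weighted {d : ℕ} (κ : ℝ) (u : CubicLattice d → ℂ) : CubicLattice d → ℂ :=
  fun n => ((rho n ^ (-κ) : ℝ) : ℂ) * u n

/-- The weighted space `ℓ^q_κ(ℤ^d)`: the sequences `u` with `(ρ_n^{-κ} u_n)_n ∈ ℓ^q(ℤ^d)`. -/
def MemWeighted {d : ℕ} (q : ℝ≥0∞) (κ : ℝ) (u : CubicLattice d → ℂ) : Prop :=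
  Memℓp (weighted κ u) q

/-- The norm of `ℓ^q_κ(ℤ^d)`: the `ℓ^q`-norm of `(ρ_n^{-κ} u_n)_n`, that is,
`(∑_n ρ_n^{-qκ} |u_n|^q)^{1/q}` for `q < ∞` and `sup_n ρ_n^{-κ} |u_n|` for `q = ∞`. -/
def weightedNorm {d : ℕ} (q : ℝ≥0∞) (κ : ℝ) (u : CubicLattice d → ℂ) (hu : MemWeighted q κ u) : ℝ :=
  ‖(⟨weighted κ u, hu⟩ : lp (fun _ : CubicLattice d => ℂ) q)‖

theorem rho_pos {d : ℕ} (n : CubicLattice d) : 0 < rho n :=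
  Finset.prod_pos fun j _ => by positivity

theorem rho_le_one {d : ℕ} (n : CubicLattice d) : rho n ≤ 1 :=
  Finset.prod_le_one (fun j _ => by positivity) fun j _ =>
    inv_le_one_of_one_le₀ (by linarith [abs_nonneg (n j : ℝ)])

/-- For `κ ≥ 0` the elements of `ℓ^q_κ(ℤ^d)` are bounded sequences. -/
theorem MemWeighted.bounded {d : ℕ} {q : ℝ≥0∞} {κ : ℝ} (hκ : 0 ≤ κ) {u : CubicLattice d → ℂ}
    (hu : MemWeighted q κ u) : Memℓp u ∞ := by
  have h : Memℓp (weighted κ u) ∞ := Memℓp.of_exponent_ge hu le_top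
  refine h.mono' fun n => ?_
  have h1 : 1 ≤ rho n ^ (-κ) :=
    Real.one_le_rpow_of_pos_of_le_one_of_nonpos (rho_pos n) (rho_le_one n) (by linarith)
  simp only [weighted, norm_mul, Complex.norm_real, Real.norm_eq_abs]
  exact le_mul_of_one_le_left (norm_nonneg _) (h1.trans (le_abs_self _))

/-- The Bessel function of the first kind `J_ν(t) = ∑_k (-1)^k / (k! Γ(k+ν+1)) (t/2)^{2k+ν}`
of real order `ν ≥ 0` at `t > 0`. -/
def besselJ (ν t : ℝ) : ℝ :=
  ∑' k : ℕ, (-1) ^ k / (k.factorial * Real.Gamma (k + ν + 1)) * (t / 2) ^ (2 * k + ν)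

/-- `C` is Landau's constant: the optimal, that is least, constant with
`|J_ν(t)| ≤ C t^{-1/3}` for all real orders `ν ≥ 0` and all `t > 0`. -/
def IsLandauConstant (C : ℝ) : Prop :=
  IsLeast {B : ℝ | ∀ ν t : ℝ, 0 ≤ ν → 0 < t → |besselJ ν t| ≤ B * t ^ (-(1 / 3) : ℝ)} C

end

open Filter Topology Set MeasureTheory

/-! The operator `e^{itΔ}` has, up to phases, the kernel `∏_j J_{|n_j - m_j|}(|t|)`: `Δ` is a sum of
commuting one-dimensional hops `½(S + S⁻¹)`, and `exp(c(S + S⁻¹)) = exp(cS) exp(cS⁻¹)` is a double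
series whose diagonals are Bessel series. Three bounds on this kernel carry the operator estimates.
It is unitary. Its entries are at most `(C_L |t|^{-1/3})^d`, so two weights in the unit ball of `ℓ²`
give a Hilbert–Schmidt bound (`formBound_of_sum_sq_le_one`). With weights `ρ^a`, `a > 1/2`, its
Hilbert–Schmidt norm is at most `(C_a |t|^{-1/2})^d` (`formBound_rho_rpow`). Stein interpolation
(`FormBound.interpolate`) between the first and the third gives weights `ρ^κ` without summability,
and between that family and the second, with parameter `θ = 2/q`, the bounds for `ℓ^q_κ`. Part (a)
is the case `κ = 0`.

For Landau's constant it suffices that `√(2/π) < 4/5` is admissible; the admissible constants then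
form a nonempty closed set bounded below, which has a least element. Write `p = t J_ν'`, so that
Bessel's equation reads `t p' = (ν² - t²) J_ν`. Suitable quadratic forms in `(J_ν, p)` are
nondecreasing in `t` and tend to `2/π` at infinity, by the cosine asymptotics of `J_ν`; they
therefore bound `J_ν²` pointwise.

For `ν ≥ 1/2` such a form gives `t^{2/3} J_ν² ≤ 2/π` from a point `T` slightly beyond `ν` on. On
`(0, T]` a Riccati barrier shows `t J_ν'/J_ν > -1/3`, so `t^{1/3} J_ν` increases up to `T` and
inherits the bound there. For `ν ≤ 1/2`, Sonin's form settles `t ≥ 1`, and three terms of the power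
series settle `t ≤ 1`. -/

/-! ### Power series of `J_ν`, recurrence and Bessel's equation -/

theorem half_le_Gamma {x : ℝ} (hx : 1 ≤ x) : 1 / 2 ≤ Real.Gamma x := by
  have hmono : ∀ y : ℝ, 2 ≤ y → 1 ≤ Real.Gamma y := fun y hy => by
    rw [← Real.Gamma_two]
    exact Real.Gamma_strictMonoOn_Ici.monotoneOn (by simp) hy hy
  rcases le_total 2 x with h | h
  · linarith [hmono x h]
  · have h1 := hmono (x + 1) (by linarith)
    rw [Real.Gamma_add_one (by linarith)] at h1
    nlinarith [Real.Gamma_pos_of_pos (show 0 < x by linarith)]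

/-- The entire function `s ↦ ∑_k (-s)^k / (k! Γ(k+ν+1))`, for which
`J_ν(t) = (t/2)^ν besselEntire ν (t²/4)`. -/
noncomputable def besselEntire (ν s : ℝ) : ℝ :=
  ∑' k : ℕ, (-s) ^ k / (k.factorial * Real.Gamma (k + ν + 1))

theorem norm_besselEntire_term_le {ν : ℝ} (hν : 0 ≤ ν) (s : ℝ) (k : ℕ) :
    ‖(-s) ^ k / (k.factorial * Real.Gamma (k + ν + 1))‖ ≤ 2 * (|s| ^ k / k.factorial) := by
  have hG := half_le_Gamma (x := k + ν + 1) (by linarith [k.cast_nonneg (α := ℝ)])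
  have hk : (0 : ℝ) < k.factorial := by exact_mod_cast k.factorial_pos
  rw [norm_div, norm_pow, norm_neg, Real.norm_eq_abs, Real.norm_of_nonneg (by positivity),
    div_le_iff₀ (by positivity)]
  have : 2 * (|s| ^ k / k.factorial) * (k.factorial * Real.Gamma (k + ν + 1))
      = |s| ^ k * (2 * Real.Gamma (k + ν + 1)) := by field_simp
  rw [this]
  exact le_mul_of_one_le_right (by positivity) (by linarith)

theorem summable_besselEntire {ν : ℝ} (hν : 0 ≤ ν) (s : ℝ) :
    Summable fun k : ℕ => (-s) ^ k / (k.factorial * Real.Gamma (k + ν + 1)) :=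
  Summable.of_norm_bounded ((Real.summable_pow_div_factorial |s|).mul_left 2)
    (norm_besselEntire_term_le hν s)

theorem besselJ_eq {ν t : ℝ} (ht : 0 < t) :
    besselJ ν t = (t / 2) ^ ν * besselEntire ν (t ^ 2 / 4) := by
  rw [besselJ, besselEntire, ← tsum_mul_left]
  congr 1
  ext k
  rw [Real.rpow_add (by positivity), show (2 * k : ℝ) = ((2 * k : ℕ) : ℝ) by push_cast; ring,
    Real.rpow_natCast, pow_mul, show (t / 2) ^ 2 = t ^ 2 / 4 by ring, neg_pow (t ^ 2 / 4)]
  ring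

theorem hasDerivAt_besselEntire {ν : ℝ} (hν : 0 ≤ ν) (s : ℝ) :
    HasDerivAt (besselEntire ν) (-besselEntire (ν + 1) s) s := by
  set R := |s| + 1
  have hR : 0 < R := by positivity
  have hu : Summable fun k : ℕ => 2 * ((k : ℝ) * R ^ (k - 1) / k.factorial) := by
    refine Summable.mul_left 2 ?_
    rw [← summable_nat_add_iff 1]
    refine (Real.summable_pow_div_factorial R).congr fun k => ?_
    rw [Nat.factorial_succ]
    have : (k.factorial : ℝ) ≠ 0 := by exact_mod_cast k.factorial_ne_zero
    push_cast
    field_simp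
  have key := hasDerivAt_tsum_of_isPreconnected (𝕜 := ℝ) (F := ℝ) (t := Metric.ball 0 R) (y₀ := s) (y := s)
    (g := fun (k : ℕ) (x : ℝ) => (-x) ^ k / (k.factorial * Real.Gamma (k + ν + 1)))
    (g' := fun (k : ℕ) (x : ℝ) => (k * (-x) ^ (k - 1) * (-1)) / (k.factorial * Real.Gamma (k + ν + 1)))
    hu Metric.isOpen_ball (convex_ball _ _).isPreconnected
    (fun k x _ => (((hasDerivAt_id x).neg.pow k).div_const _)) (fun k x hx => ?_)
    (by simp [R]) (summable_besselEntire hν s) (by simp [R])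
  · refine key.congr_deriv ?_
    have h0 : Summable fun k : ℕ => (k * (-s) ^ (k - 1) * (-1)) / (k.factorial * Real.Gamma (k + ν + 1)) := by
      rw [← summable_nat_add_iff 1]
      refine (summable_besselEntire (ν := ν + 1) (by linarith) s).neg.congr fun k => ?_
      rw [Nat.factorial_succ]
      have : (k.factorial : ℝ) ≠ 0 := by exact_mod_cast k.factorial_ne_zero
      push_cast
      rw [show (k : ℝ) + (ν + 1) + 1 = k + 1 + ν + 1 by ring]
      have := (Real.Gamma_pos_of_pos (s := k + 1 + ν + 1) (by positivity)).ne'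
      simp
      field_simp
    rw [h0.tsum_eq_zero_add, besselEntire, ← tsum_neg]
    simp only [Nat.cast_zero, zero_mul, zero_div, zero_add]
    congr 1
    ext k
    rw [Nat.factorial_succ]
    have : (k.factorial : ℝ) ≠ 0 := by exact_mod_cast k.factorial_ne_zero
    push_cast
    rw [show (k : ℝ) + (ν + 1) + 1 = k + 1 + ν + 1 by ring]
    have := (Real.Gamma_pos_of_pos (s := k + 1 + ν + 1) (by positivity)).ne'
    simp
    field_simp
  · have hG := half_le_Gamma (x := k + ν + 1) (by linarith [k.cast_nonneg (α := ℝ)])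
    have hk : (0 : ℝ) < k.factorial := by exact_mod_cast k.factorial_pos
    have hx' : |x| ≤ R := by
      rw [Metric.mem_ball, dist_zero_right, Real.norm_eq_abs] at hx
      exact hx.le
    rw [norm_div, norm_mul, norm_mul, norm_pow, norm_neg, norm_neg, norm_one, mul_one,
      Real.norm_natCast, Real.norm_eq_abs,
      Real.norm_of_nonneg (by positivity : 0 ≤ (k.factorial : ℝ) * Real.Gamma (k + ν + 1)),
      div_le_iff₀ (by positivity)]
    have : 2 * (k * R ^ (k - 1) / k.factorial) * (k.factorial * Real.Gamma (k + ν + 1))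
      = k * R ^ (k - 1) * (2 * Real.Gamma (k + ν + 1)) := by field_simp
    rw [this]
    calc k * |x| ^ (k - 1) ≤ k * R ^ (k - 1) := by gcongr
      _ ≤ _ := le_mul_of_one_le_right (by positivity) (by linarith)

theorem continuous_besselEntire {ν : ℝ} (hν : 0 ≤ ν) : Continuous (besselEntire ν) :=
  continuous_iff_continuousAt.2 fun s => (hasDerivAt_besselEntire hν s).continuousAt

theorem besselEntire_recurrence {ν : ℝ} (hν : 0 ≤ ν) (s : ℝ) :
    besselEntire ν s = (ν + 1) * besselEntire (ν + 1) s - s * besselEntire (ν + 2) s := by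
  have h2 : s * besselEntire (ν + 2) s = -∑' k : ℕ, k * ((-s) ^ k / (k.factorial * Real.Gamma (k + (ν + 1) + 1))) := by
    have e : ∀ k : ℕ, ((k + 1 : ℕ) : ℝ) * ((-s) ^ (k + 1) / ((k + 1).factorial * Real.Gamma ((k + 1 : ℕ) + (ν + 1) + 1)))
      = -s * ((-s) ^ k / (k.factorial * Real.Gamma (k + (ν + 2) + 1))) := fun k => by
      rw [Nat.factorial_succ]
      have : (k.factorial : ℝ) ≠ 0 := by exact_mod_cast k.factorial_ne_zero
      push_cast
      rw [show (k : ℝ) + (ν + 2) + 1 = k + 1 + (ν + 1) + 1 by ring]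
      have := (Real.Gamma_pos_of_pos (s := k + 1 + (ν + 1) + 1) (by positivity)).ne'
      field_simp
      ring
    have hs : Summable fun k : ℕ => (k : ℝ) * ((-s) ^ k / (k.factorial * Real.Gamma (k + (ν + 1) + 1))) := by
      rw [← summable_nat_add_iff 1]
      simp only [e]
      exact (summable_besselEntire (by linarith) s).mul_left _
    rw [hs.tsum_eq_zero_add]
    simp only [e, tsum_mul_left, besselEntire]
    simp
  have hs : Summable fun k : ℕ => (k : ℝ) * ((-s) ^ k / (k.factorial * Real.Gamma (k + (ν + 1) + 1))) := by
    have e : ∀ k : ℕ, (k : ℝ) * ((-s) ^ k / (k.factorial * Real.Gamma (k + (ν + 1) + 1)))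
        = (-s) ^ k / (k.factorial * Real.Gamma (k + ν + 1)) - (ν + 1) * ((-s) ^ k / (k.factorial * Real.Gamma (k + (ν + 1) + 1))) := fun k => by
      have hp : 0 < (k : ℝ) + ν + 1 := by positivity
      rw [show (k : ℝ) + (ν + 1) + 1 = (k + ν + 1) + 1 by ring, Real.Gamma_add_one hp.ne']
      have := (Real.Gamma_pos_of_pos hp).ne'
      have : (k.factorial : ℝ) ≠ 0 := by exact_mod_cast k.factorial_ne_zero
      field_simp
      ring
    simp only [e]
    exact (summable_besselEntire hν s).sub ((summable_besselEntire (by linarith) s).mul_left _)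
  rw [h2, besselEntire, besselEntire, sub_neg_eq_add, ← tsum_mul_left,
    ← Summable.tsum_add ((summable_besselEntire (ν := ν + 1) (by linarith) s).mul_left _) hs]
  congr 1
  ext k
  have hp : 0 < (k : ℝ) + ν + 1 := by positivity
  rw [show (k : ℝ) + (ν + 1) + 1 = (k + ν + 1) + 1 by ring, Real.Gamma_add_one hp.ne']
  have := (Real.Gamma_pos_of_pos hp).ne'
  have : (k.factorial : ℝ) ≠ 0 := by exact_mod_cast k.factorial_ne_zero
  field_simp
  ring

theorem besselJ_add_besselJ {ν t : ℝ} (hν : 0 ≤ ν) (ht : 0 < t) :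
    besselJ ν t + besselJ (ν + 2) t = 2 * (ν + 1) / t * besselJ (ν + 1) t := by
  have h2 : 0 < t / 2 := by positivity
  rw [besselJ_eq ht, besselJ_eq ht, besselJ_eq ht, besselEntire_recurrence hν,
    Real.rpow_add h2, Real.rpow_add h2, Real.rpow_one, Real.rpow_two]
  field_simp
  ring

/-- The logarithmic derivative `t J_ν'(t)` of the Bessel function, in terms of the series. -/
noncomputable def besselLogDeriv (ν t : ℝ) : ℝ := ν * besselJ ν t - t * besselJ (ν + 1) t

theorem hasDerivAt_besselJ {ν t : ℝ} (hν : 0 ≤ ν) (ht : 0 < t) :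
    HasDerivAt (besselJ ν) (besselLogDeriv ν t / t) t := by
  have h2 : 0 < t / 2 := by positivity
  have h1 : HasDerivAt (fun x : ℝ => (x / 2) ^ ν * besselEntire ν (x ^ 2 / 4))
      ((1 / 2 * ν * (t / 2) ^ (ν - 1)) * besselEntire ν (t ^ 2 / 4)
        + (t / 2) ^ ν * (-besselEntire (ν + 1) (t ^ 2 / 4) * (2 * t / 4))) t := by
    refine HasDerivAt.mul ?_ ?_
    · exact ((hasDerivAt_id t).div_const 2).rpow_const (Or.inl h2.ne')
    · have h3 : HasDerivAt (fun x : ℝ => x ^ 2 / 4) (2 * t / 4) t := by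
        simpa using (hasDerivAt_pow 2 t).div_const 4
      exact (hasDerivAt_besselEntire hν (t ^ 2 / 4)).comp t h3
  have h4 : besselLogDeriv ν t / t = (1 / 2 * ν * (t / 2) ^ (ν - 1)) * besselEntire ν (t ^ 2 / 4)
        + (t / 2) ^ ν * (-besselEntire (ν + 1) (t ^ 2 / 4) * (2 * t / 4)) := by
    rw [besselLogDeriv, besselJ_eq ht, besselJ_eq ht, Real.rpow_add h2, Real.rpow_sub h2,
      Real.rpow_one]
    field_simp
    ring
  rw [h4]
  refine h1.congr_of_eventuallyEq ?_
  filter_upwards [eventually_gt_nhds ht] with x hx using besselJ_eq hx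

/-- Bessel's equation `(t d/dt)² J_ν = (ν² - t²) J_ν` in first-order form. Together with
`hasDerivAt_besselJ` it is the system for `(J_ν, t J_ν')` behind every monotonicity argument below.
-/
theorem hasDerivAt_besselLogDeriv {ν t : ℝ} (hν : 0 ≤ ν) (ht : 0 < t) :
    HasDerivAt (besselLogDeriv ν) ((ν ^ 2 - t ^ 2) * besselJ ν t / t) t := by
  have h := ((hasDerivAt_besselJ hν ht).const_mul ν).sub
    ((hasDerivAt_id t).mul (hasDerivAt_besselJ (ν := ν + 1) (by linarith) ht))
  refine h.congr_deriv ?_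
  have hr := besselJ_add_besselJ hν ht
  have hr' : besselJ (ν + 1 + 1) t = 2 * (ν + 1) / t * besselJ (ν + 1) t - besselJ ν t := by
    rw [add_assoc, one_add_one_eq_two]; linarith
  simp only [besselLogDeriv, hr', id]
  field_simp
  ring

/-- `J_ν` is positive near `0`, and there `t J_ν' > c J_ν` for every `c < ν`. -/
theorem eventually_besselJ_pos {ν c : ℝ} (hν : 0 ≤ ν) (hc : c < ν) :
    ∀ᶠ t in 𝓝[>] (0 : ℝ), 0 < besselJ ν t ∧ c * besselJ ν t < besselLogDeriv ν t := by
  have hcont : Continuous fun t : ℝ => (ν - c) * besselEntire ν (t ^ 2 / 4)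
      - t ^ 2 / 2 * besselEntire (ν + 1) (t ^ 2 / 4) := by
    have h1 := continuous_besselEntire hν
    have h2 := continuous_besselEntire (ν := ν + 1) (by linarith)
    fun_prop
  have hcont' : Continuous fun t : ℝ => besselEntire ν (t ^ 2 / 4) := by
    have h1 := continuous_besselEntire hν
    fun_prop
  have h0 : 0 < besselEntire ν 0 := by
    rw [besselEntire, tsum_eq_single 0 (fun k hk => by simp [hk])]
    have := Real.Gamma_pos_of_pos (s := ν + 1) (by linarith)
    simpa using this
  have e1 : ∀ᶠ t in 𝓝 (0 : ℝ), 0 < besselEntire ν (t ^ 2 / 4) :=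
    hcont'.continuousAt.eventually_const_lt (by simpa using h0)
  have e2 : ∀ᶠ t in 𝓝 (0 : ℝ), 0 < (ν - c) * besselEntire ν (t ^ 2 / 4)
      - t ^ 2 / 2 * besselEntire (ν + 1) (t ^ 2 / 4) :=
    hcont.continuousAt.eventually_const_lt (by simpa using mul_pos (sub_pos.2 hc) h0)
  filter_upwards [e1.filter_mono nhdsWithin_le_nhds, e2.filter_mono nhdsWithin_le_nhds,
    self_mem_nhdsWithin] with t h1 h2 ht
  have ht : 0 < t := ht
  have hp : 0 < (t / 2) ^ ν := by positivity
  refine ⟨by rw [besselJ_eq ht]; positivity, ?_⟩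
  rw [besselLogDeriv, besselJ_eq ht, besselJ_eq ht, Real.rpow_add (by positivity), Real.rpow_one]
  nlinarith [mul_pos hp h2]

/-! ### Poisson's integral and the asymptotics of `J_ν` at infinity -/

theorem integral_rpow_mul_one_sub_rpow {u v : ℝ} (hu : 0 < u) (hv : 0 < v) :
    ∫ x in (0 : ℝ)..1, x ^ (u - 1) * (1 - x) ^ (v - 1)
      = Real.Gamma u * Real.Gamma v / Real.Gamma (u + v) := by
  have h := Complex.betaIntegral_eq_Gamma_mul_div (u : ℂ) (v : ℂ) (by simpa) (by simpa)
  rw [← Complex.ofReal_add, Complex.Gamma_ofReal, Complex.Gamma_ofReal, Complex.Gamma_ofReal,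
    Complex.betaIntegral] at h
  apply Complex.ofReal_injective
  push_cast
  rw [← h, ← intervalIntegral.integral_ofReal]
  refine intervalIntegral.integral_congr fun x hx => ?_
  rw [uIcc_of_le zero_le_one] at hx
  push_cast
  rw [Complex.ofReal_cpow hx.1, Complex.ofReal_cpow (by linarith [hx.2])]
  push_cast
  rfl

/-- The substitution `x = s²` on the half interval turns this into a Beta integral. These are the
moments needed to integrate the cosine series termwise. -/
theorem integral_pow_mul_one_sub_sq_rpow {α : ℝ} (hα : 0 < α) (k : ℕ) :
    ∫ s in (-1 : ℝ)..1, s ^ (2 * k) * (1 - s ^ 2) ^ α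
      = Real.Gamma (k + 1 / 2) * Real.Gamma (α + 1) / Real.Gamma (k + α + 3 / 2) := by
  have hc : Continuous fun s : ℝ => s ^ (2 * k) * (1 - s ^ 2) ^ α :=
    (continuous_pow _).mul ((by fun_prop : Continuous fun s : ℝ => 1 - s ^ 2).rpow_const
      fun _ => Or.inr hα.le)
  have heven : ∫ s in (-1 : ℝ)..1, s ^ (2 * k) * (1 - s ^ 2) ^ α
      = 2 * ∫ s in (0 : ℝ)..1, s ^ (2 * k) * (1 - s ^ 2) ^ α := by
    rw [← intervalIntegral.integral_add_adjacent_intervals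
      (hc.intervalIntegrable (-1) 0) (hc.intervalIntegrable 0 1)]
    have := intervalIntegral.integral_comp_neg (a := 0) (b := 1)
      fun s : ℝ => s ^ (2 * k) * (1 - s ^ 2) ^ α
    rw [neg_zero] at this
    rw [← this]
    simp only [(even_two_mul k).neg_pow, even_two.neg_pow]
    ring
  have hpt : ∀ s : ℝ, 0 < s → ((fun x : ℝ => x ^ ((k : ℝ) + 1 / 2 - 1) * (1 - x) ^ (α + 1 - 1)) ∘
      fun x : ℝ => x ^ 2) s * (2 * s) = 2 * (s ^ (2 * k) * (1 - s ^ 2) ^ α) := fun s hs0 => by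
    simp only [Function.comp_apply]
    rw [← Real.rpow_natCast_mul hs0.le, add_sub_cancel_right]
    have : s ^ (2 * k) = s ^ (((2 : ℕ) : ℝ) * ((k : ℝ) + 1 / 2 - 1)) * s := by
      nth_rw 3 [← Real.rpow_one s]
      rw [← Real.rpow_add hs0, ← Real.rpow_natCast]
      congr 1
      push_cast
      ring
    rw [this]
    ring
  have hsub := intervalIntegral.integral_comp_mul_deriv''' (a := 0) (b := 1)
    (f := fun x : ℝ => x ^ 2) (f' := fun x => 2 * x)
    (g := fun x : ℝ => x ^ ((k : ℝ) + 1 / 2 - 1) * (1 - x) ^ (α + 1 - 1))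
    (by fun_prop) (fun x _ => by simpa using (hasDerivAt_pow 2 x).hasDerivWithinAt) ?_ ?_ ?_
  · rw [heven, ← intervalIntegral.integral_const_mul]
    have hb := integral_rpow_mul_one_sub_rpow (u := k + 1 / 2) (v := α + 1) (by positivity)
      (by positivity)
    rw [show (k : ℝ) + α + 3 / 2 = k + 1 / 2 + (α + 1) by ring, ← hb]
    rw [show ((0 : ℝ) ^ 2) = 0 by norm_num, one_pow] at hsub
    rw [← hsub]
    refine intervalIntegral.integral_congr_ae (ae_of_all _ fun s hs => ?_)
    rw [uIoc_of_le zero_le_one] at hs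
    exact (hpt s hs.1).symm
  · refine ContinuousOn.mul (fun x hx => ?_) (Continuous.continuousOn
      ((by fun_prop : Continuous fun s : ℝ => 1 - s).rpow_const fun _ => Or.inr (by linarith)))
    obtain ⟨y, hy, rfl⟩ := hx
    have : (0 : ℝ) < y := by simpa using hy.1
    exact (Real.continuousAt_rpow_const _ _ (Or.inl (by positivity))).continuousWithinAt
  · have hI : IntervalIntegrable (fun x : ℝ => x ^ ((k : ℝ) + 1 / 2 - 1) * (1 - x) ^ (α + 1 - 1))
        volume 0 1 :=
      (intervalIntegral.intervalIntegrable_rpow' (by linarith [k.cast_nonneg (α := ℝ)])).mul_continuousOn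
        (Continuous.continuousOn
          ((by fun_prop : Continuous fun s : ℝ => 1 - s).rpow_const fun _ => Or.inr (by linarith)))
    rw [intervalIntegrable_iff_integrableOn_Icc_of_le zero_le_one] at hI
    refine hI.mono_set ?_
    rintro _ ⟨y, hy, rfl⟩
    rw [uIcc_of_le zero_le_one] at hy
    exact ⟨by positivity, pow_le_one₀ hy.1 hy.2⟩
  · rw [uIcc_of_le zero_le_one, integrableOn_Icc_iff_integrableOn_Ioc]
    refine ((hc.const_mul 2).integrableOn_Ioc).congr_fun (fun s hs => (hpt s hs.1).symm)
      measurableSet_Ioc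

/-- The duplication formula at half-integers, which converts the cosine coefficients `1/(2k)!` into
those of the Bessel series. -/
theorem factorial_two_mul_mul_sqrt_pi (k : ℕ) :
    ((2 * k).factorial : ℝ) * √Real.pi = 4 ^ k * k.factorial * Real.Gamma (k + 1 / 2) := by
  induction k with
  | zero => simpa using Real.Gamma_one_half_eq.symm
  | succ k ih =>
    rw [show 2 * (k + 1) = 2 * k + 1 + 1 by ring, Nat.factorial_succ, Nat.factorial_succ,
      Nat.factorial_succ]
    push_cast
    rw [show (k : ℝ) + 1 + 1 / 2 = (k + 1 / 2) + 1 by ring, Real.Gamma_add_one (by positivity),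
      mul_assoc, mul_assoc, ih]
    ring

/-- Poisson's integral representation. -/
theorem integral_one_sub_sq_rpow_mul_cos {α : ℝ} (hα : 0 < α) (t : ℝ) :
    ∫ s in (-1 : ℝ)..1, (1 - s ^ 2) ^ α * Real.cos (t * s)
      = √Real.pi * Real.Gamma (α + 1) * besselEntire (α + 1 / 2) (t ^ 2 / 4) := by
  have hw : Continuous fun s : ℝ => (1 - s ^ 2) ^ α :=
    (by fun_prop : Continuous fun s : ℝ => 1 - s ^ 2).rpow_const fun _ => Or.inr hα.le
  have hs := intervalIntegral.hasSum_integral_of_dominated_convergence (μ := volume)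
    (a := -1) (b := 1) (F := fun (k : ℕ) (s : ℝ) =>
      (1 - s ^ 2) ^ α * ((-1) ^ k * (t * s) ^ (2 * k) / (2 * k).factorial))
    (f := fun s => (1 - s ^ 2) ^ α * Real.cos (t * s))
    (fun k _ => |t| ^ (2 * k) / (2 * k).factorial) ?_ ?_ ?_ ?_ ?_
  · rw [← hs.tsum_eq, besselEntire, ← tsum_mul_left]
    congr 1
    ext k
    have e : ∀ s : ℝ, (1 - s ^ 2) ^ α * ((-1) ^ k * (t * s) ^ (2 * k) / (2 * k).factorial)
        = ((-1) ^ k * t ^ (2 * k) / (2 * k).factorial) * (s ^ (2 * k) * (1 - s ^ 2) ^ α) := fun s => by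
      rw [mul_pow]; ring
    simp only [e, intervalIntegral.integral_const_mul]
    rw [integral_pow_mul_one_sub_sq_rpow hα]
    have h := factorial_two_mul_mul_sqrt_pi k
    have h1 : ((2 * k).factorial : ℝ) ≠ 0 := by exact_mod_cast (2 * k).factorial_ne_zero
    have h2 : (k.factorial : ℝ) ≠ 0 := by exact_mod_cast k.factorial_ne_zero
    have h3 := (Real.Gamma_pos_of_pos (s := k + α + 3 / 2) (by positivity)).ne'
    rw [show (k : ℝ) + (α + 1 / 2) + 1 = k + α + 3 / 2 by ring,
      show (-(t ^ 2 / 4)) ^ k = (-1) ^ k * t ^ (2 * k) / 4 ^ k by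
        rw [neg_pow, div_pow, ← pow_mul]; ring]
    rw [show Real.Gamma ((k : ℝ) + 1 / 2) = (2 * k).factorial * √Real.pi / (4 ^ k * k.factorial) by
      rw [eq_div_iff (by positivity), h]; ring]
    field_simp
  · exact fun k => (hw.mul (by fun_prop)).aestronglyMeasurable
  · refine fun k => ae_of_all _ fun s hs => ?_
    rw [uIoc_of_le (by norm_num)] at hs
    have hs1 : |s| ≤ 1 := abs_le.2 ⟨hs.1.le, hs.2⟩
    have hs2 : s ^ 2 ≤ 1 := by rwa [sq_le_one_iff_abs_le_one]
    have hw1 : (1 - s ^ 2) ^ α ≤ 1 := Real.rpow_le_one (by linarith) (by nlinarith [sq_nonneg s]) hα.le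
    have hw0 : 0 ≤ (1 - s ^ 2) ^ α := Real.rpow_nonneg (by linarith) _
    rw [norm_mul, Real.norm_of_nonneg hw0, norm_div, norm_mul, norm_pow, norm_neg, norm_one, one_pow,
      one_mul, norm_pow, norm_mul, Real.norm_natCast, Real.norm_eq_abs, Real.norm_eq_abs]
    refine (mul_le_of_le_one_left (by positivity) hw1).trans ?_
    gcongr
    exact mul_le_of_le_one_right (abs_nonneg _) hs1
  · refine ae_of_all _ fun s _ => ?_
    exact (Real.summable_pow_div_factorial |t|).comp_injective
      (mul_right_injective₀ (two_ne_zero' ℕ))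
  · exact intervalIntegrable_const
  · refine ae_of_all _ fun s _ => (Real.hasSum_cos (t * s)).mul_left _

theorem ofReal_mul_cpow {y : ℝ} (hy : 0 < y) {z : ℂ} (hz : z ≠ 0) (α : ℝ) :
    ((y : ℂ) * z) ^ (α : ℂ) = ((y ^ α : ℝ) : ℂ) * z ^ (α : ℂ) := by
  have hy' : (y : ℂ) ≠ 0 := by exact_mod_cast hy.ne'
  rw [Complex.cpow_def_of_ne_zero (mul_ne_zero hy' hz), Complex.cpow_def_of_ne_zero hz,
    Complex.log_ofReal_mul hy hz, Complex.ofReal_cpow hy.le, Complex.cpow_def_of_ne_zero hy',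
    Complex.ofReal_log hy.le, ← Complex.exp_add, add_mul]

/-- Laplace's method at an end point: the leading term of
`∫_0^1 (y² + 2cy)^α e^{-ty} dy` as `t → ∞`. -/
theorem tendsto_laplace_endpoint {α : ℝ} (hα : 0 < α) {c : ℂ} (hc : c ∈ Complex.slitPlane) :
    Tendsto (fun t : ℝ => ((t ^ (α + 1) : ℝ) : ℂ) *
        ∫ y in (0 : ℝ)..1, ((y : ℂ) * (y + c)) ^ (α : ℂ) * Complex.exp (-(t * y)))
      atTop (𝓝 (c ^ (α : ℂ) * Real.Gamma (α + 1))) := by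
  -- The integrand after `u = ty`, extended by zero beyond `u = t`. On its support `|u/t + c| ≤ 1 +
  -- |c|`, which supplies the dominating Gamma integrand.
  set F : ℝ → ℝ → ℂ := fun t u =>
    (Iic t).indicator (fun u => ((u ^ α * Real.exp (-u) : ℝ) : ℂ) * ((u / t : ℝ) + c) ^ (α : ℂ)) u
  have hcc : ∀ r : ℝ, 0 ≤ r → 0 ≤ ((r : ℂ) + c).re ∨ ((r : ℂ) + c).im ≠ 0 := fun r hr => by
    rcases hc with h | h
    · left; simp only [Complex.add_re, Complex.ofReal_re]; linarith
    · right; simpa using h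
  have h1 : ∀ t : ℝ, 0 < t → ((t ^ (α + 1) : ℝ) : ℂ) *
        ∫ y in (0 : ℝ)..1, ((y : ℂ) * (y + c)) ^ (α : ℂ) * Complex.exp (-(t * y))
        = ∫ u in Ioi (0 : ℝ), F t u := fun t ht => by
    have h2 := intervalIntegral.integral_comp_div (a := 0) (b := t)
      (fun y : ℝ => ((y : ℂ) * (y + c)) ^ (α : ℂ) * Complex.exp (-(t * y))) ht.ne'
    rw [zero_div, div_self ht.ne'] at h2
    rw [Real.rpow_add_one ht.ne', Complex.ofReal_mul, mul_assoc, ← Complex.real_smul (x := t), ← h2,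
      ← intervalIntegral.integral_const_mul, intervalIntegral.integral_of_le ht.le]
    simp only [F]
    rw [setIntegral_indicator measurableSet_Iic, Ioi_inter_Iic]
    refine setIntegral_congr_fun measurableSet_Ioc fun u hu => ?_
    have hu0 : 0 < u := hu.1
    have hz : ((u / t : ℝ) : ℂ) + c ≠ 0 := by
      intro h0
      have hre : ((u / t : ℝ) : ℂ).re + c.re = 0 := by rw [← Complex.add_re, h0]; rfl
      have him : ((u / t : ℝ) : ℂ).im + c.im = 0 := by rw [← Complex.add_im, h0]; rfl
      rw [Complex.ofReal_re] at hre
      rw [Complex.ofReal_im] at him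
      rcases hc with h | h
      · have : 0 < u / t := by positivity
        linarith
      · exact h (by linarith)
    rw [ofReal_mul_cpow (div_pos hu0 ht) hz, ← mul_assoc, ← mul_assoc, ← Complex.ofReal_mul,
      Real.div_rpow hu0.le ht.le, mul_div_cancel₀ _ (by positivity : t ^ α ≠ 0)]
    have : (t : ℂ) * ((u / t : ℝ) : ℂ) = u := by
      rw [← Complex.ofReal_mul, mul_div_cancel₀ _ ht.ne']
    rw [this]
    push_cast
    ring
  refine Tendsto.congr' ((eventually_gt_atTop 0).mono fun t ht => (h1 t ht).symm) ?_
  have hlim : c ^ (α : ℂ) * Real.Gamma (α + 1)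
      = ∫ u in Ioi (0 : ℝ), ((u ^ α * Real.exp (-u) : ℝ) : ℂ) * c ^ (α : ℂ) := by
    rw [integral_mul_const, integral_complex_ofReal, Real.Gamma_eq_integral (by linarith),
      mul_comm]
    congr 2
    refine setIntegral_congr_fun measurableSet_Ioi fun u _ => ?_
    rw [add_sub_cancel_right, mul_comm]
  rw [hlim]
  refine tendsto_integral_filter_of_dominated_convergence
    (fun u => (u ^ α * Real.exp (-u)) * (1 + ‖c‖) ^ α) ?_ ?_ ?_ ?_
  · refine (eventually_gt_atTop 0).mono fun t ht => ?_
    refine (AEStronglyMeasurable.indicator ?_ measurableSet_Iic)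
    refine ContinuousOn.aestronglyMeasurable (fun u hu => ?_) measurableSet_Ioi
    refine ContinuousAt.continuousWithinAt ?_
    have hu0 : (0 : ℝ) < u := hu
    refine ContinuousAt.mul ?_ ?_
    · exact Complex.continuous_ofReal.continuousAt.comp
        ((Real.continuousAt_rpow_const _ _ (Or.inl hu0.ne')).mul (by fun_prop))
    · exact (Complex.continuousAt_cpow_const_of_re_pos (hcc _ (by positivity)) (by simpa)).comp
        (f := fun u : ℝ => ((u / t : ℝ) : ℂ) + c) (by fun_prop)
  · refine (eventually_gt_atTop 0).mono fun t ht => ?_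
    refine (ae_restrict_mem measurableSet_Ioi).mono fun u hu => ?_
    have hu0 : (0 : ℝ) < u := hu
    simp only [F]
    by_cases hut : u ∈ Iic t
    · rw [indicator_of_mem hut, norm_mul, Complex.norm_real, Real.norm_of_nonneg (by positivity),
        Complex.norm_cpow_real]
      gcongr
      refine (norm_add_le _ _).trans ?_
      gcongr
      rw [Complex.norm_real, Real.norm_of_nonneg (by positivity)]
      exact (div_le_one ht).2 hut
    · rw [indicator_of_notMem hut, norm_zero]
      positivity
  · refine Integrable.mul_const ?_ _
    refine (Real.GammaIntegral_convergent (s := α + 1) (by linarith)).congr ?_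
    refine (ae_restrict_mem measurableSet_Ioi).mono fun u _ => ?_
    beta_reduce
    rw [add_sub_cancel_right, mul_comm]
  · refine (ae_restrict_mem measurableSet_Ioi).mono fun u hu => ?_
    have h3 : Tendsto (fun t : ℝ => ((u ^ α * Real.exp (-u) : ℝ) : ℂ) * ((u / t : ℝ) + c) ^ (α : ℂ))
        atTop (𝓝 (((u ^ α * Real.exp (-u) : ℝ) : ℂ) * c ^ (α : ℂ))) := by
      refine Tendsto.const_mul _ ?_
      have h4 : Tendsto (fun t : ℝ => ((u / t : ℝ) : ℂ) + c) atTop (𝓝 c) := by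
        have : Tendsto (fun t : ℝ => ((u / t : ℝ) : ℂ)) atTop (𝓝 ((0 : ℝ) : ℂ)) :=
          (Complex.continuous_ofReal.tendsto 0).comp (tendsto_const_nhds.div_atTop tendsto_id)
        simpa using this.add_const c
      exact (continuousAt_cpow_const hc).tendsto.comp h4
    refine h3.congr' ((eventually_ge_atTop u).mono fun t ht => ?_)
    simp only [F]
    rw [indicator_of_mem (show u ∈ Iic t from ht)]

/-- Cauchy's theorem on the rectangle with corners `±1`, `±1 + i`. There `Re(1 - z²) = 1 - x² + y² ≥
0`, so the principal branch is admissible, and on the vertical sides `1 - (±1 + iy)² = y(y ∓ 2i)`.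
-/
theorem integral_one_sub_sq_cpow_contour {α : ℝ} (hα : 0 < α) (t : ℝ) :
    (∫ x in (-1 : ℝ)..1, (1 - (x : ℂ) ^ 2) ^ (α : ℂ) * Complex.exp (Complex.I * (t * x)))
      = (∫ x in (-1 : ℝ)..1, (1 - ((x : ℂ) + Complex.I) ^ 2) ^ (α : ℂ) *
          Complex.exp (Complex.I * (t * (x + Complex.I))))
        - Complex.I * Complex.exp (Complex.I * t) *
          (∫ y in (0 : ℝ)..1, ((y : ℂ) * (y + -(2 * Complex.I))) ^ (α : ℂ) * Complex.exp (-(t * y)))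
        + Complex.I * Complex.exp (-(Complex.I * t)) *
          (∫ y in (0 : ℝ)..1, ((y : ℂ) * (y + 2 * Complex.I)) ^ (α : ℂ) * Complex.exp (-(t * y))) := by
  have hre : ∀ z : ℂ, (1 - z ^ 2).re = 1 - z.re ^ 2 + z.im ^ 2 := fun z => by
    simp [pow_two]; ring
  have h := Complex.integral_boundary_rect_eq_zero_of_continuousOn_of_differentiableOn
    (fun z : ℂ => (1 - z ^ 2) ^ (α : ℂ) * Complex.exp (Complex.I * (t * z)))
    (-1) (1 + Complex.I) ?_ ?_
  · simp only [Complex.neg_re, Complex.one_re, Complex.add_re, Complex.I_re, add_zero,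
      Complex.neg_im, Complex.one_im, neg_zero, Complex.add_im, Complex.I_im, zero_add,
      Complex.ofReal_zero, zero_mul, Complex.ofReal_one, one_mul, smul_eq_mul,
      Complex.ofReal_neg] at h
    have e1 : ∀ y : ℝ, (1 - ((1 : ℂ) + y * Complex.I) ^ 2) ^ (α : ℂ) *
        Complex.exp (Complex.I * (t * (1 + y * Complex.I)))
        = Complex.exp (Complex.I * t) *
          (((y : ℂ) * (y + -(2 * Complex.I))) ^ (α : ℂ) * Complex.exp (-(t * y))) := fun y => by
      rw [show (1 - ((1 : ℂ) + y * Complex.I) ^ 2) = (y : ℂ) * (y + -(2 * Complex.I)) by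
          ring_nf; rw [Complex.I_sq]; ring,
        show Complex.I * (t * (1 + y * Complex.I)) = Complex.I * t + -(t * y) by
          ring_nf; rw [Complex.I_sq]; ring, Complex.exp_add]
      ring
    have e2 : ∀ y : ℝ, (1 - (-(1 : ℂ) + y * Complex.I) ^ 2) ^ (α : ℂ) *
        Complex.exp (Complex.I * (t * (-1 + y * Complex.I)))
        = Complex.exp (-(Complex.I * t)) *
          (((y : ℂ) * (y + 2 * Complex.I)) ^ (α : ℂ) * Complex.exp (-(t * y))) := fun y => by
      rw [show (1 - (-(1 : ℂ) + y * Complex.I) ^ 2) = (y : ℂ) * (y + 2 * Complex.I) by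
          ring_nf; rw [Complex.I_sq]; ring,
        show Complex.I * (t * (-1 + y * Complex.I)) = -(Complex.I * t) + -(t * y) by
          ring_nf; rw [Complex.I_sq]; ring, Complex.exp_add]
      ring
    simp only [e1, e2, intervalIntegral.integral_const_mul] at h
    linear_combination h
  · refine fun z hz => ContinuousAt.continuousWithinAt (ContinuousAt.mul ?_ (by fun_prop))
    refine (Complex.continuousAt_cpow_const_of_re_pos (Or.inl ?_) (by simpa)).comp
      (f := fun z : ℂ => 1 - z ^ 2) (by fun_prop)
    have h1 : z.re ∈ Icc (-1 : ℝ) 1 := by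
      have := hz.1
      simpa [uIcc_of_le] using this
    rw [hre]
    nlinarith [h1.1, h1.2, sq_nonneg z.im]
  · refine fun z hz => DifferentiableAt.differentiableWithinAt (DifferentiableAt.mul ?_ (by fun_prop))
    refine DifferentiableAt.cpow_const (by fun_prop) (Or.inl ?_)
    have h1 : z.re ∈ Ioo (-1 : ℝ) 1 := by
      have := hz.1
      simpa using this
    rw [hre]
    nlinarith [h1.1, h1.2, sq_nonneg z.im]

theorem two_mul_I_cpow (α : ℝ) :
    (2 * Complex.I) ^ (α : ℂ) = ((2 ^ α : ℝ) : ℂ) * Complex.exp (Complex.I * (Real.pi * α / 2 : ℝ)) := by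
  have := ofReal_mul_cpow (y := 2) two_pos Complex.I_ne_zero α
  rw [Complex.ofReal_ofNat] at this
  rw [this, Complex.cpow_def_of_ne_zero Complex.I_ne_zero, Complex.log_I]
  congr 2
  push_cast
  ring

theorem neg_two_mul_I_cpow (α : ℝ) :
    (-(2 * Complex.I)) ^ (α : ℂ)
      = ((2 ^ α : ℝ) : ℂ) * Complex.exp (-(Complex.I * (Real.pi * α / 2 : ℝ))) := by
  have := ofReal_mul_cpow (y := 2) two_pos (neg_ne_zero.2 Complex.I_ne_zero) α
  rw [Complex.ofReal_ofNat] at this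
  rw [← mul_neg, this, Complex.cpow_def_of_ne_zero (neg_ne_zero.2 Complex.I_ne_zero),
    Complex.log_neg_I]
  congr 2
  push_cast
  ring

/-- In the contour formula the top side carries a factor `e^{-t}`, and the two vertical sides are
the Laplace integrals with `c = ∓2i`. Their conjugate phases add up to the cosine. -/
theorem tendsto_poisson_integral {α : ℝ} (hα : 0 < α) :
    Tendsto (fun t : ℝ => t ^ (α + 1) * (∫ s in (-1 : ℝ)..1, (1 - s ^ 2) ^ α * Real.cos (t * s))
      - 2 * 2 ^ α * Real.Gamma (α + 1) * Real.cos (t - Real.pi * α / 2 - Real.pi / 2)) atTop (𝓝 0) := by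
  set L₁ : ℝ → ℂ := fun t => ((t ^ (α + 1) : ℝ) : ℂ) *
    ∫ y in (0 : ℝ)..1, ((y : ℂ) * (y + -(2 * Complex.I))) ^ (α : ℂ) * Complex.exp (-(t * y))
  set L₂ : ℝ → ℂ := fun t => ((t ^ (α + 1) : ℝ) : ℂ) *
    ∫ y in (0 : ℝ)..1, ((y : ℂ) * (y + 2 * Complex.I)) ^ (α : ℂ) * Complex.exp (-(t * y))
  set T : ℝ → ℂ := fun t => ((t ^ (α + 1) : ℝ) : ℂ) *
    ∫ x in (-1 : ℝ)..1, (1 - ((x : ℂ) + Complex.I) ^ 2) ^ (α : ℂ) *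
          Complex.exp (Complex.I * (t * (x + Complex.I)))
  have h1 := tendsto_laplace_endpoint hα (c := -(2 * Complex.I)) (Or.inr (by simp))
  have h2 := tendsto_laplace_endpoint hα (c := 2 * Complex.I) (Or.inr (by simp))
  have hT : Tendsto T atTop (𝓝 0) := by
    refine squeeze_zero_norm' (a := fun t => (t ^ (α + 1) * Real.exp (-1 * t)) *
      ∫ x in (-1 : ℝ)..1, ‖(1 - ((x : ℂ) + Complex.I) ^ 2) ^ (α : ℂ)‖) ?_ ?_
    · refine (eventually_gt_atTop 0).mono fun t ht => ?_
      simp only [T]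
      rw [norm_mul, Complex.norm_real, Real.norm_of_nonneg (by positivity), mul_assoc]
      gcongr
      refine (intervalIntegral.norm_integral_le_integral_norm (by norm_num)).trans (le_of_eq ?_)
      rw [← intervalIntegral.integral_const_mul]
      refine intervalIntegral.integral_congr fun x _ => ?_
      simp only [norm_mul, Complex.norm_exp]
      rw [mul_comm]
      congr 2
      simp
    · have := (tendsto_rpow_mul_exp_neg_mul_atTop_nhds_zero (α + 1) 1 one_pos).mul_const
        (∫ x in (-1 : ℝ)..1, ‖(1 - ((x : ℂ) + Complex.I) ^ 2) ^ (α : ℂ)‖)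
      rwa [zero_mul] at this
  have hb : ∀ z : ℝ → ℂ, Tendsto z atTop (𝓝 0) → ∀ e : ℝ → ℂ, (∀ t, ‖e t‖ = 1) →
      Tendsto (fun t => e t * z t) atTop (𝓝 0) := fun z hz e he => by
    rw [tendsto_zero_iff_norm_tendsto_zero] at hz ⊢
    simpa only [norm_mul, he, one_mul] using hz
  have hn1 : ∀ t : ℝ, ‖-(Complex.I * Complex.exp (Complex.I * t))‖ = 1 := fun t => by
    rw [norm_neg, norm_mul, Complex.norm_I, one_mul, mul_comm, Complex.norm_exp_ofReal_mul_I]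
  have hn2 : ∀ t : ℝ, ‖Complex.I * Complex.exp (-(Complex.I * t))‖ = 1 := fun t => by
    rw [norm_mul, Complex.norm_I, one_mul, ← mul_neg, mul_comm, ← Complex.ofReal_neg,
      Complex.norm_exp_ofReal_mul_I]
  have h3 := (hT.add (hb _ (tendsto_sub_nhds_zero_iff.2 h1) _ hn1)).add
    (hb _ (tendsto_sub_nhds_zero_iff.2 h2) _ hn2)
  rw [add_zero, add_zero] at h3
  have h4 := (Complex.continuous_re.tendsto 0).comp h3
  rw [Complex.zero_re] at h4
  refine h4.congr fun t => ?_
  have hC : (∫ s in (-1 : ℝ)..1, (1 - s ^ 2) ^ α * Real.cos (t * s))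
      = (∫ x in (-1 : ℝ)..1, (1 - (x : ℂ) ^ 2) ^ (α : ℂ) * Complex.exp (Complex.I * (t * x))).re := by
    have hint : IntervalIntegrable (fun x : ℝ => (1 - (x : ℂ) ^ 2) ^ (α : ℂ) *
        Complex.exp (Complex.I * (t * x))) volume (-1) 1 := by
      refine ContinuousOn.intervalIntegrable fun x hx => ContinuousAt.continuousWithinAt
        (ContinuousAt.mul ?_ (by fun_prop))
      rw [uIcc_of_le (by norm_num)] at hx
      refine (Complex.continuousAt_cpow_const_of_re_pos (Or.inl ?_) (by simpa)).comp
        (f := fun x : ℝ => 1 - (x : ℂ) ^ 2) (by fun_prop)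
      rw [← Complex.ofReal_pow, Complex.sub_re, Complex.one_re, Complex.ofReal_re]
      nlinarith [hx.1, hx.2]
    rw [← Complex.reCLM_apply, ← Complex.reCLM.intervalIntegral_comp_comm hint]
    refine intervalIntegral.integral_congr fun x hx => ?_
    rw [uIcc_of_le (by norm_num)] at hx
    have hx2 : 0 ≤ 1 - x ^ 2 := by nlinarith [hx.1, hx.2]
    simp only [Complex.reCLM_apply]
    rw [← Complex.ofReal_pow, ← Complex.ofReal_one, ← Complex.ofReal_sub, ← Complex.ofReal_cpow hx2,
      Complex.re_ofReal_mul, mul_comm Complex.I, ← Complex.ofReal_mul, Complex.exp_ofReal_mul_I_re]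
  have hcos : -(Complex.I * Complex.exp (Complex.I * t)) * ((-(2 * Complex.I)) ^ (α : ℂ) * Real.Gamma (α + 1))
      + Complex.I * Complex.exp (-(Complex.I * t)) * ((2 * Complex.I) ^ (α : ℂ) * Real.Gamma (α + 1))
      = ((2 * 2 ^ α * Real.Gamma (α + 1) * Real.cos (t - Real.pi * α / 2 - Real.pi / 2) : ℝ) : ℂ) := by
    rw [two_mul_I_cpow, neg_two_mul_I_cpow, Real.cos_sub_pi_div_two]
    push_cast
    rw [Complex.sin]
    have e1 : Complex.exp (Complex.I * t) * Complex.exp (-(Complex.I * (Real.pi * α / 2)))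
      = Complex.exp ((t - Real.pi * α / 2) * Complex.I) := by rw [← Complex.exp_add]; ring_nf
    have e2 : Complex.exp (-(Complex.I * t)) * Complex.exp (Complex.I * (Real.pi * α / 2))
      = Complex.exp (-(t - Real.pi * α / 2) * Complex.I) := by rw [← Complex.exp_add]; ring_nf
    rw [← e1, ← e2]
    ring
  have hre := congrArg Complex.re hcos
  rw [Complex.ofReal_re] at hre
  rw [← hre, hC, ← Complex.re_ofReal_mul, ← Complex.sub_re,
    integral_one_sub_sq_cpow_contour hα t]
  simp only [Function.comp_apply, T]
  congr 1
  ring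

/-- The leading asymptotics of `J_ν` at infinity. -/
theorem tendsto_besselJ_sub_cos {ν : ℝ} (hν : 0 ≤ ν) :
    Tendsto (fun t : ℝ => √t * besselJ ν t
      - √(2 / Real.pi) * Real.cos (t - ν * Real.pi / 2 - Real.pi / 4)) atTop (𝓝 0) := by
  have main : ∀ μ : ℝ, 1 / 2 < μ → Tendsto (fun t : ℝ => √t * besselJ μ t
      - √(2 / Real.pi) * Real.cos (t - μ * Real.pi / 2 - Real.pi / 4)) atTop (𝓝 0) := by
    intro μ hμ
    have hα : 0 < μ - 1 / 2 := by linarith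
    have hG := Real.Gamma_pos_of_pos (s := μ - 1 / 2 + 1) (by linarith)
    have h := (tendsto_poisson_integral hα).const_mul
      ((2 ^ μ)⁻¹ / (√Real.pi * Real.Gamma (μ - 1 / 2 + 1)))
    rw [mul_zero] at h
    refine h.congr' ((eventually_gt_atTop 0).mono fun t ht => ?_)
    beta_reduce
    rw [integral_one_sub_sq_rpow_mul_cos hα, besselJ_eq ht, sub_add_cancel, mul_sub]
    congr 1
    · rw [Real.div_rpow ht.le two_pos.le, Real.sqrt_eq_rpow,
        show μ - 1 / 2 + 1 = 1 / 2 + μ by ring, Real.rpow_add ht]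
      rw [show μ - 1 / 2 + 1 = 1 / 2 + μ by ring] at hG
      have : (0 : ℝ) < Real.pi ^ (1 / 2 : ℝ) := by positivity
      have : (0 : ℝ) < 2 ^ μ := by positivity
      rw [Real.sqrt_eq_rpow]
      field_simp
    · rw [show t - Real.pi * (μ - 1 / 2) / 2 - Real.pi / 2 = t - μ * Real.pi / 2 - Real.pi / 4 by ring,
        Real.sqrt_div two_pos.le, Real.rpow_sub two_pos, ← Real.sqrt_eq_rpow]
      have : (0 : ℝ) < 2 ^ μ := by positivity
      have h2 : √(2 : ℝ) ^ 2 = 2 := Real.sq_sqrt two_pos.le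
      generalize Real.cos (t - μ * Real.pi / 2 - Real.pi / 4) = C
      generalize Real.Gamma (μ - 1 / 2 + 1) = G at hG
      field_simp
      rw [h2]
  -- Poisson's integral reaches only orders above `1/2`. The three-term recurrence carries the
  -- asymptotics down to every `ν ≥ 0`: the term in `J_{ν+1}` has the coefficient `2(ν+1)/t`, which
  -- vanishes in the limit.
  have h1 := main (ν + 1) (by linarith)
  have h2 := main (ν + 2) (by linarith)
  have hinv : Tendsto (fun t : ℝ => 2 * (ν + 1) / t) atTop (𝓝 0) :=
    tendsto_const_nhds.div_atTop tendsto_id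
  have h3 : Tendsto (fun t : ℝ => 2 * (ν + 1) / t * (√(2 / Real.pi) *
      Real.cos (t - (ν + 1) * Real.pi / 2 - Real.pi / 4))) atTop (𝓝 0) := by
    refine squeeze_zero_norm' (a := fun t => ‖2 * (ν + 1) / t‖ * √(2 / Real.pi)) ?_ ?_
    · refine Eventually.of_forall fun t => ?_
      rw [norm_mul, norm_mul, Real.norm_of_nonneg (Real.sqrt_nonneg _)]
      gcongr
      exact mul_le_of_le_one_right (Real.sqrt_nonneg _) (Real.abs_cos_le_one _)
    · simpa using hinv.norm.mul_const (√(2 / Real.pi))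
  have h4 := ((hinv.mul h1).add h3).sub h2
  simp only [mul_zero, add_zero, sub_zero] at h4
  refine h4.congr' ((eventually_gt_atTop 0).mono fun t ht => ?_)
  have hr := besselJ_add_besselJ hν ht
  beta_reduce
  rw [show besselJ ν t = 2 * (ν + 1) / t * besselJ (ν + 1) t - besselJ (ν + 2) t by linarith,
    show t - ν * Real.pi / 2 - Real.pi / 4 = t - (ν + 2) * Real.pi / 2 - Real.pi / 4 + Real.pi by ring,
    Real.cos_add_pi]
  ring

/-- The phases of `J_ν` and `J_{ν+1}` differ by `π/2`, so the leading terms are a cosine and a sine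
of the same angle. -/
theorem tendsto_besselJ_sq_add_sq {ν : ℝ} (hν : 0 ≤ ν) :
    Tendsto (fun t : ℝ => t * besselJ ν t ^ 2 + t * besselJ (ν + 1) t ^ 2) atTop
      (𝓝 (2 / Real.pi)) := by
  have h1 := tendsto_besselJ_sub_cos hν
  have h2 := tendsto_besselJ_sub_cos (ν := ν + 1) (by linarith)
  set C : ℝ → ℝ := fun t => √(2 / Real.pi) * Real.cos (t - ν * Real.pi / 2 - Real.pi / 4)
  set S : ℝ → ℝ := fun t => √(2 / Real.pi) * Real.cos (t - (ν + 1) * Real.pi / 2 - Real.pi / 4)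
  have hCS : ∀ t, C t ^ 2 + S t ^ 2 = 2 / Real.pi := fun t => by
    simp only [C, S]
    rw [show t - (ν + 1) * Real.pi / 2 - Real.pi / 4
      = t - ν * Real.pi / 2 - Real.pi / 4 - Real.pi / 2 by ring, Real.cos_sub_pi_div_two,
      mul_pow, mul_pow, Real.sq_sqrt (by positivity), ← mul_add, Real.cos_sq_add_sin_sq, mul_one]
  have hb : ∀ (e f : ℝ → ℝ), Tendsto e atTop (𝓝 0) → (∀ t, |f t| ≤ √(2 / Real.pi)) →
      Tendsto (fun t => 2 * f t * e t) atTop (𝓝 0) := fun e f he hf => by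
    refine squeeze_zero_norm (a := fun t => 2 * √(2 / Real.pi) * ‖e t‖) (fun t => ?_) ?_
    · rw [norm_mul, norm_mul, Real.norm_ofNat, Real.norm_eq_abs]
      gcongr
      exact hf t
    · simpa using he.norm.const_mul (2 * √(2 / Real.pi))
  have hcos : ∀ x, |√(2 / Real.pi) * Real.cos x| ≤ √(2 / Real.pi) := fun x => by
    rw [abs_mul, abs_of_nonneg (Real.sqrt_nonneg _)]
    exact mul_le_of_le_one_right (Real.sqrt_nonneg _) (Real.abs_cos_le_one _)
  have h3 := ((((h1.pow 2).add (hb _ C h1 fun t => hcos _)).add (h2.pow 2)).add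
    (hb _ S h2 fun t => hcos _)).add_const (2 / Real.pi)
  simp only [ne_eq, OfNat.ofNat_ne_zero, not_false_eq_true, zero_pow, add_zero, zero_add] at h3
  refine h3.congr' ((eventually_gt_atTop 0).mono fun t ht => ?_)
  have hs := Real.sq_sqrt ht.le
  have hc := hCS t
  simp only [C, S] at hc ⊢
  linear_combination (besselJ ν t ^ 2 + besselJ (ν + 1) t ^ 2) * hs - hc

/-- Used to evaluate at infinity the quadratic forms in `(J_ν, t J_ν')`, after `t J_ν'` is rewritten
through `J_{ν+1}`. -/
theorem tendsto_besselJ_quadratic {ν : ℝ} (hν : 0 ≤ ν) {A B C : ℝ → ℝ}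
    (hA : Tendsto A atTop (𝓝 1)) (hB : Tendsto B atTop (𝓝 0)) (hC : Tendsto C atTop (𝓝 1)) :
    Tendsto (fun t : ℝ => t * (A t * besselJ ν t ^ 2 + B t * besselJ ν t * besselJ (ν + 1) t
      + C t * besselJ (ν + 1) t ^ 2)) atTop (𝓝 (2 / Real.pi)) := by
  have h := tendsto_besselJ_sq_add_sq hν
  have herr : Tendsto (fun t : ℝ => t * ((A t - 1) * besselJ ν t ^ 2
      + B t * besselJ ν t * besselJ (ν + 1) t + (C t - 1) * besselJ (ν + 1) t ^ 2)) atTop (𝓝 0) := by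
    refine squeeze_zero_norm' (a := fun t => (|A t - 1| + |B t| + |C t - 1|) *
      (t * besselJ ν t ^ 2 + t * besselJ (ν + 1) t ^ 2)) ?_ ?_
    · refine (eventually_ge_atTop 0).mono fun t ht => ?_
      generalize besselJ ν t = x
      generalize besselJ (ν + 1) t = y
      rw [norm_mul, Real.norm_of_nonneg ht, ← mul_add, mul_left_comm]
      refine mul_le_mul_of_nonneg_left ?_ ht
      rw [Real.norm_eq_abs]
      refine (abs_add_three _ _ _).trans ?_
      have hxy : |x * y| ≤ x ^ 2 + y ^ 2 := by
        rw [abs_mul]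
        nlinarith [sq_abs x, sq_abs y, sq_nonneg (|x| - |y|), sq_nonneg (|x|), sq_nonneg |y|]
      rw [mul_assoc (B t), abs_mul, abs_mul, abs_mul (C t - 1), abs_of_nonneg (sq_nonneg x),
        abs_of_nonneg (sq_nonneg y)]
      nlinarith [abs_nonneg (A t - 1), abs_nonneg (B t), abs_nonneg (C t - 1), sq_nonneg x,
        sq_nonneg y, mul_nonneg (abs_nonneg (A t - 1)) (sq_nonneg y),
        mul_nonneg (abs_nonneg (C t - 1)) (sq_nonneg x),
        mul_le_mul_of_nonneg_left hxy (abs_nonneg (B t))]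
    · have := ((((hA.sub_const 1).abs).add hB.abs).add ((hC.sub_const 1).abs)).mul h
      simpa using this
  have h5 := herr.add h
  rw [zero_add] at h5
  refine h5.congr fun t => ?_
  ring

/-! ### Monotone quadratic forms and pointwise bounds by `2/π` -/

theorem le_of_deriv_nonneg_of_tendsto {f f' : ℝ → ℝ} {a L : ℝ}
    (hf : ∀ t, a ≤ t → HasDerivAt f (f' t) t) (hf' : ∀ t, a ≤ t → 0 ≤ f' t)
    (hL : Tendsto f atTop (𝓝 L)) {t : ℝ} (ht : a ≤ t) : f t ≤ L := by
  have hm : MonotoneOn f (Ici a) := by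
    refine monotoneOn_of_hasDerivWithinAt_nonneg (f' := f') (convex_Ici a)
      (fun x hx => (hf x hx).continuousAt.continuousWithinAt) (fun x hx => ?_) fun x hx => ?_
    · exact (hf x (interior_subset hx)).hasDerivWithinAt
    · exact hf' x (interior_subset hx)
  refine ge_of_tendsto hL ((eventually_ge_atTop t).mono fun s hs => ?_)
  exact hm ht (ht.trans hs) hs

theorem rpow_neg_five_half {t τ : ℝ} (ht : 0 < t) (hτ : τ < t ^ 2) :
    (t ^ 2 - τ) ^ (-(5 / 2) : ℝ) = t⁻¹ ^ 5 * (1 - τ * t⁻¹ ^ 2) ^ (-(5 / 2) : ℝ) := by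
  have h1 : 0 < 1 - τ * t⁻¹ ^ 2 := by
    have : τ * t⁻¹ ^ 2 < 1 := by
      rw [inv_pow, ← div_eq_mul_inv, div_lt_one (by positivity)]
      exact hτ
    linarith
  have h2 : t ^ 2 - τ = t ^ 2 * (1 - τ * t⁻¹ ^ 2) := by field_simp
  rw [h2, Real.mul_rpow (by positivity) h1.le]
  congr 1
  rw [← Real.rpow_natCast t 2, ← Real.rpow_mul ht.le, inv_pow, ← Real.rpow_natCast t 5,
    ← Real.rpow_neg ht.le]
  norm_num

/-- A monotone quadratic form in `(J_ν, t J_ν')`, and the pointwise bound it yields. -/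
theorem besselJ_sq_le_of_energy {ν τ a : ℝ} (hν : 0 ≤ ν) (ha : 0 < a) (hτ : τ < a ^ 2)
    (hmono : ∀ t, a ≤ t → 0 ≤ (4 * (ν ^ 2 - τ) - 1) * (t ^ 2 - τ) ^ 2
      - 12 * τ * (t ^ 2 - τ) - 15 * τ ^ 2) {t : ℝ} (ht : a ≤ t) :
    (t ^ 2 - τ) ^ (-(5 / 2) : ℝ) * (t ^ 4 / 4 + τ * t ^ 2 + (t ^ 2 - ν ^ 2) * (t ^ 2 - τ) ^ 2)
      * besselJ ν t ^ 2 ≤ 2 / Real.pi := by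
  have hpos : ∀ t, a ≤ t → 0 < t ^ 2 - τ := fun t ht => by nlinarith
  -- With `D = t d/dt`, `p = D J_ν` and `φ = (t² - τ)^{-1/2}`, this is `φ p² - (Dφ) J_ν p + (½ D²φ +
  -- (t² - ν²) φ) J_ν²`. For any `φ` the terms in `p²` and `J_ν p` cancel in its derivative, leaving
  -- `(½ D³φ + 2(t² - ν²) Dφ + 2t² φ) J_ν²`; its sign is what `hmono` asks for.
  set E : ℝ → ℝ := fun t => (t ^ 2 - τ) ^ (-(5 / 2) : ℝ) *
    ((t ^ 2 * (t ^ 2 + 2 * τ) / 2 + (t ^ 2 - ν ^ 2) * (t ^ 2 - τ) ^ 2) * besselJ ν t ^ 2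
      + t ^ 2 * (t ^ 2 - τ) * besselJ ν t * besselLogDeriv ν t
      + (t ^ 2 - τ) ^ 2 * besselLogDeriv ν t ^ 2)
  have hE : E t ≤ 2 / Real.pi := by
    refine le_of_deriv_nonneg_of_tendsto (a := a) (f' := fun t => (t ^ 2 - τ) ^ (-(7 / 2) : ℝ) * (t / 2) *
      ((4 * (ν ^ 2 - τ) - 1) * (t ^ 2 - τ) ^ 2 - 12 * τ * (t ^ 2 - τ) - 15 * τ ^ 2) * besselJ ν t ^ 2)
      (fun t ht => ?_) (fun t ht => ?_) ?_ ht
    · have ht0 : 0 < t := ha.trans_le ht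
      have hy := hpos t ht
      have dy : HasDerivAt (fun x : ℝ => x ^ 2 - τ) (2 * t) t := by
        simpa using (hasDerivAt_pow 2 t).sub_const τ
      have d2 : HasDerivAt (fun x : ℝ => x ^ 2) (2 * t) t := by simpa using hasDerivAt_pow 2 t
      have dq : HasDerivAt (fun x : ℝ => (x ^ 2 - τ) ^ (-(5 / 2) : ℝ))
          (-5 * t * (t ^ 2 - τ) ^ (-(7 / 2) : ℝ)) t := by
        refine (dy.rpow_const (Or.inl hy.ne')).congr_deriv ?_
        rw [show (-(5 / 2) - 1 : ℝ) = -(7 / 2) by norm_num]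
        ring
      have du := hasDerivAt_besselJ hν ht0
      have dp := hasDerivAt_besselLogDeriv hν ht0
      have hq : (t ^ 2 - τ) ^ (-(5 / 2) : ℝ) = (t ^ 2 - τ) * (t ^ 2 - τ) ^ (-(7 / 2) : ℝ) := by
        rw [← Real.rpow_one_add' hy.le (by norm_num)]
        norm_num
      have d := dq.mul (((((d2.mul (d2.add_const (2 * τ))).div_const 2).add
        ((d2.sub_const (ν ^ 2)).mul (dy.pow 2))).mul (du.pow 2)).add
        (((d2.mul dy).mul du).mul dp) |>.add ((dy.pow 2).mul (dp.pow 2)))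
      refine d.congr_deriv ?_
      simp only [Pi.pow_apply, Pi.mul_apply, Pi.add_apply]
      rw [hq]
      generalize (t ^ 2 - τ) ^ (-(7 / 2) : ℝ) = q
      field_simp
      ring
    · have := hmono t ht
      have ht0 : 0 < t := ha.trans_le ht
      have hq : 0 ≤ (t ^ 2 - τ) ^ (-(7 / 2) : ℝ) := Real.rpow_nonneg (hpos t ht).le _
      positivity
    · set M : ℝ → ℝ := fun s => (1 - τ * s ^ 2) ^ (-(5 / 2) : ℝ)
      have hM : ContinuousAt M 0 :=
        ContinuousAt.rpow_const (by fun_prop) (Or.inl (by norm_num))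
      have hlim : ∀ (P : ℝ → ℝ) (v : ℝ), Continuous P → P 0 = v →
          Tendsto (fun t : ℝ => M t⁻¹ * P t⁻¹) atTop (𝓝 v) := fun P v hP hv => by
          have h1 : Tendsto (fun s => M s * P s) (𝓝 0) (𝓝 (M 0 * P 0)) :=
            (hM.mul hP.continuousAt).tendsto
          rw [show M 0 = 1 by simp [M], one_mul, hv] at h1
          exact h1.comp tendsto_inv_atTop_zero
      have h := tendsto_besselJ_quadratic hν
        (A := fun t => M t⁻¹ * (fun s : ℝ => s ^ 2 * (1 + 2 * τ * s ^ 2) / 2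
          + (1 - τ * s ^ 2) ^ 2 + ν * s ^ 2 * (1 - τ * s ^ 2)) t⁻¹)
        (B := fun t => M t⁻¹ * (fun s : ℝ => -(s * (1 - τ * s ^ 2)
          + 2 * ν * s * (1 - τ * s ^ 2) ^ 2)) t⁻¹)
        (C := fun t => M t⁻¹ * (fun s : ℝ => (1 - τ * s ^ 2) ^ 2) t⁻¹)
        (hlim (fun s : ℝ => s ^ 2 * (1 + 2 * τ * s ^ 2) / 2
          + (1 - τ * s ^ 2) ^ 2 + ν * s ^ 2 * (1 - τ * s ^ 2)) _ (by fun_prop) (by simp))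
        (hlim (fun s : ℝ => -(s * (1 - τ * s ^ 2)
          + 2 * ν * s * (1 - τ * s ^ 2) ^ 2)) _ (by fun_prop) (by simp))
        (hlim (fun s : ℝ => (1 - τ * s ^ 2) ^ 2) _ (by fun_prop) (by simp))
      refine h.congr' ((eventually_ge_atTop a).mono fun t ht => ?_)
      have ht0 : 0 < t := ha.trans_le ht
      simp only [E, M]
      rw [rpow_neg_five_half ht0 (by linarith [hpos t ht]), besselLogDeriv]
      generalize (1 - τ * t⁻¹ ^ 2) ^ (-(5 / 2) : ℝ) = m
      field_simp
      ring
  -- The bracket of `E` exceeds the claimed multiple of `J_ν²` by the square of `(t²/2) J_ν + (t² -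
  -- τ) t J_ν'`.
  refine le_trans ?_ hE
  have hq : 0 ≤ (t ^ 2 - τ) ^ (-(5 / 2) : ℝ) := Real.rpow_nonneg (hpos t ht).le _
  simp only [E]
  rw [mul_assoc]
  refine mul_le_mul_of_nonneg_left ?_ hq
  nlinarith [sq_nonneg (t ^ 2 / 2 * besselJ ν t + (t ^ 2 - τ) * besselLogDeriv ν t)]

/-- Sonin's argument. The function `w = √t J_ν` solves `w'' + (1 + β/t²) w = 0`, and `D = w² +
w'²/(1 + β/t²)` is nondecreasing because `β ≥ 0`. -/
theorem mul_besselJ_sq_le_of_le_half {ν t : ℝ} (hν : 0 ≤ ν) (hν' : ν ≤ 1 / 2) (ht : 0 < t) :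
    t * besselJ ν t ^ 2 ≤ 2 / Real.pi := by
  set β := 1 / 4 - ν ^ 2
  have hβ : 0 ≤ β := by simp only [β]; nlinarith
  set D : ℝ → ℝ := fun t => t * besselJ ν t ^ 2
    + (besselLogDeriv ν t + besselJ ν t / 2) ^ 2 * (t / (t ^ 2 + β))
  have hD : D t ≤ 2 / Real.pi := by
    refine le_of_deriv_nonneg_of_tendsto (a := t) (f' := fun t =>
      (besselLogDeriv ν t + besselJ ν t / 2) ^ 2 * (2 * β) / (t ^ 2 + β) ^ 2)
      (fun x hx => ?_) (fun x _ => by positivity) ?_ le_rfl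
    · have hx0 : 0 < x := ht.trans_le hx
      have hR : x ^ 2 + β ≠ 0 := by positivity
      have du := hasDerivAt_besselJ hν hx0
      have dp := hasDerivAt_besselLogDeriv hν hx0
      have dR : HasDerivAt (fun x : ℝ => x ^ 2 + β) (2 * x) x := by
        simpa using (hasDerivAt_pow 2 x).add_const β
      have d := ((hasDerivAt_id x).mul (du.pow 2)).add
        (((dp.add (du.div_const 2)).pow 2).mul ((hasDerivAt_id x).div dR hR))
      refine d.congr_deriv ?_
      simp only [Pi.pow_apply, Pi.add_apply, Pi.div_apply, id]
      have hν2 : ν ^ 2 = 1 / 4 - β := by simp only [β]; ring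
      rw [hν2]
      field_simp
      ring
    · have hR : ∀ (P : ℝ → ℝ) (v : ℝ), ContinuousAt P 0 → P 0 = v →
          Tendsto (fun t : ℝ => P t⁻¹) atTop (𝓝 v) :=
        fun P v hP hv => hv ▸ hP.tendsto.comp tendsto_inv_atTop_zero
      have hc : ∀ Q : ℝ → ℝ, Continuous Q → ContinuousAt (fun s : ℝ => Q s / (1 + β * s ^ 2)) 0 :=
        fun Q hQ => hQ.continuousAt.div (by fun_prop) (by norm_num)
      have h := tendsto_besselJ_quadratic hν
        (A := fun t => (fun s : ℝ => (1 + β * s ^ 2 + (ν + 1 / 2) ^ 2 * s ^ 2) / (1 + β * s ^ 2)) t⁻¹)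
        (B := fun t => (fun s : ℝ => -(2 * (ν + 1 / 2) * s) / (1 + β * s ^ 2)) t⁻¹)
        (C := fun t => (fun s : ℝ => 1 / (1 + β * s ^ 2)) t⁻¹)
        (hR _ _ (hc (fun s => 1 + β * s ^ 2 + (ν + 1 / 2) ^ 2 * s ^ 2) (by fun_prop)) (by simp))
        (hR _ _ (hc (fun s => -(2 * (ν + 1 / 2) * s)) (by fun_prop)) (by simp))
        (hR _ _ (hc (fun s => 1) (by fun_prop)) (by simp))
      refine h.congr' ((eventually_gt_atTop 0).mono fun x hx => ?_)
      simp only [D, besselLogDeriv]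
      have h1 : x ^ 2 + β ≠ 0 := by positivity
      have h2 : 1 + β * x⁻¹ ^ 2 ≠ 0 := by positivity
      have h3 : x ^ 2 + β = x ^ 2 * (1 + β * x⁻¹ ^ 2) := by field_simp
      rw [h3]
      generalize 1 + β * x⁻¹ ^ 2 = r at h2
      field_simp
      ring
  refine le_trans ?_ hD
  simp only [D]
  have : 0 ≤ (besselLogDeriv ν t + besselJ ν t / 2) ^ 2 * (t / (t ^ 2 + β)) := by positivity
  linarith

/-- The energy bound at `τ = 0`, where the monotonicity condition is just `4ν² ≥ 1`. It is sharp
enough away from the turning point and serves later for integer orders below `t/2`. -/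
theorem besselJ_sq_mul_le {ν t : ℝ} (hν : 1 / 2 ≤ ν) (ht : 0 < t) :
    (t ^ 2 - ν ^ 2) * besselJ ν t ^ 2 ≤ 2 / Real.pi * t := by
  have h := besselJ_sq_le_of_energy (ν := ν) (τ := 0) (a := t) (by linarith) ht (by positivity)
    (fun s _ => by
      have : 0 ≤ 4 * (ν ^ 2 - 0) - 1 := by nlinarith
      have := mul_nonneg this (sq_nonneg (s ^ 2 - 0))
      linarith) le_rfl
  rw [rpow_neg_five_half ht (by positivity)] at h
  simp only [zero_mul, sub_zero, Real.one_rpow, mul_one, add_zero] at h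
  have h2 : t⁻¹ ^ 5 * (t ^ 4 / 4 + (t ^ 2 - ν ^ 2) * (t ^ 2) ^ 2) = t⁻¹ * (1 / 4 + (t ^ 2 - ν ^ 2)) := by
    field_simp
  rw [h2, mul_assoc, inv_mul_le_iff₀ ht] at h
  nlinarith [sq_nonneg (besselJ ν t)]

/-! ### Growth of `J_ν` before the transition point -/

/-- A Riccati barrier: a lower bound for `t J_ν'/J_ν` before the first maximum of `J_ν`. -/
theorem besselJ_pos_and_lt_of_barrier {ν V K T : ℝ} (hν : 0 ≤ ν) (hTV : T ^ 2 < V)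
    (hK : 1 / 2 < K) (h0 : √V - K < ν) (hdisc : (V - ν ^ 2 + K ^ 2) ^ 2 ≤ 4 * (2 * K - 1) * V)
    {t : ℝ} (ht : 0 < t) (htT : t ≤ T) :
    0 < besselJ ν t ∧ (√(V - t ^ 2) - K) * besselJ ν t < besselLogDeriv ν t := by
  set b : ℝ → ℝ := fun x => √(V - x ^ 2) - K
  set φ : ℝ → ℝ := fun x => besselLogDeriv ν x - b x * besselJ ν x
  have hV : 0 < V := (sq_nonneg T).trans_lt hTV
  have hVx : ∀ x, 0 < x → x ≤ T → 0 < V - x ^ 2 := fun x hx hxT => by nlinarith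
  set B := √V + K
  have hb1 : ∀ x, b x ≤ √V - K := fun x => by
    have := Real.sqrt_le_sqrt (show V - x ^ 2 ≤ V by nlinarith [sq_nonneg x])
    simp only [b]; linarith
  have hbB : ∀ x, b x ≤ B := fun x => (hb1 x).trans (by simp only [B]; linarith)
  have hbB' : ∀ x, -B ≤ b x := fun x => by
    have := Real.sqrt_nonneg (V - x ^ 2)
    have := Real.sqrt_nonneg V
    simp only [B, b]; linarith
  have hB : 0 ≤ B := by have := Real.sqrt_nonneg V; simp only [B]; linarith
  have db : ∀ x, 0 < x → x ≤ T → HasDerivAt b (-x / √(V - x ^ 2)) x := fun x hx hxT => by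
    have h1 : HasDerivAt (fun x : ℝ => V - x ^ 2) (-(2 * x)) x := by
      simpa using (hasDerivAt_pow 2 x).const_sub V
    refine ((h1.sqrt (hVx x hx hxT).ne').sub_const K).congr_deriv ?_
    have := (Real.sqrt_pos.2 (hVx x hx hxT)).ne'
    field_simp
  have dφ : ∀ x, 0 < x → x ≤ T → HasDerivAt φ (((ν ^ 2 - x ^ 2) * besselJ ν x / x)
      - (-x / √(V - x ^ 2) * besselJ ν x + b x * (besselLogDeriv ν x / x))) x := fun x hx hxT =>
    (hasDerivAt_besselLogDeriv hν hx).sub ((db x hx hxT).mul (hasDerivAt_besselJ hν hx))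
  -- Positivity persists to the end of an interval: since `B ≥ |b|`, the factor `x^B` makes both
  -- `x^B J_ν` and `x^B φ` nondecreasing as long as `J_ν` and `φ` are positive. The first failure
  -- `s` found below then contradicts this.
  have key : ∀ δ s, 0 < δ → δ ≤ s → s ≤ T → 0 < besselJ ν δ → 0 < φ δ →
      (∀ x ∈ Ioo δ s, 0 < besselJ ν x ∧ 0 < φ x) → 0 < besselJ ν s ∧ 0 < φ s := by
    intro δ s hδ hδs hsT h1 h2 hgood
    have hs : 0 < s := hδ.trans_le hδs
    have dB : ∀ x, 0 < x → HasDerivAt (fun x : ℝ => x ^ B) (B * x ^ B / x) x := fun x hx => by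
      refine (Real.hasDerivAt_rpow_const (Or.inl hx.ne')).congr_deriv ?_
      rw [Real.rpow_sub_one hx.ne']
      ring
    have m1 : MonotoneOn (fun x => x ^ B * besselJ ν x) (Icc δ s) := by
      refine monotoneOn_of_hasDerivWithinAt_nonneg (f' := fun x =>
        B * x ^ B / x * besselJ ν x + x ^ B * (besselLogDeriv ν x / x)) (convex_Icc _ _)
        (fun x hx => ?_) (fun x hx => ?_) fun x hx => ?_
      · have hx0 := hδ.trans_le hx.1
        exact ((dB x hx0).mul (hasDerivAt_besselJ hν hx0)).continuousAt.continuousWithinAt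
      · rw [interior_Icc] at hx
        have hx0 := hδ.trans hx.1
        exact ((dB x hx0).mul (hasDerivAt_besselJ hν hx0)).hasDerivWithinAt
      · rw [interior_Icc] at hx
        have hx0 := hδ.trans hx.1
        obtain ⟨g1, g2⟩ := hgood x hx
        have : B * x ^ B / x * besselJ ν x + x ^ B * (besselLogDeriv ν x / x)
          = x ^ B / x * (φ x + (b x + B) * besselJ ν x) := by simp only [φ]; ring
        rw [this]
        have := hbB' x
        have : 0 ≤ (b x + B) * besselJ ν x := mul_nonneg (by linarith) g1.le
        positivity
    have m2 : MonotoneOn (fun x => x ^ B * φ x) (Icc δ s) := by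
      refine monotoneOn_of_hasDerivWithinAt_nonneg (f' := fun x =>
        B * x ^ B / x * φ x + x ^ B * (((ν ^ 2 - x ^ 2) * besselJ ν x / x)
      - (-x / √(V - x ^ 2) * besselJ ν x + b x * (besselLogDeriv ν x / x)))) (convex_Icc _ _)
        (fun x hx => ?_) (fun x hx => ?_) fun x hx => ?_
      · have hx0 := hδ.trans_le hx.1
        exact ((dB x hx0).mul (dφ x hx0 (hx.2.trans hsT))).continuousAt.continuousWithinAt
      · rw [interior_Icc] at hx
        have hx0 := hδ.trans hx.1
        exact ((dB x hx0).mul (dφ x hx0 (hx.2.le.trans hsT))).hasDerivWithinAt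
      · rw [interior_Icc] at hx
        have hx0 := hδ.trans hx.1
        obtain ⟨g1, g2⟩ := hgood x hx
        have hY : 0 < √(V - x ^ 2) := Real.sqrt_pos.2 (hVx x hx0 (hx.2.le.trans hsT))
        have hY2 : √(V - x ^ 2) ^ 2 = V - x ^ 2 := Real.sq_sqrt (hVx x hx0 (hx.2.le.trans hsT)).le
        have e : B * x ^ B / x * φ x + x ^ B * (((ν ^ 2 - x ^ 2) * besselJ ν x / x)
            - (-x / √(V - x ^ 2) * besselJ ν x + b x * (besselLogDeriv ν x / x)))
          = x ^ B / x * ((B - b x) * φ x + (ν ^ 2 - x ^ 2 + x ^ 2 / √(V - x ^ 2) - b x ^ 2) * besselJ ν x) := by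
          simp only [φ]
          field_simp
          ring
        rw [e]
        -- The logarithmic derivative `r = x J_ν'/J_ν` satisfies `x r' = ν² - x² - r²`, and `b` must
        -- be a subsolution. In `Y = √(V - x²)` the defect is a quadratic divided by `Y`, and
        -- `hdisc` says that its discriminant is not positive.
        have hr : 0 ≤ ν ^ 2 - x ^ 2 + x ^ 2 / √(V - x ^ 2) - b x ^ 2 := by
          simp only [b]
          generalize √(V - x ^ 2) = Y at hY hY2
          have hx2 : x ^ 2 = V - Y ^ 2 := by linarith
          rw [hx2]
          have : ν ^ 2 - (V - Y ^ 2) + (V - Y ^ 2) / Y - (Y - K) ^ 2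
            = ((2 * K - 1) * Y ^ 2 - (V - ν ^ 2 + K ^ 2) * Y + V) / Y := by
            field_simp
            ring
          rw [this]
          refine div_nonneg ?_ hY.le
          have h4 : 0 ≤ 4 * (2 * K - 1) * ((2 * K - 1) * Y ^ 2 - (V - ν ^ 2 + K ^ 2) * Y + V) := by
            nlinarith [sq_nonneg (2 * (2 * K - 1) * Y - (V - ν ^ 2 + K ^ 2))]
          exact nonneg_of_mul_nonneg_right h4 (by linarith)
        have := hbB x
        have : 0 ≤ (B - b x) * φ x := mul_nonneg (by linarith) g2.le
        positivity
    have p : 0 < s ^ B := Real.rpow_pos_of_pos hs _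
    have n1 := m1 (left_mem_Icc.2 hδs) (right_mem_Icc.2 hδs) hδs
    have n2 := m2 (left_mem_Icc.2 hδs) (right_mem_Icc.2 hδs) hδs
    have q : 0 < δ ^ B := Real.rpow_pos_of_pos hδ _
    exact ⟨pos_of_mul_pos_right ((mul_pos q h1).trans_le n1) p.le,
      pos_of_mul_pos_right ((mul_pos q h2).trans_le n2) p.le⟩
  suffices h : 0 < besselJ ν t ∧ 0 < φ t from ⟨h.1, by simpa [φ] using h.2⟩
  by_contra hbad
  obtain ⟨δ, hδ0, hδ⟩ : ∃ δ, 0 < δ ∧ ∀ x, 0 < x → x < δ → 0 < besselJ ν x ∧ 0 < φ x := by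
    have := eventually_besselJ_pos hν h0
    obtain ⟨δ, hδ, h⟩ := mem_nhdsGT_iff_exists_Ioo_subset.1 this
    refine ⟨δ, hδ, fun x hx hxδ => ?_⟩
    obtain ⟨g1, g2⟩ := h ⟨hx, hxδ⟩
    refine ⟨g1, ?_⟩
    have := mul_le_mul_of_nonneg_right (hb1 x) g1.le
    simp only [φ]
    linarith
  have hδt : δ / 2 ≤ t := by
    by_contra h
    exact hbad (hδ t ht (by linarith))
  set S : Set ℝ := {x ∈ Icc (δ / 2) t | besselJ ν x ⊓ φ x ≤ 0}
  have hScomp : IsCompact S := by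
    refine isCompact_Icc.of_isClosed_subset ?_ (sep_subset _ _)
    refine ContinuousOn.preimage_isClosed_of_isClosed (f := fun x => besselJ ν x ⊓ φ x)
      (fun x hx => ?_) isClosed_Icc isClosed_Iic
    have hx0 : 0 < x := (half_pos hδ0).trans_le hx.1
    exact (hasDerivAt_besselJ hν hx0).continuousAt.continuousWithinAt.inf
      (dφ x hx0 (hx.2.trans htT)).continuousAt.continuousWithinAt
  have hSne : S.Nonempty := by
    refine ⟨t, ⟨hδt, le_rfl⟩, ?_⟩
    by_contra h
    exact hbad (lt_inf_iff.1 (not_le.1 h))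
  obtain ⟨s, hsS, hmin⟩ := hScomp.exists_isLeast hSne
  obtain ⟨g1, g2⟩ := hδ (δ / 2) (half_pos hδ0) (half_lt_self hδ0)
  have := key (δ / 2) s (half_pos hδ0) hsS.1.1 (hsS.1.2.trans htT) g1 g2 fun x hx => by
    by_contra h
    have hxS : x ∈ S := ⟨⟨hx.1.le, hx.2.le.trans hsS.1.2⟩, by
      by_contra h'
      exact h (lt_inf_iff.1 (not_le.1 h'))⟩
    exact absurd (hmin hxS) (not_le.2 hx.2)
  exact absurd hsS.2 (not_le.2 (lt_inf_iff.2 this))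

/-- The hypothesis `hTV` keeps the barrier at or above `-1/3` up to `T`. Hence `t J_ν'/J_ν > -1/3`
on `(0, T]`, and there `t^{1/3} J_ν` increases. -/
theorem rpow_mul_besselJ_le_of_barrier {ν V K T : ℝ} (hν : 0 ≤ ν)
    (hTV : (K - 1 / 3) ^ 2 ≤ V - T ^ 2)
    (hK : 1 / 2 < K) (h0 : √V - K < ν) (hdisc : (V - ν ^ 2 + K ^ 2) ^ 2 ≤ 4 * (2 * K - 1) * V)
    {t : ℝ} (ht : 0 < t) (htT : t ≤ T) :
    0 < besselJ ν t ∧ t ^ (1 / 3 : ℝ) * besselJ ν t ≤ T ^ (1 / 3 : ℝ) * besselJ ν T := by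
  have hTV' : T ^ 2 < V := by nlinarith [sq_pos_of_pos (show 0 < K - 1 / 3 by linarith)]
  have hbar := fun {x : ℝ} (hx : 0 < x) (hxT : x ≤ T) =>
    besselJ_pos_and_lt_of_barrier hν hTV' hK h0 hdisc hx hxT
  refine ⟨(hbar ht htT).1, ?_⟩
  have d : ∀ x, 0 < x → HasDerivAt (fun x => x ^ (1 / 3 : ℝ) * besselJ ν x)
      (x ^ (1 / 3 : ℝ) / x * (besselLogDeriv ν x + 1 / 3 * besselJ ν x)) x := fun x hx => by
    refine ((Real.hasDerivAt_rpow_const (Or.inl hx.ne')).mul (hasDerivAt_besselJ hν hx)).congr_deriv ?_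
    rw [Real.rpow_sub_one hx.ne']
    ring
  have m : MonotoneOn (fun x => x ^ (1 / 3 : ℝ) * besselJ ν x) (Icc t T) := by
    refine monotoneOn_of_hasDerivWithinAt_nonneg (f' := fun x =>
      x ^ (1 / 3 : ℝ) / x * (besselLogDeriv ν x + 1 / 3 * besselJ ν x)) (convex_Icc _ _)
      (fun x hx => (d x (ht.trans_le hx.1)).continuousAt.continuousWithinAt)
      (fun x hx => (d x (ht.trans_le (interior_subset hx).1)).hasDerivWithinAt) fun x hx => ?_
    rw [interior_Icc] at hx
    have hx0 := ht.trans hx.1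
    obtain ⟨g1, g2⟩ := hbar hx0 hx.2.le
    have h1 : K - 1 / 3 ≤ √(V - x ^ 2) := by
      refine Real.le_sqrt_of_sq_le (hTV.trans ?_)
      nlinarith [hx.2]
    have : 0 ≤ besselLogDeriv ν x + 1 / 3 * besselJ ν x := by nlinarith
    positivity
  exact m (left_mem_Icc.2 htT) (right_mem_Icc.2 htT) htT

/-! ### Landau's bound for orders `ν ≥ 1/2` -/

theorem abs_le_of_rpow_mul_sq_le {x t c : ℝ} (ht : 0 < t) (h : t ^ (2 / 3 : ℝ) * x ^ 2 ≤ c) :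
    |x| ≤ √c * t ^ (-(1 / 3) : ℝ) := by
  have h1 : t ^ (2 / 3 : ℝ) * x ^ 2 = (t ^ (1 / 3 : ℝ) * |x|) ^ 2 := by
    rw [mul_pow, sq_abs, ← Real.rpow_natCast (t ^ (1 / 3 : ℝ)), ← Real.rpow_mul ht.le]
    norm_num
  rw [h1] at h
  have h2 := Real.le_sqrt_of_sq_le h
  rw [Real.rpow_neg ht.le, ← div_eq_mul_inv, le_div_iff₀ (by positivity)]
  linarith

/-- The energy bound reads `t^{2/3} H(t) J_ν² ≤ 2/π`. It suffices that `H` increases on `[T, ∞)` and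
that `H(T) ≥ 1`, where `T² = (z + 1/2)³` and `z = ν^{2/3}`. -/
theorem besselJ_sq_le_of_transition_le {ν z t : ℝ} (hν : 1 / 2 ≤ ν) (hz : 5 / 8 ≤ z)
    (hzν : z ^ 3 = ν ^ 2) (ht0 : 0 < t) (ht : (z + 1 / 2) ^ 3 ≤ t ^ 2) :
    t ^ (2 / 3 : ℝ) * besselJ ν t ^ 2 ≤ 2 / Real.pi := by
  -- For `τ = z³ - c z²` and `T² ≈ z³ + (3/2) z²`, the monotonicity condition at `T` requires to
  -- leading order `4c(c + 3/2)² ≥ 15`. The value `c = 3/4` only just satisfies it.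
  set τ := z ^ 3 - 3 / 4 * z ^ 2 with hτ
  have hM : 0 < z + 1 / 2 := by linarith
  set T := (z + 1 / 2) ^ (3 / 2 : ℝ) with hT
  have hT0 : 0 < T := by positivity
  have hT2 : T ^ 2 = (z + 1 / 2) ^ 3 := by
    rw [hT, ← Real.rpow_natCast, ← Real.rpow_mul hM.le, ← Real.rpow_natCast]
    norm_num
  have hT23 : T ^ (2 / 3 : ℝ) = z + 1 / 2 := by
    rw [hT, ← Real.rpow_mul hM.le]
    norm_num
  have hTt : T ≤ t := by nlinarith
  -- In the excesses `e = z - 5/8` and `d = x² - T²`, the polynomial inequalities below expand with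
  -- nonnegative coefficients only.
  obtain ⟨e, he, rfl⟩ : ∃ e, 0 ≤ e ∧ z = 5 / 8 + e := ⟨z - 5 / 8, by linarith, by ring⟩
  have hy : ∀ x, T ≤ x → ∃ d, 0 ≤ d ∧ x ^ 2 = (5 / 8 + e + 1 / 2) ^ 3 + d := fun x hx =>
    ⟨x ^ 2 - (5 / 8 + e + 1 / 2) ^ 3, by nlinarith, by ring⟩
  have hmono : ∀ x, T ≤ x → 0 ≤ (4 * (ν ^ 2 - τ) - 1) * (x ^ 2 - τ) ^ 2
      - 12 * τ * (x ^ 2 - τ) - 15 * τ ^ 2 := fun x hx => by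
    obtain ⟨d, hd, hx2⟩ := hy x hx
    rw [hx2, ← hzν, hτ]
    ring_nf
    positivity
  have hpos : ∀ x, T ≤ x → 0 < x ^ 2 - τ := fun x hx => by
    obtain ⟨d, hd, hx2⟩ := hy x hx
    rw [hx2, hτ]
    ring_nf
    positivity
  have hE := besselJ_sq_le_of_energy (by linarith) hT0 (by linarith [hpos T le_rfl]) hmono hTt
  set N : ℝ → ℝ := fun x => x ^ 4 / 4 + τ * x ^ 2 + (x ^ 2 - ν ^ 2) * (x ^ 2 - τ) ^ 2
  set H : ℝ → ℝ := fun x => (x ^ 2 - τ) ^ (-(5 / 2) : ℝ) * N x * x ^ (-(2 / 3) : ℝ)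
  have hH : MonotoneOn H (Ici T) := by
    have d : ∀ x, T ≤ x → HasDerivAt H ((x ^ 2 - τ) ^ (-(7 / 2) : ℝ) * x ^ (-(2 / 3) : ℝ) / x *
        (-5 * x ^ 2 * N x + (x ^ 2 - τ) * (x ^ 4 + 2 * τ * x ^ 2 + 2 * x ^ 2 * (x ^ 2 - τ) ^ 2
          + 4 * x ^ 2 * (x ^ 2 - ν ^ 2) * (x ^ 2 - τ)) - 2 / 3 * (x ^ 2 - τ) * N x)) x := fun x hx => by
      have hx0 : 0 < x := hT0.trans_le hx
      have dy : HasDerivAt (fun x : ℝ => x ^ 2 - τ) (2 * x) x := by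
        simpa using (hasDerivAt_pow 2 x).sub_const τ
      have d2 : HasDerivAt (fun x : ℝ => x ^ 2) (2 * x) x := by simpa using hasDerivAt_pow 2 x
      have dq : HasDerivAt (fun x : ℝ => (x ^ 2 - τ) ^ (-(5 / 2) : ℝ))
          (-5 * x * (x ^ 2 - τ) ^ (-(7 / 2) : ℝ)) x := by
        refine (dy.rpow_const (Or.inl (hpos x hx).ne')).congr_deriv ?_
        rw [show (-(5 / 2) - 1 : ℝ) = -(7 / 2) by norm_num]
        ring
      have dr : HasDerivAt (fun x : ℝ => x ^ (-(2 / 3) : ℝ)) (-(2 / 3) * x ^ (-(2 / 3) : ℝ) / x) x := by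
        refine (Real.hasDerivAt_rpow_const (Or.inl hx0.ne')).congr_deriv ?_
        rw [Real.rpow_sub_one hx0.ne']
        ring
      have hq : (x ^ 2 - τ) ^ (-(5 / 2) : ℝ) = (x ^ 2 - τ) * (x ^ 2 - τ) ^ (-(7 / 2) : ℝ) := by
        rw [← Real.rpow_one_add' (hpos x hx).le (by norm_num)]
        norm_num
      have d4 : HasDerivAt (fun x : ℝ => x ^ 4) (4 * x ^ 3) x := by simpa using hasDerivAt_pow 4 x
      refine ((dq.mul (((d4.div_const 4).add (d2.const_mul τ)).add
        ((d2.sub_const (ν ^ 2)).mul (dy.pow 2)))).mul dr).congr_deriv ?_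
      simp only [Pi.pow_apply, Pi.mul_apply, Pi.add_apply, N]
      rw [hq]
      generalize (x ^ 2 - τ) ^ (-(7 / 2) : ℝ) = q
      generalize x ^ (-(2 / 3) : ℝ) = r
      field_simp
      ring
    refine monotoneOn_of_hasDerivWithinAt_nonneg (convex_Ici T)
      (fun x hx => (d x hx).continuousAt.continuousWithinAt)
      (fun x hx => (d x (interior_subset hx)).hasDerivWithinAt) fun x hx => ?_
    have hx := interior_subset hx
    have hx0 : 0 < x := hT0.trans_le hx
    have hp := hpos x hx
    refine mul_nonneg (by positivity) ?_
    obtain ⟨d, hd, hx2⟩ := hy x hx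
    simp only [N]
    rw [show x ^ 4 = (x ^ 2) ^ 2 by ring, hx2, ← hzν, hτ]
    ring_nf
    positivity
  have hHT : 1 ≤ H T := by
    have hp := hpos T le_rfl
    have hN : 0 ≤ N T := by
      simp only [N]
      rw [show T ^ 4 = (T ^ 2) ^ 2 by ring, hT2, ← hzν, hτ]
      ring_nf
      positivity
    -- This is `H(T) ≥ 1` squared, which removes the half-integer power and leaves a polynomial
    -- inequality in `e`.
    have hN2 : (5 / 8 + e + 1 / 2) ^ 2 * (T ^ 2 - τ) ^ 5 ≤ N T ^ 2 := by
      rw [← sub_nonneg]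
      simp only [N]
      rw [show T ^ 4 = (T ^ 2) ^ 2 by ring, hT2, ← hzν, hτ]
      ring_nf
      positivity
    have hq : ((T ^ 2 - τ) ^ (5 / 2 : ℝ)) ^ 2 = (T ^ 2 - τ) ^ 5 := by
      rw [← Real.rpow_natCast, ← Real.rpow_mul hp.le, ← Real.rpow_natCast]
      norm_num
    rw [← hq, ← mul_pow] at hN2
    have h1 := abs_le_of_sq_le_sq hN2 hN
    have h2 := (le_abs_self _).trans h1
    simp only [H]
    rw [Real.rpow_neg hp.le, Real.rpow_neg hT0.le, hT23, inv_mul_eq_div, ← div_eq_mul_inv,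
      div_div, le_div_iff₀ (by positivity)]
    linarith
  have h1 : 1 ≤ H t := hHT.trans (hH self_mem_Ici hTt hTt)
  refine le_trans ?_ hE
  refine mul_le_mul_of_nonneg_right ?_ (sq_nonneg _)
  simp only [H] at h1
  rw [Real.rpow_neg ht0.le, ← div_eq_mul_inv, le_div_iff₀ (by positivity), one_mul] at h1
  exact h1

/-- Beyond `T` the energy bound applies; before `T` the barrier reduces the claim to the bound at
`T` itself. -/
theorem abs_besselJ_le_of_half_le {ν t : ℝ} (hν : 1 / 2 ≤ ν) (ht : 0 < t) :
    |besselJ ν t| ≤ √(2 / Real.pi) * t ^ (-(1 / 3) : ℝ) := by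
  set w := ν ^ (1 / 3 : ℝ)
  have hw0 : 0 < w := by positivity
  have hw3 : w ^ 3 = ν := by
    rw [← Real.rpow_natCast, ← Real.rpow_mul (by linarith)]
    norm_num
  have hw : 79 / 100 ≤ w := by
    by_contra! h
    have := pow_lt_pow_left₀ h hw0.le (n := 3) (by norm_num)
    rw [hw3] at this
    norm_num at this
    linarith
  have hz : 5 / 8 ≤ w ^ 2 := by
    by_contra! h
    have := pow_lt_pow_left₀ h (by positivity) (n := 3) (by norm_num)
    rw [← pow_mul, mul_comm 2 3, pow_mul, hw3] at this
    norm_num at this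
    nlinarith
  have hzν : (w ^ 2) ^ 3 = ν ^ 2 := by rw [← hw3]; ring
  rcases le_total ((w ^ 2 + 1 / 2) ^ 3) (t ^ 2) with h | h
  · exact abs_le_of_rpow_mul_sq_le ht (besselJ_sq_le_of_transition_le hν hz hzν ht h)
  have hM : 0 < w ^ 2 + 1 / 2 := by positivity
  set T := (w ^ 2 + 1 / 2) ^ (3 / 2 : ℝ) with hT
  have hT0 : 0 < T := by positivity
  have hT2 : T ^ 2 = (w ^ 2 + 1 / 2) ^ 3 := by
    rw [hT, ← Real.rpow_natCast, ← Real.rpow_mul hM.le, ← Real.rpow_natCast]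
    norm_num
  have htT : t ≤ T := by nlinarith
  -- Put `z = w²`, `T² ≈ z³ + s z²` and `K ≈ kz`. To leading order the discriminant condition is `(s
  -- + 2k²)² ≤ 8k`; the largest possible `s` is `3/2`, attained only at `k = 1/2`. This dictates
  -- both `T² = (z + 1/2)³` and the coefficient of `w²` in `K`; `7/5` is a choice at the next order.
  set K := (w ^ 2 + 7 / 5) / 2 with hK
  -- Makes the barrier equal to `-1/3` exactly at `T`.
  set V := T ^ 2 + (K - 1 / 3) ^ 2 with hV
  have hV0 : 0 ≤ V := by positivity
  have h0 : √V - K < ν := by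
    rw [sub_lt_iff_lt_add, Real.sqrt_lt' (by positivity)]
    rw [← sub_pos, hV, hT2, hK, ← hw3]
    obtain ⟨e, he, hwe⟩ : ∃ e, 0 ≤ e ∧ w = 79 / 100 + e := ⟨w - 79 / 100, by linarith, by ring⟩
    rw [hwe]
    ring_nf
    positivity
  have hdisc : (V - ν ^ 2 + K ^ 2) ^ 2 ≤ 4 * (2 * K - 1) * V := by
    rw [← sub_nonneg, hV, hT2, hK, ← hzν]
    obtain ⟨e, he, hwe⟩ : ∃ e, 0 ≤ e ∧ w ^ 2 = 5 / 8 + e := ⟨w ^ 2 - 5 / 8, by linarith, by ring⟩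
    rw [hwe]
    ring_nf
    positivity
  obtain ⟨g1, g2⟩ := rpow_mul_besselJ_le_of_barrier (ν := ν) (V := V) (K := K) (T := T) (by linarith)
    (by simp [hV]) (by simp only [hK]; nlinarith) h0 hdisc ht htT
  have h3 := abs_le_of_rpow_mul_sq_le hT0
    (besselJ_sq_le_of_transition_le hν hz hzν hT0 hT2.ge)
  have h4 := (le_abs_self _).trans h3
  rw [Real.rpow_neg hT0.le, ← div_eq_mul_inv, le_div_iff₀ (by positivity)] at h4
  rw [abs_of_pos g1, Real.rpow_neg ht.le, ← div_eq_mul_inv, le_div_iff₀ (by positivity)]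
  linarith

/-! ### Landau's bound for orders `ν ≤ 1/2` -/

/-- From `γ < H_128 - 7 log 2`. The index is a power of two so that `log 2` is the only logarithm to
estimate. -/
theorem eulerMascheroniConstant_lt_log_two_sub :
    Real.eulerMascheroniConstant < Real.log 2 - 1119 / 10000 := by
  have h := Real.eulerMascheroniConstant_lt_eulerMascheroniSeq' 128
  have h128 : Real.log (128 : ℕ) = 7 * Real.log 2 := by
    rw [show ((128 : ℕ) : ℝ) = 2 ^ 7 by norm_num, Real.log_pow, Nat.cast_ofNat]
  have hH : (harmonic 128 : ℚ) < 5433148 / 1000000 := by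
    norm_num [harmonic, Finset.sum_range_succ]
  have hH' : ((harmonic 128 : ℚ) : ℝ) < 5433148 / 1000000 := by
    have : ((harmonic 128 : ℚ) : ℝ) < ((5433148 / 1000000 : ℚ) : ℝ) := by exact_mod_cast hH
    norm_num at this ⊢
  rw [Real.eulerMascheroniSeq', if_neg (by norm_num), h128] at h
  have := Real.log_two_gt_d9
  linarith

/-- `log Γ` is convex and lies above its tangent at `1`, whose slope is `-γ`. -/
theorem exp_neg_eulerMascheroniConstant_mul_le_Gamma {ν : ℝ} (hν : 0 ≤ ν) :
    Real.exp (-Real.eulerMascheroniConstant * ν) ≤ Real.Gamma (1 + ν) := by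
  rcases hν.eq_or_lt with rfl | hν
  · simp
  have hG := Real.Gamma_pos_of_pos (s := 1 + ν) (by linarith)
  rw [← Real.le_log_iff_exp_le hG]
  have hd : HasDerivAt (Real.log ∘ Real.Gamma) (-Real.eulerMascheroniConstant) 1 := by
    have h1 := Real.hasDerivAt_Gamma_one
    refine (h1.log (by simp)).congr_deriv ?_
    simp
  have h := Real.convexOn_log_Gamma.le_slope_of_hasDerivAt (x := 1) (y := 1 + ν) (by simp)
    (by simp; linarith) (by linarith) hd
  rw [slope_def_field, le_div_iff₀ (by linarith)] at h
  simpa using h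

/-- For `0 ≤ s ≤ 1` the series alternates with decreasing terms, so its partial sums of two and
three terms enclose it. -/
theorem besselEntire_bounds {ν s : ℝ} (hν : 0 ≤ ν) (hs : 0 ≤ s) (hs1 : s ≤ 1) :
    0 ≤ besselEntire ν s ∧ besselEntire ν s * Real.Gamma (1 + ν)
      ≤ 1 - s / (1 + ν) + s ^ 2 / (2 * ((1 + ν) * (2 + ν))) := by
  set f : ℕ → ℝ := fun k => s ^ k / (k.factorial * Real.Gamma (k + ν + 1))
  have hG : ∀ k : ℕ, 0 < Real.Gamma (k + ν + 1) := fun k => Real.Gamma_pos_of_pos (by positivity)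
  have hterm : ∀ k : ℕ, (-s) ^ k / (k.factorial * Real.Gamma (k + ν + 1)) = (-1) ^ k * f k := fun k => by
    simp only [f]; rw [neg_pow]; ring
  have hanti : Antitone f := antitone_nat_of_succ_le fun k => by
    simp only [f]
    have hk : (0 : ℝ) < k.factorial := by exact_mod_cast k.factorial_pos
    have hk1 : (0 : ℝ) < k + ν + 1 := by positivity
    rw [Nat.factorial_succ]
    push_cast
    rw [show (k : ℝ) + 1 + ν + 1 = (k + ν + 1) + 1 by ring, Real.Gamma_add_one hk1.ne', pow_succ]
    have h1 : s ^ k * s / ((k + 1) * k.factorial * ((k + ν + 1) * Real.Gamma (k + ν + 1)))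
      = s ^ k / (k.factorial * Real.Gamma (k + ν + 1)) * (s / ((k + 1) * (k + ν + 1))) := by
      have := (hG k).ne'
      field_simp
    rw [h1]
    refine mul_le_of_le_one_right (by have := hG k; positivity) ?_
    rw [div_le_one (by positivity)]
    have := k.cast_nonneg (α := ℝ)
    nlinarith [mul_nonneg this hν, mul_nonneg this this]
  have hl : Tendsto (fun n => ∑ i ∈ Finset.range n, (-1) ^ i * f i) atTop (𝓝 (besselEntire ν s)) := by
    have := (summable_besselEntire hν s).hasSum.tendsto_sum_nat
    simp only [hterm] at this
    have e : besselEntire ν s = ∑' k, (-1) ^ k * f k := by rw [besselEntire]; simp only [hterm]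
    rwa [e]
  have h0 := hanti.alternating_series_le_tendsto hl 1
  have h1 := hanti.tendsto_le_alternating_series hl 1
  have hg := hG 0
  norm_num [Finset.sum_range_succ, f] at h0 h1 hg
  have g1 : Real.Gamma (1 + ν + 1) = (1 + ν) * Real.Gamma (1 + ν) := Real.Gamma_add_one (by linarith)
  have g2 : Real.Gamma (2 + ν + 1) = (2 + ν) * ((1 + ν) * Real.Gamma (1 + ν)) := by
    rw [Real.Gamma_add_one (by linarith), ← g1]
    ring_nf
  rw [add_comm ν 1] at h0 h1 hg
  rw [g1] at h0 h1
  rw [g2] at h1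
  constructor
  · have : (Real.Gamma (1 + ν))⁻¹ - s / ((1 + ν) * Real.Gamma (1 + ν))
        = ((1 + ν) - s) / ((1 + ν) * Real.Gamma (1 + ν)) := by
      field_simp
    have h2 : 0 ≤ ((1 + ν) - s) / ((1 + ν) * Real.Gamma (1 + ν)) :=
      div_nonneg (by linarith) (by positivity)
    linarith
  · have := mul_le_mul_of_nonneg_right h1 hg.le
    refine this.trans (le_of_eq ?_)
    field_simp
    ring

theorem small_order_coeff_zero_nonneg {t : ℝ} (ht : 0 ≤ t) (ht1 : t ≤ 1) :
    0 ≤ 7978 / 10000 * 64 - (2 + t) / 3 * (64 - 16 * t ^ 2 + t ^ 4) := by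
  have ht' : 0 ≤ 1 - t := by linarith
  have t2 : 0 ≤ t ^ 2 := by positivity
  have t3 : 0 ≤ t ^ 3 := by positivity
  nlinarith [sq_nonneg (t - 69 / 100), mul_nonneg ht (sq_nonneg (t - 69 / 100)),
    mul_nonneg ht' (sq_nonneg (t - 69 / 100)), mul_nonneg t2 ht', mul_nonneg t3 ht',
    mul_nonneg t2 (sq_nonneg (t - 69 / 100)), mul_nonneg t3 (sq_nonneg (t - 69 / 100))]

theorem small_order_coeff_one_nonneg {t : ℝ} (ht : 0 ≤ t) (ht1 : t ≤ 9 / 10) :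
    0 ≤ (823023 / 10000 : ℝ) - 96 * t - 32 / 3 * t ^ 2 + 56 / 3 * t ^ 3 + t ^ 4 - t ^ 5 := by
  have h : t ^ 5 ≤ t ^ 4 := pow_le_pow_of_le_one ht (by linarith) (by norm_num)
  nlinarith [mul_nonneg ht (sq_nonneg (t - 9 / 10)), sq_nonneg (t - 9 / 10),
    mul_nonneg ht (sub_nonneg.2 ht1)]

theorem small_order_coeff_two_nonneg {t : ℝ} (ht : 0 ≤ t) (ht1 : t ≤ 1) :
    0 ≤ (1090862250 / 10000000 : ℝ) - 320 / 3 * t - 8 * t ^ 2 + 8 * t ^ 3 := by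
  have ht' : 0 ≤ 1 - t := by linarith
  nlinarith [mul_nonneg ht ht', mul_nonneg ht (sq_nonneg (1 - t))]

theorem small_order_coeff_near_one {r : ℝ} (r0 : 0 ≤ r) (r1 : r ≤ 1 / 10) :
    0 ≤ (7978 / 10000 * 64 - (2 + (1 - r)) / 3 * (64 - 16 * (1 - r) ^ 2 + (1 - r) ^ 4))
      + ((823023 / 10000 : ℝ) - 96 * (1 - r) - 32 / 3 * (1 - r) ^ 2 + 56 / 3 * (1 - r) ^ 3
        + (1 - r) ^ 4 - (1 - r) ^ 5) / 5 ∧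
    205 / 100 - 12 * r ≤
      7978 / 10000 * 64 - (2 + (1 - r)) / 3 * (64 - 16 * (1 - r) ^ 2 + (1 - r) ^ 4) ∧
    -57 / 10 + 60 * r ≤ (823023 / 10000 : ℝ) - 96 * (1 - r) - 32 / 3 * (1 - r) ^ 2
      + 56 / 3 * (1 - r) ^ 3 + (1 - r) ^ 4 - (1 - r) ^ 5 ∧
    24 / 10 ≤ (1090862250 / 10000000 : ℝ) - 320 / 3 * (1 - r) - 8 * (1 - r) ^ 2
      + 8 * (1 - r) ^ 3 := by
  have r2 := mul_nonneg r0 (sub_nonneg.2 r1)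
  have r3 := mul_nonneg r0 r2
  have r4 := mul_nonneg r0 r3
  have r5 := mul_nonneg r0 r4
  have s2 := mul_nonneg r0 r0
  have s3 := mul_nonneg r0 s2
  have s4 := mul_nonneg r0 s3
  have s5 := mul_nonneg r0 s4
  refine ⟨?_, ?_, ?_, ?_⟩ <;> ring_nf at * <;> linarith

/-- Right side minus left side is a quartic in `ν` whose `ν⁴` coefficient is positive and can be
dropped. `A0`, `A1`, `A2` and the cubic factor bound the remaining coefficients from below, as
functions of `t`. Only `A1` can be negative, and only for `t` near `1`. -/
theorem small_order_polynomial_bound {ν t : ℝ} (hν : 0 ≤ ν) (hν' : ν ≤ 1 / 2) (ht : 0 ≤ t)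
    (ht1 : t ≤ 1) :
    (1 + (1 / 3 + ν) * (t - 1)) * (32 * ((1 + ν) * (2 + ν)) - 8 * t ^ 2 * (2 + ν) + t ^ 4)
      ≤ 7978 / 10000 * (32 * ((1 + ν) * (2 + ν)))
        * (1 + 1119 / 10000 * ν + (1119 / 10000 * ν) ^ 2 / 2) := by
  obtain ⟨A0, hA0⟩ : ∃ A0, A0 = 7978 / 10000 * 64 - (2 + t) / 3 * (64 - 16 * t ^ 2 + t ^ 4) := ⟨_, rfl⟩
  obtain ⟨A1, hA1⟩ : ∃ A1, A1 = (823023 / 10000 : ℝ) - 96 * t - 32 / 3 * t ^ 2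
    + 56 / 3 * t ^ 3 + t ^ 4 - t ^ 5 := ⟨_, rfl⟩
  obtain ⟨A2, hA2⟩ : ∃ A2, A2 = (1090862250 / 10000000 : ℝ) - 320 / 3 * t - 8 * t ^ 2
    + 8 * t ^ 3 := ⟨_, rfl⟩
  have h0 : 0 ≤ A0 := hA0 ▸ small_order_coeff_zero_nonneg ht ht1
  have h2 : 0 ≤ A2 := hA2 ▸ small_order_coeff_two_nonneg ht ht1
  have h3 : 0 ≤ (35336269 / 1000000 : ℝ) - 32 * t := by linarith
  have ν2 : 0 ≤ ν ^ 2 := by positivity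
  have ν3 : 0 ≤ ν ^ 3 := by positivity
  have key : 0 ≤ A0 + A1 * ν + A2 * ν ^ 2 + ((35336269 / 1000000 : ℝ) - 32 * t) * ν ^ 3 := by
    have p2 := mul_nonneg h2 ν2
    have p3 := mul_nonneg h3 ν3
    rcases le_total t (9 / 10) with h9 | h9
    · have h1 : 0 ≤ A1 := hA1 ▸ small_order_coeff_one_nonneg ht h9
      positivity
    · obtain ⟨r, hr⟩ : ∃ r, t = 1 - r := ⟨1 - t, by ring⟩
      obtain ⟨e, e0, e1, e2⟩ := small_order_coeff_near_one (r := r) (by linarith) (by linarith)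
      rw [← hr, ← hA0] at e e0
      rw [← hr, ← hA1] at e1
      rw [← hr, ← hA2] at e2
      rw [← hA1] at e
      -- For `ν ≤ 1/5` the affine part `A0 + A1 ν` lies between its values at `0` and `1/5`, both
      -- nonnegative. For larger `ν` the quadratic and cubic terms compensate, through bounds affine
      -- in `r = 1 - t`.
      rcases le_total ν (1 / 5) with h5 | h5
      · have : A0 + A1 * ν = (1 - 5 * ν) * A0 + 5 * ν * (A0 + A1 / 5) := by ring
        have q1 := mul_nonneg (show 0 ≤ 1 - 5 * ν by linarith) h0
        have q2 := mul_nonneg (show 0 ≤ 5 * ν by linarith) e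
        linarith
      · have q1 := mul_le_mul_of_nonneg_right e1 hν
        have q2 := mul_le_mul_of_nonneg_right e2 ν2
        have q3 : 33 / 10 * ν ^ 3 ≤ ((35336269 / 1000000 : ℝ) - 32 * t) * ν ^ 3 :=
          mul_le_mul_of_nonneg_right (by linarith) ν3
        have q4 := mul_nonneg (show 0 ≤ ν - 1 / 5 by linarith) (show 0 ≤ r by linarith)
        have q5 := sq_nonneg (ν - 1 / 2)
        have q6 := mul_nonneg (show 0 ≤ ν + 1 by linarith) q5
        linarith
  have ν4 : 0 ≤ ν ^ 4 := by positivity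
  subst hA0 hA1 hA2
  linarith

/-- For `t ≥ 1` use `t^{2/3} ≤ t` and Sonin's bound. For `t ≤ 1`, Bernoulli's inequality for
`t^{1/3+ν}`, the truncated series and `2^ν Γ(1+ν) ≥ e^{(log 2 - γ)ν}` reduce the claim to a
polynomial inequality. -/
theorem abs_besselJ_le_of_le_half {ν t : ℝ} (hν : 0 ≤ ν) (hν' : ν ≤ 1 / 2) (ht : 0 < t) :
    |besselJ ν t| ≤ √(2 / Real.pi) * t ^ (-(1 / 3) : ℝ) := by
  rcases le_total 1 t with h1 | h1
  · refine abs_le_of_rpow_mul_sq_le ht ((mul_le_mul_of_nonneg_right ?_ (sq_nonneg _)).trans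
      (mul_besselJ_sq_le_of_le_half hν hν' ht))
    calc t ^ (2 / 3 : ℝ) ≤ t ^ (1 : ℝ) := Real.rpow_le_rpow_of_exponent_le h1 (by norm_num)
      _ = t := Real.rpow_one t
  have ht2 : t ^ 2 ≤ 1 := pow_le_one₀ ht.le h1
  obtain ⟨b0, b1⟩ := besselEntire_bounds (ν := ν) (s := t ^ 2 / 4) hν (by positivity) (by linarith)
  have hG := exp_neg_eulerMascheroniConstant_mul_le_Gamma hν
  have hG0 := Real.Gamma_pos_of_pos (s := 1 + ν) (by linarith)
  have hexp : 1 + 1119 / 10000 * ν + (1119 / 10000 * ν) ^ 2 / 2 ≤ 2 ^ ν * Real.Gamma (1 + ν) := by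
    refine (Real.quadratic_le_exp_of_nonneg (by positivity)).trans ?_
    calc Real.exp (1119 / 10000 * ν)
        ≤ Real.exp (Real.log 2 * ν + -Real.eulerMascheroniConstant * ν) := by
          rw [← add_mul]
          have := eulerMascheroniConstant_lt_log_two_sub
          gcongr
          linarith
      _ = 2 ^ ν * Real.exp (-Real.eulerMascheroniConstant * ν) := by
          rw [Real.exp_add, Real.rpow_def_of_pos two_pos]
      _ ≤ _ := by gcongr
  have hpi : (7978 / 10000 : ℝ) ≤ √(2 / Real.pi) := by
    refine Real.le_sqrt_of_sq_le ?_
    rw [le_div_iff₀ Real.pi_pos]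
    nlinarith [Real.pi_lt_d4]
  have hber : t ^ (1 / 3 + ν) ≤ 1 + (1 / 3 + ν) * (t - 1) := by
    have := rpow_one_add_le_one_add_mul_self (s := t - 1) (p := 1 / 3 + ν) (by linarith)
      (by linarith) (by linarith)
    rwa [add_sub_cancel] at this
  have hpoly := small_order_polynomial_bound hν hν' ht.le h1
  rw [besselJ_eq ht, abs_of_nonneg (by positivity), Real.rpow_neg ht.le, ← div_eq_mul_inv,
    le_div_iff₀ (by positivity)]
  have hP0 : 0 ≤ 1 - t ^ 2 / 4 / (1 + ν) + (t ^ 2 / 4) ^ 2 / (2 * ((1 + ν) * (2 + ν))) :=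
    le_trans (by positivity) b1
  have e1 : (t / 2) ^ ν * besselEntire ν (t ^ 2 / 4) * t ^ (1 / 3 : ℝ) * (2 ^ ν * Real.Gamma (1 + ν))
      = t ^ (1 / 3 + ν) * (besselEntire ν (t ^ 2 / 4) * Real.Gamma (1 + ν)) := by
    rw [Real.div_rpow ht.le two_pos.le, Real.rpow_add ht]
    have : (2 : ℝ) ^ ν ≠ 0 := by positivity
    field_simp
  have e2 : t ^ (1 / 3 + ν) * (besselEntire ν (t ^ 2 / 4) * Real.Gamma (1 + ν))
      ≤ (1 + (1 / 3 + ν) * (t - 1)) *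
        (1 - t ^ 2 / 4 / (1 + ν) + (t ^ 2 / 4) ^ 2 / (2 * ((1 + ν) * (2 + ν)))) :=
    mul_le_mul hber b1 (by positivity) (le_trans (by positivity) hber)
  have e3 : (1 + (1 / 3 + ν) * (t - 1)) *
        (1 - t ^ 2 / 4 / (1 + ν) + (t ^ 2 / 4) ^ 2 / (2 * ((1 + ν) * (2 + ν))))
      ≤ 7978 / 10000 * (1 + 1119 / 10000 * ν + (1119 / 10000 * ν) ^ 2 / 2) := by
    have hd : 0 < 32 * ((1 + ν) * (2 + ν)) := by positivity
    refine le_of_mul_le_mul_right ?_ hd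
    have : (1 + (1 / 3 + ν) * (t - 1)) *
        (1 - t ^ 2 / 4 / (1 + ν) + (t ^ 2 / 4) ^ 2 / (2 * ((1 + ν) * (2 + ν))))
        * (32 * ((1 + ν) * (2 + ν)))
        = (1 + (1 / 3 + ν) * (t - 1)) * (32 * ((1 + ν) * (2 + ν)) - 8 * t ^ 2 * (2 + ν) + t ^ 4) := by
      field_simp
      ring
    rw [this]
    linarith
  have hD : 0 < 2 ^ ν * Real.Gamma (1 + ν) := by positivity
  refine le_of_mul_le_mul_right ?_ hD
  rw [e1]
  calc _ ≤ _ := e2.trans e3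
    _ ≤ √(2 / Real.pi) * (2 ^ ν * Real.Gamma (1 + ν)) := by gcongr

/-! ### Existence of Landau's constant -/

theorem abs_besselJ_le {ν t : ℝ} (hν : 0 ≤ ν) (ht : 0 < t) :
    |besselJ ν t| ≤ √(2 / Real.pi) * t ^ (-(1 / 3) : ℝ) := by
  rcases le_total ν (1 / 2) with h | h
  · exact abs_besselJ_le_of_le_half hν h ht
  · exact abs_besselJ_le_of_half_le h ht

/-- The admissible constants are an intersection of closed half-lines, bounded below by `|J_0(1)| ≥
0`, so their infimum is attained. It is below `4/5` because `√(2/π)` is admissible. -/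
theorem isLandauConstant_exists : ∃ C : ℝ, IsLandauConstant C ∧ 0 ≤ C ∧ C < 4 / 5 := by
  set S : Set ℝ := {B : ℝ | ∀ ν t : ℝ, 0 ≤ ν → 0 < t → |besselJ ν t| ≤ B * t ^ (-(1 / 3) : ℝ)}
  have hmem : √(2 / Real.pi) ∈ S := fun ν t hν ht => abs_besselJ_le hν ht
  have hlb : ∀ B ∈ S, 0 ≤ B := fun B hB => by
    have := hB 0 1 le_rfl one_pos
    rw [Real.one_rpow, mul_one] at this
    exact (abs_nonneg _).trans this
  have hclosed : IsClosed S := by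
    simp only [S, ofPred_forall]
    refine isClosed_iInter fun ν => isClosed_iInter fun t => isClosed_iInter fun _ =>
      isClosed_iInter fun _ => isClosed_le continuous_const (by fun_prop)
  have hbdd : BddBelow S := ⟨0, hlb⟩
  have hle := hclosed.isLeast_csInf ⟨_, hmem⟩ hbdd
  refine ⟨sInf S, hle, hlb _ hle.1, (hle.2 hmem).trans_lt ?_⟩
  rw [Real.sqrt_lt' (by norm_num), div_lt_iff₀ Real.pi_pos]
  nlinarith [Real.pi_gt_d4]

/-! ### Bounded forms and Stein interpolation -/

/-- The sesquilinear form with kernel `k` is bounded by `M` on finitely supported sequences. -/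
def FormBound {ι : Type*} (k : ι → ι → ℂ) (M : ℝ) : Prop :=
  ∀ (s : Finset ι) (f g : ι → ℂ), ‖∑ n ∈ s, ∑ m ∈ s, f n * k n m * g m‖
    ≤ M * √(∑ n ∈ s, ‖f n‖ ^ 2) * √(∑ m ∈ s, ‖g m‖ ^ 2)

/-- Cauchy–Schwarz over pairs of indices: the Hilbert–Schmidt norm dominates the operator norm. -/
theorem FormBound.of_sum_sq_le {ι : Type*} {k : ι → ι → ℂ} {M : ℝ} (hM : 0 ≤ M)
    (h : ∀ s : Finset ι, ∑ n ∈ s, ∑ m ∈ s, ‖k n m‖ ^ 2 ≤ M ^ 2) : FormBound k M := by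
  intro s f g
  have h1 : ‖∑ n ∈ s, ∑ m ∈ s, f n * k n m * g m‖
      ≤ ∑ p ∈ s ×ˢ s, ‖k p.1 p.2‖ * (‖f p.1‖ * ‖g p.2‖) := by
    rw [Finset.sum_product]
    refine (norm_sum_le _ _).trans (Finset.sum_le_sum fun n _ => (norm_sum_le _ _).trans
      (Finset.sum_le_sum fun m _ => ?_))
    rw [norm_mul, norm_mul]
    exact le_of_eq (by ring)
  have h2 : ∑ p ∈ s ×ˢ s, (‖f p.1‖ * ‖g p.2‖) ^ 2 = (∑ n ∈ s, ‖f n‖ ^ 2) * ∑ m ∈ s, ‖g m‖ ^ 2 := by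
    rw [Finset.sum_product, Finset.sum_mul_sum]
    simp only [mul_pow]
  refine (h1.trans (Real.sum_mul_le_sqrt_mul_sqrt _ _ _)).trans ?_
  rw [h2, Real.sqrt_mul (Finset.sum_nonneg fun _ _ => by positivity), mul_assoc]
  refine mul_le_mul_of_nonneg_right ?_ (by positivity)
  rw [Finset.sum_product]
  exact (Real.sqrt_le_sqrt (h s)).trans (le_of_eq (Real.sqrt_sq hM))

theorem FormBound.mul_mul {ι : Type*} {k : ι → ι → ℂ} {M : ℝ} (hM : 0 ≤ M) (h : FormBound k M)
    {α β : ι → ℂ} {c c' : ℝ} (hc : 0 ≤ c) (hc' : 0 ≤ c') (hα : ∀ n, ‖α n‖ ≤ c)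
    (hβ : ∀ n, ‖β n‖ ≤ c') : FormBound (fun n m => α n * k n m * β m) (M * c * c') := by
  intro s f g
  have h1 := h s (fun n => f n * α n) (fun m => β m * g m)
  have e : ∀ n m, f n * (α n * k n m * β m) * g m = f n * α n * k n m * (β m * g m) :=
    fun n m => by ring
  simp only [e]
  refine h1.trans ?_
  have hb : ∀ (φ γ : ι → ℂ) (r : ℝ), 0 ≤ r → (∀ n, ‖γ n‖ ≤ r * ‖φ n‖) →
      √(∑ n ∈ s, ‖γ n‖ ^ 2) ≤ r * √(∑ n ∈ s, ‖φ n‖ ^ 2) := fun φ γ r hr hγ => by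
    rw [← Real.sqrt_sq hr, ← Real.sqrt_mul (sq_nonneg r), Finset.mul_sum]
    refine Real.sqrt_le_sqrt (Finset.sum_le_sum fun n _ => ?_)
    rw [← mul_pow]
    exact pow_le_pow_left₀ (norm_nonneg _) (hγ n) 2
  have b1 := hb f (fun n => f n * α n) c hc fun n => by
    rw [norm_mul, mul_comm]
    exact mul_le_mul_of_nonneg_right (hα n) (norm_nonneg _)
  have b2 := hb g (fun n => β n * g n) c' hc' fun n => by
    rw [norm_mul]
    exact mul_le_mul_of_nonneg_right (hβ n) (norm_nonneg _)
  calc M * √(∑ n ∈ s, ‖f n * α n‖ ^ 2) * √(∑ m ∈ s, ‖β m * g m‖ ^ 2)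
      ≤ M * (c * √(∑ n ∈ s, ‖f n‖ ^ 2)) * (c' * √(∑ m ∈ s, ‖g m‖ ^ 2)) := by gcongr
    _ = _ := by ring

/-- The analytic family `A₀^{1-z} A₁^z`, with value `0` where `A₀` or `A₁` vanishes. -/
noncomputable def geomFamily (a b : ℝ) (z : ℂ) : ℂ :=
  if a = 0 ∨ b = 0 then 0 else Complex.exp ((1 - z) * Real.log a + z * Real.log b)

theorem differentiable_geomFamily (a b : ℝ) : Differentiable ℂ (geomFamily a b) := by
  unfold geomFamily
  split_ifs <;> fun_prop

theorem geomFamily_ofReal {a b θ : ℝ} (ha : 0 ≤ a) (hb : 0 ≤ b) (h0 : 0 < θ) (h1 : θ < 1) :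
    geomFamily a b θ = ((a ^ (1 - θ) * b ^ θ : ℝ) : ℂ) := by
  unfold geomFamily
  split_ifs with h
  · rcases h with rfl | rfl
    · rw [Real.zero_rpow (by linarith)]; simp
    · rw [Real.zero_rpow h0.ne']; simp
  · push Not at h
    rw [Real.rpow_def_of_pos (lt_of_le_of_ne ha (Ne.symm h.1)),
      Real.rpow_def_of_pos (lt_of_le_of_ne hb (Ne.symm h.2)), ← Real.exp_add]
    push_cast
    ring_nf

theorem norm_geomFamily_of_ne {a b : ℝ} (h : ¬(a = 0 ∨ b = 0)) (z : ℂ) :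
    ‖geomFamily a b z‖ = Real.exp ((1 - z.re) * Real.log a + z.re * Real.log b) := by
  rw [geomFamily, if_neg h, Complex.norm_exp]
  simp

theorem norm_geomFamily_le {a b : ℝ} {z : ℂ} (hz : z.re ∈ Icc (0 : ℝ) 1) :
    ‖geomFamily a b z‖ ≤ Real.exp (|Real.log a| + |Real.log b|) := by
  by_cases h : a = 0 ∨ b = 0
  · rw [geomFamily, if_pos h, norm_zero]; positivity
  · rw [norm_geomFamily_of_ne h]
    gcongr
    · refine (le_abs_self _).trans ?_
      rw [abs_mul, abs_of_nonneg (by linarith [hz.2])]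
      exact mul_le_of_le_one_left (abs_nonneg _) (by linarith [hz.1])
    · refine (le_abs_self _).trans ?_
      rw [abs_mul, abs_of_nonneg hz.1]
      exact mul_le_of_le_one_left (abs_nonneg _) hz.2

theorem exists_geomFamily_eq_left {a b : ℝ} (ha : 0 ≤ a) {z : ℂ} (hz : z.re = 0) :
    ∃ φ : ℂ, ‖φ‖ ≤ 1 ∧ geomFamily a b z = φ * a := by
  by_cases h : a = 0 ∨ b = 0
  · exact ⟨0, by simp, by rw [geomFamily, if_pos h, zero_mul]⟩
  · have h' := h
    push Not at h'
    refine ⟨geomFamily a b z / a, ?_, by rw [div_mul_cancel₀]; exact_mod_cast h'.1⟩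
    have ha' : 0 < a := lt_of_le_of_ne ha (Ne.symm h'.1)
    rw [norm_div, norm_geomFamily_of_ne h, hz, Complex.norm_real, Real.norm_of_nonneg ha]
    simp [Real.exp_log ha', h'.1]

theorem exists_geomFamily_eq_right {a b : ℝ} (hb : 0 ≤ b) {z : ℂ} (hz : z.re = 1) :
    ∃ φ : ℂ, ‖φ‖ ≤ 1 ∧ geomFamily a b z = φ * b := by
  by_cases h : a = 0 ∨ b = 0
  · exact ⟨0, by simp, by rw [geomFamily, if_pos h, zero_mul]⟩
  · have h' := h
    push Not at h'
    refine ⟨geomFamily a b z / b, ?_, by rw [div_mul_cancel₀]; exact_mod_cast h'.2⟩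
    have hb' : 0 < b := lt_of_le_of_ne hb (Ne.symm h'.2)
    rw [norm_div, norm_geomFamily_of_ne h, hz, Complex.norm_real, Real.norm_of_nonneg hb]
    simp [Real.exp_log hb', h'.2]

/-- Stein interpolation between two weighted bounds for the same kernel. -/
theorem FormBound.interpolate {ι : Type*} {k : ι → ι → ℂ} {A₀ A₁ B₀ B₁ : ι → ℝ} {M₀ M₁ θ : ℝ}
    (hA₀ : ∀ n, 0 ≤ A₀ n) (hA₁ : ∀ n, 0 ≤ A₁ n) (hB₀ : ∀ n, 0 ≤ B₀ n) (hB₁ : ∀ n, 0 ≤ B₁ n)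
    (hM₀ : 0 ≤ M₀) (hM₁ : 0 ≤ M₁) (h0 : 0 < θ) (h1 : θ < 1)
    (H₀ : FormBound (fun n m => (A₀ n : ℂ) * k n m * B₀ m) M₀)
    (H₁ : FormBound (fun n m => (A₁ n : ℂ) * k n m * B₁ m) M₁) :
    FormBound (fun n m => ((A₀ n ^ (1 - θ) * A₁ n ^ θ : ℝ) : ℂ) * k n m *
      ((B₀ m ^ (1 - θ) * B₁ m ^ θ : ℝ) : ℂ)) (M₀ ^ (1 - θ) * M₁ ^ θ) := by
  intro s f g
  -- A finite sum of entire functions, bounded on the strip `0 ≤ Re z ≤ 1`, with the interpolated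
  -- form as its value at `θ`. Hadamard's three lines theorem applies.
  set F : ℂ → ℂ := fun z => ∑ n ∈ s, ∑ m ∈ s,
    f n * (geomFamily (A₀ n) (A₁ n) z * k n m * geomFamily (B₀ m) (B₁ m) z) * g m
  have hF : Differentiable ℂ F := by
    refine Differentiable.fun_sum fun n _ => Differentiable.fun_sum fun m _ => ?_
    have d1 := differentiable_geomFamily (A₀ n) (A₁ n)
    have d2 := differentiable_geomFamily (B₀ m) (B₁ m)
    fun_prop
  set P := √(∑ n ∈ s, ‖f n‖ ^ 2)
  set Q := √(∑ m ∈ s, ‖g m‖ ^ 2)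
  have hP : 0 ≤ P := Real.sqrt_nonneg _
  have hQ : 0 ≤ Q := Real.sqrt_nonneg _
  have hbd : BddAbove ((norm ∘ F) '' Complex.HadamardThreeLines.verticalClosedStrip 0 1) := by
    refine ⟨∑ n ∈ s, ∑ m ∈ s, ‖f n‖ * (Real.exp (|Real.log (A₀ n)| + |Real.log (A₁ n)|) * ‖k n m‖ *
      Real.exp (|Real.log (B₀ m)| + |Real.log (B₁ m)|)) * ‖g m‖, ?_⟩
    rintro _ ⟨z, hz, rfl⟩
    refine (norm_sum_le _ _).trans (Finset.sum_le_sum fun n _ => (norm_sum_le _ _).trans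
      (Finset.sum_le_sum fun m _ => ?_))
    rw [norm_mul, norm_mul, norm_mul, norm_mul]
    gcongr
    · exact norm_geomFamily_le hz
    · exact norm_geomFamily_le hz
  -- On either edge of the strip the analytic weights are the given weights times factors of modulus
  -- at most one, and such factors do not increase the form bound.
  have edge : ∀ (A B : ι → ℝ) (M : ℝ), 0 ≤ M → FormBound (fun n m => (A n : ℂ) * k n m * B m) M →
      ∀ z, (∀ n, ∃ φ : ℂ, ‖φ‖ ≤ 1 ∧ geomFamily (A₀ n) (A₁ n) z = φ * A n) →
      (∀ n, ∃ φ : ℂ, ‖φ‖ ≤ 1 ∧ geomFamily (B₀ n) (B₁ n) z = φ * B n) → ‖F z‖ ≤ M * P * Q := by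
    intro A B M hM H z hφ hψ
    choose φ hφ1 hφ using hφ
    choose ψ hψ1 hψ using hψ
    have := H.mul_mul hM zero_le_one zero_le_one hφ1 hψ1 s f g
    rw [mul_one, mul_one] at this
    refine le_trans (le_of_eq ?_) this
    simp only [F, hφ, hψ]
    congr 1
    refine Finset.sum_congr rfl fun n _ => Finset.sum_congr rfl fun m _ => ?_
    ring
  have key := Complex.HadamardThreeLines.norm_le_interp_of_mem_verticalClosedStrip₀₁' F
    (z := (θ : ℂ)) (a := M₀ * P * Q) (b := M₁ * P * Q) (by
      simp only [Complex.HadamardThreeLines.verticalClosedStrip, mem_preimage, Complex.ofReal_re]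
      exact ⟨h0.le, h1.le⟩) hF.diffContOnCl hbd
    (fun z hz => edge A₀ B₀ M₀ hM₀ H₀ z (fun n => exists_geomFamily_eq_left (hA₀ n) hz)
      fun n => exists_geomFamily_eq_left (hB₀ n) hz)
    (fun z hz => edge A₁ B₁ M₁ hM₁ H₁ z (fun n => exists_geomFamily_eq_right (hA₁ n) hz)
      fun n => exists_geomFamily_eq_right (hB₁ n) hz)
  have hFθ : F θ = ∑ n ∈ s, ∑ m ∈ s, f n * (((A₀ n ^ (1 - θ) * A₁ n ^ θ : ℝ) : ℂ) * k n m *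
      ((B₀ m ^ (1 - θ) * B₁ m ^ θ : ℝ) : ℂ)) * g m := by
    simp only [F, geomFamily_ofReal (hA₀ _) (hA₁ _) h0 h1, geomFamily_ofReal (hB₀ _) (hB₁ _) h0 h1]
  rw [hFθ, Complex.ofReal_re] at key
  refine key.trans (le_of_eq ?_)
  have hPQ : 0 ≤ P * Q := mul_nonneg hP hQ
  rw [mul_assoc, mul_assoc M₁, Real.mul_rpow hM₀ hPQ, Real.mul_rpow hM₁ hPQ]
  have : (P * Q) ^ (1 - θ) * (P * Q) ^ θ = P * Q := by
    rw [← Real.rpow_add' hPQ (by norm_num), sub_add_cancel, Real.rpow_one]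
  linear_combination M₀ ^ (1 - θ) * M₁ ^ θ * this

/-! ### The kernel of `e^{itΔ}`: Bessel products and unitarity -/

theorem exp_add_of_commute_complex {𝔸 : Type*} [NormedRing 𝔸] [NormedAlgebra ℂ 𝔸] [CompleteSpace 𝔸]
    {x y : 𝔸} (h : Commute x y) :
    NormedSpace.exp (x + y) = NormedSpace.exp x * NormedSpace.exp y :=
  letI := NormedAlgebra.restrictScalars ℚ ℂ 𝔸
  NormedSpace.exp_add_of_commute h

theorem shiftOp_mul {d : ℕ} (e e' : CubicLattice d) :
    shiftOp e * shiftOp e' = shiftOp (e + e') := by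
  ext f n
  change f (n + e + e') = f (n + (e + e'))
  rw [add_assoc]

theorem shiftOp_zero {d : ℕ} : shiftOp (0 : CubicLattice d) = 1 := by
  ext f n
  change f (n + 0) = f n
  rw [add_zero]

theorem shiftOp_pow {d : ℕ} (e : CubicLattice d) (p : ℕ) : shiftOp e ^ p = shiftOp (p • e) := by
  induction p with
  | zero => rw [pow_zero, zero_smul, shiftOp_zero]
  | succ p ih => rw [pow_succ, ih, shiftOp_mul, succ_nsmul]

theorem shiftOp_commute {d : ℕ} (e e' : CubicLattice d) : Commute (shiftOp e) (shiftOp e') := by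
  rw [Commute, SemiconjBy, shiftOp_mul, shiftOp_mul, add_comm]

/-- The summand `c (S_{e_j} + S_{-e_j})` of a multiple of the discrete Laplacian. -/
noncomputable def hopOp {d : ℕ} (c : ℂ) (j : Fin d) : EllTwo d →L[ℂ] EllTwo d :=
  c • shiftOp (stdVec j) + c • shiftOp (-stdVec j)

theorem hopOp_commute {d : ℕ} (c : ℂ) (i j : Fin d) : Commute (hopOp c i) (hopOp c j) := by
  have h : ∀ e e' : CubicLattice d, Commute (c • shiftOp e) (c • shiftOp e') := fun e e' =>
    ((shiftOp_commute e e').smul_right c).smul_left c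
  exact ((h _ _).add_right (h _ _)).add_left ((h _ _).add_right (h _ _))

theorem propagator_eq_exp_sum {d : ℕ} (t : ℝ) :
    propagator d t = NormedSpace.exp (∑ j : Fin d, hopOp (Complex.I * t / 2) j) := by
  simp only [propagator, discreteLaplacian, hopOp, ← smul_add, ← Finset.smul_sum, smul_smul]
  congr 2
  ring

/-- The forward and backward shifts commute, so the exponential factors, and the Cauchy product of
the two series counts `p.1` forward and `p.2` backward hops. -/
theorem exp_hopOp_apply {d : ℕ} (c : ℂ) (j : Fin d) (g : EllTwo d) (n : CubicLattice d) :
    NormedSpace.exp (hopOp c j) g n = ∑' p : ℕ × ℕ,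
      c ^ (p.1 + p.2) / (p.1.factorial * p.2.factorial) *
        g (n + ((p.1 : ℤ) - p.2) • stdVec j) := by
  have hcomm : Commute (c • shiftOp (stdVec j)) (c • shiftOp (-stdVec j)) :=
    ((shiftOp_commute _ _).smul_right c).smul_left c
  have hs1 := NormedSpace.norm_expSeries_summable' (𝕂 := ℂ) (c • shiftOp (stdVec j))
  have hs2 := NormedSpace.norm_expSeries_summable' (𝕂 := ℂ) (c • shiftOp (-stdVec j))
  rw [hopOp, exp_add_of_commute_complex hcomm, NormedSpace.exp_eq_tsum ℂ]
  simp only []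
  rw [tsum_mul_tsum_of_summable_norm hs1 hs2]
  let E : (EllTwo d →L[ℂ] EllTwo d) →L[ℂ] ℂ :=
    (lp.evalCLM ℂ (fun _ : CubicLattice d => ℂ) 2 n) ∘L (ContinuousLinearMap.apply ℂ (EllTwo d) g)
  have hE : ∀ A, E A = A g n := fun A => rfl
  rw [← hE, E.map_tsum (summable_mul_of_summable_norm hs1 hs2)]
  refine tsum_congr fun p => ?_
  rw [smul_pow, smul_pow, smul_smul, smul_smul, smul_mul_smul_comm, shiftOp_pow, shiftOp_pow,
    shiftOp_mul, map_smul, hE, shiftOp_apply, smul_eq_mul, pow_add]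
  congr 1
  · rw [div_eq_mul_inv, mul_inv]; ring
  · rw [sub_smul, natCast_zsmul, natCast_zsmul, smul_neg, sub_eq_add_neg]

/-- The convolution kernel of `exp (c (S + S⁻¹))` for the shift `S` of `ℤ`. -/
noncomputable def hopKernel (c : ℂ) (k : ℤ) : ℂ :=
  ∑' q : ℕ, c ^ ((q + k.toNat) + (q + (-k).toNat)) /
    ((q + k.toNat).factorial * (q + (-k).toNat).factorial)

/-- Only hop counts with difference `k` survive; they are `(q + k⁺, q + k⁻)` with `q ≥ 0`, which
gives the single series of `hopKernel`. -/
theorem exp_hopOp_apply_of_eq_zero {d : ℕ} (c : ℂ) (j : Fin d) (g : EllTwo d) (n : CubicLattice d)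
    (k : ℤ) (hg : ∀ l : ℤ, l ≠ k → g (n + l • stdVec j) = 0) :
    NormedSpace.exp (hopOp c j) g n = hopKernel c k * g (n + k • stdVec j) := by
  have hinj : Function.Injective fun q : ℕ => (q + k.toNat, q + (-k).toNat) := fun q q' h => by
    simpa using congrArg Prod.fst h
  rw [exp_hopOp_apply, ← hinj.tsum_eq, hopKernel, ← tsum_mul_right]
  · refine tsum_congr fun q => ?_
    have : ((q + k.toNat : ℕ) : ℤ) - ((q + (-k).toNat : ℕ) : ℤ) = k := by omega
    simp only [this]
  · rintro ⟨p, q⟩ hpq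
    have hk : (p : ℤ) - q = k := by
      by_contra h
      exact hpq (by simp only [hg _ h, mul_zero])
    refine ⟨p - k.toNat, ?_⟩
    simp only [Prod.mk.injEq]
    omega

/-- As `c² = -t²/4`, factoring out `c^{|k|}` leaves `besselEntire` at `t²/4`, and `|c|^{|k|} =
(|t|/2)^{|k|}` is the prefactor of the Bessel function. -/
theorem norm_hopKernel {t : ℝ} (ht : t ≠ 0) (k : ℤ) :
    ‖hopKernel (Complex.I * t / 2) k‖ = |besselJ k.natAbs (|t|)| := by
  set c : ℂ := Complex.I * t / 2
  have hc : c ^ 2 = ((-(t ^ 2 / 4) : ℝ) : ℂ) := by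
    simp only [c, div_pow, mul_pow, Complex.I_sq]
    push_cast
    ring
  have hk : hopKernel c k = c ^ k.natAbs * ((besselEntire k.natAbs (t ^ 2 / 4) : ℝ) : ℂ) := by
    rw [hopKernel, besselEntire, Complex.ofReal_tsum, ← tsum_mul_left]
    refine tsum_congr fun q => ?_
    have hG : Real.Gamma ((q : ℝ) + (k.natAbs : ℝ) + 1) = ((q + k.natAbs).factorial : ℝ) := by
      rw [← Nat.cast_add, Real.Gamma_nat_eq_factorial]
    rw [hG, Complex.ofReal_div, Complex.ofReal_pow, ← hc]
    push_cast
    rcases le_total 0 k with h | h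
    · have h1 : k.toNat = k.natAbs := by omega
      have h2 : (-k).toNat = 0 := by omega
      rw [h1, h2, add_zero, ← pow_mul, mul_div_assoc', ← pow_add, mul_comm (q.factorial : ℂ)]
      congr 2
      ring
    · have h1 : (-k).toNat = k.natAbs := by omega
      have h2 : k.toNat = 0 := by omega
      rw [h1, h2, add_zero, ← pow_mul, mul_div_assoc', ← pow_add]
      congr 2
      ring
  have hcn : ‖c‖ = |t| / 2 := by simp [c]
  rw [hk, norm_mul, norm_pow, hcn, Complex.norm_real, Real.norm_eq_abs,
    besselJ_eq (abs_pos.2 ht), sq_abs, abs_mul, Real.rpow_natCast,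
    abs_of_nonneg (by positivity : 0 ≤ (|t| / 2) ^ k.natAbs)]

/-- Adding one coordinate direction at a time: hops in the directions of `s` leave the other
coordinates unchanged, so on each line in a new direction only one site contributes. -/
theorem exp_sum_hopOp_single {d : ℕ} (c : ℂ) (s : Finset (Fin d)) (m n : CubicLattice d) :
    NormedSpace.exp (∑ j ∈ s, hopOp c j) (lp.single 2 m (1 : ℂ)) n =
      if ∀ j ∉ s, n j = m j then ∏ j ∈ s, hopKernel c (m j - n j) else 0 := by
  classical
  induction s using Finset.induction_on generalizing n with
  | empty =>
    rw [Finset.sum_empty, NormedSpace.exp_zero, one_apply_eq_self, lp.single_apply,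
      Finset.prod_empty, Pi.single_apply]
    simp [funext_iff]
  | insert i s hi ih =>
    have hcomm : Commute (hopOp c i) (∑ j ∈ s, hopOp c j) :=
      Commute.sum_right _ _ _ fun j _ => hopOp_commute c i j
    rw [Finset.sum_insert hi, exp_add_of_commute_complex hcomm, mul_apply_eq_comp,
      exp_hopOp_apply_of_eq_zero c i _ n (m i - n i)]
    · rw [ih, Finset.prod_insert hi, mul_ite, mul_zero]
      have hne : ∀ j, j ≠ i → (n + (m i - n i) • stdVec i : CubicLattice d) j = n j := fun j hj => by
        simp [stdVec, hj]
      have he : (n + (m i - n i) • stdVec i : CubicLattice d) i = m i := by simp [stdVec]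
      refine if_congr ⟨fun h j hj => ?_, fun h j hj => ?_⟩ ?_ rfl
      · rw [Finset.mem_insert, not_or] at hj
        rw [← h j hj.2, hne j hj.1]
      · by_cases hji : j = i
        · rw [hji, he]
        · rw [hne j hji, h j (by simp [hji, hj])]
      · congr 1
        exact Finset.prod_congr rfl fun j hj => by rw [hne j fun h => hi (h ▸ hj)]
    · intro l hl
      rw [ih, if_neg]
      intro h
      have := h i hi
      simp [stdVec] at this
      omega

/-- The matrix entries of `e^{itΔ}`. -/
noncomputable def propagatorKernel (d : ℕ) (t : ℝ) (n m : CubicLattice d) : ℂ :=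
  propagator d t (lp.single 2 m (1 : ℂ)) n

theorem norm_propagatorKernel {d : ℕ} {t : ℝ} (ht : t ≠ 0) (n m : CubicLattice d) :
    ‖propagatorKernel d t n m‖ = ∏ j, |besselJ (n j - m j).natAbs (|t|)| := by
  rw [propagatorKernel, propagator_eq_exp_sum, exp_sum_hopOp_single, if_pos (by simp), norm_prod]
  refine Finset.prod_congr rfl fun j _ => ?_
  rw [norm_hopKernel ht, ← Int.natAbs_neg, neg_sub]

theorem star_shiftOp {d : ℕ} (e : CubicLattice d) : star (shiftOp e) = shiftOp (-e) := by
  rw [ContinuousLinearMap.star_eq_adjoint, eq_comm, ContinuousLinearMap.eq_adjoint_iff]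
  intro x y
  rw [lp.inner_eq_tsum, lp.inner_eq_tsum, ← (Equiv.addRight e).tsum_eq]
  refine tsum_congr fun n => ?_
  rw [Equiv.coe_addRight, shiftOp_apply, shiftOp_apply, add_neg_cancel_right]

theorem star_discreteLaplacian (d : ℕ) : star (discreteLaplacian d) = discreteLaplacian d := by
  rw [discreteLaplacian, star_smul, star_sum]
  congr 1
  · simp
  · refine Finset.sum_congr rfl fun j _ => ?_
    rw [star_add, star_shiftOp, star_shiftOp, neg_neg, add_comm]

/-- `Δ` is self-adjoint because the adjoint of `S_e` is `S_{-e}`; hence `itΔ` is skew-adjoint and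
its exponential unitary. -/
theorem norm_propagator_le_one (d : ℕ) (t : ℝ) : ‖propagator d t‖ ≤ 1 := by
  have hskew : (Complex.I * (t : ℂ)) • discreteLaplacian d ∈ skewAdjoint (EllTwo d →L[ℂ] EllTwo d) := by
    rw [skewAdjoint.mem_iff, star_smul, star_discreteLaplacian, ← neg_smul]
    congr 1
    simp
  have hU : propagator d t ∈ unitary (EllTwo d →L[ℂ] EllTwo d) :=
    letI := NormedAlgebra.restrictScalars ℚ ℂ (EllTwo d →L[ℂ] EllTwo d)
    NormedSpace.exp_mem_unitary_of_mem_skewAdjoint hskew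
  have h1 := CStarRing.norm_star_mul_self (x := propagator d t)
  rw [Unitary.star_mul_self_of_mem hU] at h1
  have h2 : ‖(1 : EllTwo d →L[ℂ] EllTwo d)‖ ≤ 1 := ContinuousLinearMap.norm_id_le
  nlinarith [norm_nonneg (propagator d t)]

/-! ### Passage between operators and their matrix forms -/

theorem norm_sum_single_eq_sqrt {d : ℕ} (s : Finset (CubicLattice d)) (f : CubicLattice d → ℂ) :
    ‖∑ n ∈ s, (lp.single 2 n (f n) : EllTwo d)‖ = √(∑ n ∈ s, ‖f n‖ ^ 2) := by
  have h := lp.norm_sum_single (p := 2) (by norm_num) f s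
  simp only [ENNReal.toReal_ofNat, Real.rpow_ofNat] at h
  rw [← h, Real.sqrt_sq (norm_nonneg _)]

theorem apply_sum_single {d : ℕ} (T : EllTwo d →L[ℂ] EllTwo d) (s : Finset (CubicLattice d))
    (g : CubicLattice d → ℂ) (n : CubicLattice d) :
    T (∑ m ∈ s, lp.single 2 m (g m)) n = ∑ m ∈ s, T (lp.single 2 m (1 : ℂ)) n * g m := by
  rw [map_sum, lp.coeFn_sum, Finset.sum_apply]
  refine Finset.sum_congr rfl fun m _ => ?_
  have : (lp.single 2 m (g m) : EllTwo d) = g m • lp.single 2 m (1 : ℂ) := by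
    rw [← lp.single_smul, smul_eq_mul, mul_one]
  rw [this, map_smul, lp.coeFn_smul, Pi.smul_apply, smul_eq_mul, mul_comm]

theorem FormBound.of_norm_le {d : ℕ} {T : EllTwo d →L[ℂ] EllTwo d} {M : ℝ} (h : ‖T‖ ≤ M) :
    FormBound (fun n m => T (lp.single 2 m (1 : ℂ)) n) M := by
  intro s f g
  have key : inner ℂ (∑ n ∈ s, (lp.single 2 n (star (f n)) : EllTwo d))
      (T (∑ m ∈ s, lp.single 2 m (g m))) =
        ∑ n ∈ s, ∑ m ∈ s, f n * T (lp.single 2 m (1 : ℂ)) n * g m := by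
    rw [sum_inner]
    refine Finset.sum_congr rfl fun n _ => ?_
    rw [lp.inner_single_left, apply_sum_single]
    simp only [RCLike.inner_apply, RCLike.star_def, Complex.conj_conj, Finset.sum_mul]
    refine Finset.sum_congr rfl fun m _ => ?_
    ring
  rw [← key]
  refine (norm_inner_le_norm _ _).trans ?_
  have h1 := T.le_of_opNorm_le h (∑ m ∈ s, lp.single 2 m (g m))
  have h2 := norm_sum_single_eq_sqrt s fun n => star (f n)
  simp only [norm_star] at h2
  rw [norm_sum_single_eq_sqrt] at h1
  rw [h2, mul_comm, mul_right_comm]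
  exact mul_le_mul_of_nonneg_right h1 (Real.sqrt_nonneg _)

/-- Testing the form against the conjugated coordinates of `T g` on a finite set bounds `T` on
finitely supported `g`; these are dense. -/
theorem FormBound.norm_le {d : ℕ} {T : EllTwo d →L[ℂ] EllTwo d} {M : ℝ} (hM : 0 ≤ M)
    (h : FormBound (fun n m => T (lp.single 2 m (1 : ℂ)) n) M) : ‖T‖ ≤ M := by
  classical
  have fin : ∀ (s : Finset (CubicLattice d)) (g : CubicLattice d → ℂ),
      ‖T (∑ m ∈ s, lp.single 2 m (g m))‖ ≤ M * ‖∑ m ∈ s, (lp.single 2 m (g m) : EllTwo d)‖ := by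
    intro s g
    refine lp.norm_le_of_forall_sum_le (by norm_num) (by positivity) fun s' => ?_
    simp only [ENNReal.toReal_ofNat, Real.rpow_ofNat]
    set y := T (∑ m ∈ s, lp.single 2 m (g m))
    set A := ∑ n ∈ s', ‖y n‖ ^ 2
    have hA : 0 ≤ A := Finset.sum_nonneg fun _ _ => by positivity
    have key := h (s ∪ s') (fun n => if n ∈ s' then star (y n) else 0)
      (fun m => if m ∈ s then g m else 0)
    have e1 : ∑ n ∈ s ∪ s', ∑ m ∈ s ∪ s', (if n ∈ s' then star (y n) else 0) *
        T (lp.single 2 m (1 : ℂ)) n * (if m ∈ s then g m else 0) = (A : ℂ) := by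
      simp only [A, Complex.ofReal_sum]
      rw [← Finset.sum_subset Finset.subset_union_right fun n _ hn => by simp [hn]]
      refine Finset.sum_congr rfl fun n hn => ?_
      rw [← Finset.sum_subset Finset.subset_union_left fun m _ hm => by simp [hm]]
      simp only [hn, if_true, mul_assoc, ← Finset.mul_sum]
      rw [Finset.sum_congr rfl fun m hm => by rw [if_pos hm], ← apply_sum_single]
      simp only [RCLike.star_def]
      rw [← Complex.normSq_eq_conj_mul_self, Complex.normSq_eq_norm_sq]
    have e2 : ∑ n ∈ s ∪ s', ‖(if n ∈ s' then star (y n) else 0)‖ ^ 2 = A := by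
      rw [← Finset.sum_subset Finset.subset_union_right fun n _ hn => by simp [hn]]
      exact Finset.sum_congr rfl fun n hn => by rw [if_pos hn, norm_star]
    have e3 : ∑ m ∈ s ∪ s', ‖(if m ∈ s then g m else 0)‖ ^ 2 = ∑ m ∈ s, ‖g m‖ ^ 2 := by
      rw [← Finset.sum_subset Finset.subset_union_left fun n _ hn => by simp [hn]]
      exact Finset.sum_congr rfl fun n hn => by rw [if_pos hn]
    rw [e1, e2, e3, ← norm_sum_single_eq_sqrt s g, Complex.norm_real, Real.norm_of_nonneg hA] at key
    set G := ‖∑ m ∈ s, (lp.single 2 m (g m) : EllTwo d)‖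
    have hs := Real.sq_sqrt hA
    rcases (Real.sqrt_nonneg A).eq_or_lt with h0 | h0
    · have hA0 : A = 0 := by rw [← hs, ← h0]; norm_num
      rw [hA0]
      positivity
    · have : √A ≤ M * G := by
        refine le_of_mul_le_mul_right ?_ h0
        nlinarith
      rw [← hs]
      exact pow_le_pow_left₀ h0.le this 2
  refine T.opNorm_le_bound hM fun f => ?_
  have hf := lp.hasSum_single (p := 2) (by norm_num) f
  exact le_of_tendsto_of_tendsto ((T.continuous.tendsto f).comp hf).norm (hf.norm.const_mul M)
    (Eventually.of_forall fun s => fin s f)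

theorem formBound_propagatorKernel (d : ℕ) (t : ℝ) : FormBound (propagatorKernel d t) 1 :=
  FormBound.of_norm_le (norm_propagator_le_one d t)

theorem norm_mulOp_comp_propagator_le {d : ℕ} {u v : CubicLattice d → ℂ} (hu : Memℓp u ∞)
    (hv : Memℓp v ∞) {t M : ℝ} (hM : 0 ≤ M)
    (h : FormBound (fun n m => u n * propagatorKernel d t n m * v m) M) :
    ‖mulOp u hu ∘L propagator d t ∘L mulOp v hv‖ ≤ M := by
  refine FormBound.norm_le hM ?_
  convert h using 3 with n m
  have : mulOp v hv (lp.single 2 m (1 : ℂ)) = v m • lp.single 2 m (1 : ℂ) := by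
    ext i
    rw [mulOp_apply, lp.coeFn_smul, Pi.smul_apply, smul_eq_mul, lp.single_apply]
    by_cases hi : i = m
    · rw [hi]
    · simp [hi]
  rw [ContinuousLinearMap.comp_apply, ContinuousLinearMap.comp_apply, this, mulOp_apply, map_smul,
    lp.coeFn_smul, Pi.smul_apply, smul_eq_mul, propagatorKernel]
  ring

/-! ### The weighted Hilbert–Schmidt bound -/

/-- The numbers `|J_{|n-m|}(t)|` are the moduli of a column of the one-dimensional propagator, whose
norm is at most one. -/
theorem sum_besselJ_sq_le_one {t : ℝ} (ht : 0 < t) (s : Finset ℤ) (m : ℤ) :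
    ∑ n ∈ s, besselJ (n - m).natAbs t ^ 2 ≤ 1 := by
  have h1 := lp.sum_rpow_le_norm_rpow (p := 2) (by norm_num)
    (propagator 1 t (lp.single 2 (fun _ => m) (1 : ℂ))) (s.map ⟨fun n _ => n, fun a b h => congrFun h 0⟩)
  simp only [ENNReal.toReal_ofNat, Real.rpow_ofNat, Finset.sum_map] at h1
  have h2 := (propagator 1 t).le_of_opNorm_le (norm_propagator_le_one 1 t)
    (lp.single 2 (fun _ => m) (1 : ℂ))
  rw [lp.norm_single (by norm_num), norm_one, mul_one] at h2
  calc ∑ n ∈ s, besselJ (n - m).natAbs t ^ 2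
      = ∑ n ∈ s, ‖propagatorKernel 1 t (fun _ => n) (fun _ => m)‖ ^ 2 := by
        refine Finset.sum_congr rfl fun n _ => ?_
        rw [norm_propagatorKernel ht.ne', Fin.prod_univ_one, sq_abs, abs_of_pos ht]
    _ ≤ _ := h1
    _ ≤ 1 := pow_le_one₀ (norm_nonneg _) h2

/-- Comparison with a telescoping sum of `x^{1-p}/(p-1)`, where Bernoulli's inequality replaces the
integral comparison. -/
theorem sum_range_rpow_neg_le {p : ℝ} (hp : 1 < p) (N : ℕ) :
    ∑ k ∈ Finset.range N, ((k : ℝ) + 2) ^ (-p) ≤ 1 / (p - 1) := by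
  have hp' : 0 < p - 1 := by linarith
  have key : ∑ k ∈ Finset.range N, ((k : ℝ) + 2) ^ (-p) ≤
      (1 - ((N : ℝ) + 1) ^ (1 - p)) / (p - 1) := by
    induction N with
    | zero => simp
    | succ N ih =>
      rw [Finset.sum_range_succ]
      have hN : (0 : ℝ) < (N : ℝ) + 2 := by positivity
      have h1 : 1 + p * (1 / ((N : ℝ) + 1)) ≤ (1 + 1 / ((N : ℝ) + 1)) ^ p :=
        one_add_mul_self_le_rpow_one_add (by
          have : (0 : ℝ) ≤ 1 / ((N : ℝ) + 1) := by positivity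
          linarith) hp.le
      have h3 : (1 + 1 / ((N : ℝ) + 1)) ^ p = ((N : ℝ) + 2) ^ p / ((N : ℝ) + 1) ^ p := by
        rw [← Real.div_rpow (by positivity) (by positivity)]
        congr 1
        field_simp
        ring
      have hx := Real.rpow_pos_of_pos hN p
      have hy := Real.rpow_pos_of_pos (show (0 : ℝ) < (N : ℝ) + 1 by positivity) p
      have e1 : ((N : ℝ) + 1) ^ (1 - p) = ((N : ℝ) + 1) / ((N : ℝ) + 1) ^ p := by
        rw [Real.rpow_sub (by positivity), Real.rpow_one]
      have e2 : ((N : ℝ) + 2) ^ (1 - p) = ((N : ℝ) + 2) / ((N : ℝ) + 2) ^ p := by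
        rw [Real.rpow_sub (by positivity), Real.rpow_one]
      have h4 : (p - 1) * ((N : ℝ) + 2) ^ (-p) ≤ ((N : ℝ) + 1) ^ (1 - p) - ((N : ℝ) + 2) ^ (1 - p) := by
        rw [h3, le_div_iff₀ hy] at h1
        rw [e1, e2, Real.rpow_neg hN.le]
        rw [le_sub_iff_add_le, ← div_eq_mul_inv, ← add_div, div_le_div_iff₀ hx hy]
        have e : (p - 1 + ((N : ℝ) + 2)) * ((N : ℝ) + 1) ^ p =
            ((N : ℝ) + 1) * ((1 + p * (1 / ((N : ℝ) + 1))) * ((N : ℝ) + 1) ^ p) := by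
          field_simp
          ring
        rw [e]
        gcongr
      push_cast
      rw [show (N : ℝ) + 1 + 1 = N + 2 by ring]
      calc _ ≤ (1 - ((N : ℝ) + 1) ^ (1 - p)) / (p - 1) +
            (((N : ℝ) + 1) ^ (1 - p) - ((N : ℝ) + 2) ^ (1 - p)) / (p - 1) :=
            add_le_add ih ((le_div_iff₀' hp').2 h4)
        _ = _ := by ring
  refine key.trans ?_
  have := Real.rpow_nonneg (show (0 : ℝ) ≤ (N : ℝ) + 1 by positivity) (1 - p)
  gcongr
  linarith

theorem sum_one_add_abs_rpow_le {p : ℝ} (hp : 1 < p) (s : Finset ℤ) :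
    ∑ n ∈ s, (1 + |(n : ℝ)|) ^ (-p) ≤ 1 + 2 / (p - 1) := by
  obtain ⟨N, hN⟩ : ∃ N : ℕ, s ⊆ Finset.Icc (-(N : ℤ)) N := by
    refine ⟨s.sup Int.natAbs, fun n hn => ?_⟩
    have : n.natAbs ≤ s.sup Int.natAbs := Finset.le_sup (f := Int.natAbs) hn
    rw [Finset.mem_Icc]
    omega
  have h0 : ∀ n : ℤ, 0 ≤ (1 + |(n : ℝ)|) ^ (-p) := fun n => by positivity
  refine (Finset.sum_le_sum_of_subset_of_nonneg hN fun n _ _ => h0 n).trans ?_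
  have key : ∀ N : ℕ, ∑ n ∈ Finset.Icc (-(N : ℤ)) N, (1 + |(n : ℝ)|) ^ (-p) =
      1 + 2 * ∑ k ∈ Finset.range N, ((k : ℝ) + 2) ^ (-p) := by
    intro N
    induction N with
    | zero => simp
    | succ N ih =>
      have hI : Finset.Icc (-((N + 1 : ℕ) : ℤ)) ((N + 1 : ℕ) : ℤ) =
          insert (-((N + 1 : ℕ) : ℤ)) (insert ((N + 1 : ℕ) : ℤ) (Finset.Icc (-(N : ℤ)) N)) := by
        ext n
        simp only [Finset.mem_insert, Finset.mem_Icc]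
        omega
      have ha : |(N : ℝ) + 1| = N + 1 := abs_of_nonneg (by positivity)
      rw [hI, Finset.sum_insert, Finset.sum_insert, ih, Finset.sum_range_succ]
      · push_cast
        rw [abs_neg, ha, show 1 + ((N : ℝ) + 1) = N + 2 by ring]
        ring
      · simp
      · simp only [Finset.mem_insert, Finset.mem_Icc]
        omega
  rw [key]
  have := sum_range_rpow_neg_le hp N
  have e : 2 / (p - 1) = 2 * (1 / (p - 1)) := by ring
  linarith

/-- For `1 ≤ |k| ≤ t/2` one has `t² - k² ≥ (3/4) t²`, and `2/π ≤ 3/4`. The order `0` lies outside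
that estimate and is covered by Sonin's bound. -/
theorem besselJ_natAbs_sq_le {t : ℝ} (ht : 0 < t) (k : ℤ) (hk : 2 * |(k : ℝ)| ≤ t) :
    besselJ k.natAbs t ^ 2 ≤ 1 / t := by
  have hpi : 2 / Real.pi ≤ 3 / 4 := by
    rw [div_le_div_iff₀ Real.pi_pos (by norm_num)]
    linarith [Real.pi_gt_three]
  have hka : |(k : ℝ)| = (k.natAbs : ℝ) := by rw [Nat.cast_natAbs, Int.cast_abs]
  rw [hka] at hk
  rw [le_div_iff₀' ht]
  rcases Nat.eq_zero_or_pos k.natAbs with h | h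
  · rw [h]
    exact (mul_besselJ_sq_le_of_le_half (by simp) (by simp) ht).trans (hpi.trans (by norm_num))
  · have h1 : (1 : ℝ) ≤ k.natAbs := by exact_mod_cast h
    have h2 := besselJ_sq_mul_le (ν := (k.natAbs : ℝ)) (by linarith) ht
    have h3 : 3 / 4 * t ^ 2 ≤ t ^ 2 - (k.natAbs : ℝ) ^ 2 := by nlinarith
    have h4 : 3 / 4 * t ^ 2 * besselJ k.natAbs t ^ 2 ≤ 3 / 4 * t :=
      (mul_le_mul_of_nonneg_right h3 (sq_nonneg _)).trans (h2.trans (by gcongr))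
    refine le_of_mul_le_mul_left ?_ (show 0 < 3 / 4 * t by positivity)
    linarith

theorem one_add_rpow_le {a t x : ℝ} (ha : 1 / 2 < a) (ht : 0 < t) (hx : t ≤ 4 * x) :
    (1 + x) ^ (-(2 * a)) ≤ 4 / t := by
  have h1 : (1 + x) ^ (-(2 * a)) ≤ (1 + x) ^ (-1 : ℝ) :=
    Real.rpow_le_rpow_of_exponent_le (by linarith) (by linarith)
  rw [Real.rpow_neg_one] at h1
  refine h1.trans ?_
  rw [inv_eq_one_div, div_le_div_iff₀ (by linarith) ht]
  linarith

/-- If `|n - m| ≤ t/2` the Bessel factor is at most `1/t` and the weights are summable. Otherwise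
`|n|` or `|m|` exceeds `t/4`, the corresponding weight is at most `4/t`, and unitarity sums the
Bessel factor along the other index. -/
theorem sum_weighted_besselJ_sq_le {a t : ℝ} (ha : 1 / 2 < a) (ht : 0 < t) (s : Finset ℤ) :
    ∑ n ∈ s, ∑ m ∈ s, (1 + |(n : ℝ)|) ^ (-(2 * a)) * besselJ (n - m).natAbs t ^ 2 *
      (1 + |(m : ℝ)|) ^ (-(2 * a)) ≤ (3 * (1 + 2 * a / (2 * a - 1))) ^ 2 / t := by
  set ω : ℤ → ℝ := fun n => (1 + |(n : ℝ)|) ^ (-(2 * a)) with hω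
  have hω0 : ∀ n, 0 ≤ ω n := fun n => by positivity
  have hω1 : ∀ n, ω n ≤ 1 := fun n =>
    Real.rpow_le_one_of_one_le_of_nonpos (by linarith [abs_nonneg (n : ℝ)]) (by linarith)
  set b : ℤ → ℝ := fun k => besselJ k.natAbs t ^ 2
  have hb0 : ∀ k, 0 ≤ b k := fun k => sq_nonneg _
  have hbs : ∀ k, b (-k) = b k := fun k => by simp only [b, Int.natAbs_neg]
  have term : ∀ n m : ℤ, ω n * b (n - m) * ω m ≤
      1 / t * (ω n * ω m) + 4 / t * (ω m * b (n - m)) + 4 / t * (ω n * b (m - n)) := by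
    intro n m
    have hbsym : b (m - n) = b (n - m) := by rw [← hbs, neg_sub]
    rw [hbsym]
    have hn := hω0 n
    have hm := hω0 m
    have hb := hb0 (n - m)
    have p1 : 0 ≤ 1 / t * (ω n * ω m) := by positivity
    have p2 : 0 ≤ 4 / t * (ω m * b (n - m)) := by positivity
    have p3 : 0 ≤ 4 / t * (ω n * b (n - m)) := by positivity
    by_cases hk : 2 * |((n - m : ℤ) : ℝ)| ≤ t
    · have := mul_le_mul_of_nonneg_right (besselJ_natAbs_sq_le ht _ hk) (mul_nonneg hn hm)
      have e : ω n * b (n - m) * ω m = b (n - m) * (ω n * ω m) := by ring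
      rw [e]
      linarith
    · push_cast at hk
      have htri : |(n : ℝ) - m| ≤ |(n : ℝ)| + |(m : ℝ)| := abs_sub _ _
      rcases le_total |(n : ℝ)| |(m : ℝ)| with h | h
      · have : ω m ≤ 4 / t := one_add_rpow_le ha ht (by linarith)
        have := mul_le_mul_of_nonneg_right this (mul_nonneg hn hb)
        linarith
      · have : ω n ≤ 4 / t := one_add_rpow_le ha ht (by linarith)
        have := mul_le_mul_of_nonneg_right this (mul_nonneg hm hb)
        linarith
  set S := ∑ n ∈ s, ω n
  have hS0 : 0 ≤ S := Finset.sum_nonneg fun n _ => hω0 n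
  have hS : S ≤ 1 + 2 / (2 * a - 1) := sum_one_add_abs_rpow_le (by linarith) s
  have hcol : ∑ n ∈ s, ω n * ∑ m ∈ s, b (m - n) ≤ S := by
    refine Finset.sum_le_sum fun n _ => mul_le_of_le_one_right (hω0 n) ?_
    exact sum_besselJ_sq_le_one ht s n
  calc ∑ n ∈ s, ∑ m ∈ s, ω n * b (n - m) * ω m
      ≤ ∑ n ∈ s, ∑ m ∈ s, (1 / t * (ω n * ω m) + 4 / t * (ω m * b (n - m)) +
          4 / t * (ω n * b (m - n))) :=
        Finset.sum_le_sum fun n _ => Finset.sum_le_sum fun m _ => term n m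
    _ = 1 / t * (S * S) + 4 / t * (∑ n ∈ s, ω n * ∑ m ∈ s, b (m - n)) +
          4 / t * (∑ n ∈ s, ω n * ∑ m ∈ s, b (m - n)) := by
        simp only [Finset.sum_add_distrib, ← Finset.mul_sum]
        rw [Finset.sum_mul_sum]
        simp only [← Finset.mul_sum]
        congr 3
        rw [Finset.sum_comm]
        simp only [Finset.mul_sum]
    _ ≤ 1 / t * (S * S) + 4 / t * S + 4 / t * S := by gcongr
    _ = (S * S + 8 * S) / t := by ring
    -- With `x = 1/(2a - 1)` and `S ≤ 1 + 2x`, one has `S² + 8S ≤ 9 + 20x + 4x² ≤ 9(2 + x)²`.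
    _ ≤ _ := by
        gcongr
        set x := 1 / (2 * a - 1) with hx
        have hx0 : 0 < x := one_div_pos.2 (by linarith)
        have e1 : 2 / (2 * a - 1) = 2 * x := by rw [hx]; ring
        have e2 : 2 * a / (2 * a - 1) = 1 + x := by
          have : 2 * a - 1 ≠ 0 := by linarith
          rw [hx]; field_simp; ring
        rw [e1] at hS
        rw [e2]
        nlinarith

/-- Enclosing the finite set in a box makes the double sum factor over the coordinates. -/
theorem sum_sum_prod_le_pow {d : ℕ} {φ : ℤ → ℤ → ℝ} {B : ℝ} (hφ : ∀ n m, 0 ≤ φ n m)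
    (h : ∀ I : Finset ℤ, ∑ n ∈ I, ∑ m ∈ I, φ n m ≤ B) (s : Finset (CubicLattice d)) :
    ∑ n ∈ s, ∑ m ∈ s, ∏ j, φ (n j) (m j) ≤ B ^ d := by
  set I : Fin d → Finset ℤ := fun j => s.image fun n => n j
  have hs : s ⊆ Fintype.piFinset I := fun n hn => by
    rw [Fintype.mem_piFinset]
    exact fun j => Finset.mem_image_of_mem (fun n : CubicLattice d => n j) hn
  have h0 : ∀ n m : CubicLattice d, 0 ≤ ∏ j, φ (n j) (m j) := fun n m =>
    Finset.prod_nonneg fun j _ => hφ _ _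
  calc ∑ n ∈ s, ∑ m ∈ s, ∏ j, φ (n j) (m j)
      ≤ ∑ n ∈ s, ∑ m ∈ Fintype.piFinset I, ∏ j, φ (n j) (m j) :=
        Finset.sum_le_sum fun n _ => Finset.sum_le_sum_of_subset_of_nonneg hs fun m _ _ => h0 n m
    _ ≤ ∑ n ∈ Fintype.piFinset I, ∑ m ∈ Fintype.piFinset I, ∏ j, φ (n j) (m j) :=
        Finset.sum_le_sum_of_subset_of_nonneg hs fun n _ _ => Finset.sum_nonneg fun m _ => h0 n m
    _ = ∏ j, ∑ n ∈ I j, ∑ m ∈ I j, φ n m := by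
        rw [Finset.prod_univ_sum]
        exact Finset.sum_congr rfl fun n _ => (Finset.prod_univ_sum I fun j m => φ (n j) m).symm
    _ ≤ ∏ _j : Fin d, B := Finset.prod_le_prod
        (fun j _ => Finset.sum_nonneg fun n _ => Finset.sum_nonneg fun m _ => hφ n m)
        fun j _ => h (I j)
    _ = B ^ d := by simp

theorem rho_rpow {d : ℕ} (p : ℝ) (n : CubicLattice d) :
    rho n ^ p = ∏ j, (1 + |(n j : ℝ)|) ^ (-p) := by
  rw [rho, ← Real.finsetProd_rpow _ _ fun j _ => by positivity]
  refine Finset.prod_congr rfl fun j _ => ?_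
  rw [Real.inv_rpow (by positivity), Real.rpow_neg (by positivity)]

/-- The decay constant of `ρ^a e^{itΔ} ρ^a`. -/
noncomputable def decayConst (d : ℕ) (a t : ℝ) : ℝ :=
  (3 * (1 + 2 * a / (2 * a - 1)) * |t| ^ (-(1 / 2) : ℝ)) ^ d

theorem weightConst_pos {a : ℝ} (ha : 1 / 2 < a) : 0 < 3 * (1 + 2 * a / (2 * a - 1)) := by
  have : 0 < 2 * a - 1 := by linarith
  positivity

theorem decayConst_nonneg {d : ℕ} {a t : ℝ} (ha : 1 / 2 < a) : 0 ≤ decayConst d a t :=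
  pow_nonneg (mul_nonneg (weightConst_pos ha).le (by positivity)) d

/-- The square of the weighted kernel is a product over coordinates, so its Hilbert–Schmidt sum is
at most the `d`-th power of the one-dimensional one. -/
theorem formBound_rho_rpow {d : ℕ} {a t : ℝ} (ha : 1 / 2 < a) (ht : t ≠ 0) :
    FormBound (fun n m => ((rho n ^ a : ℝ) : ℂ) * propagatorKernel d t n m * ((rho m ^ a : ℝ) : ℂ))
      (decayConst d a t) := by
  have ht' : 0 < |t| := abs_pos.2 ht
  refine FormBound.of_sum_sq_le (decayConst_nonneg ha) fun s => ?_
  have hB : decayConst d a t ^ 2 = ((3 * (1 + 2 * a / (2 * a - 1))) ^ 2 / |t|) ^ d := by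
    rw [decayConst, ← pow_mul, mul_comm d 2, pow_mul, mul_pow, ← Real.rpow_mul_natCast ht'.le]
    norm_num [Real.rpow_neg_one, div_eq_mul_inv]
  rw [hB]
  refine le_trans (le_of_eq ?_) (sum_sum_prod_le_pow
    (φ := fun n m => (1 + |(n : ℝ)|) ^ (-(2 * a)) * besselJ (n - m).natAbs (|t|) ^ 2 *
      (1 + |(m : ℝ)|) ^ (-(2 * a))) (fun n m => by positivity)
    (sum_weighted_besselJ_sq_le ha ht') s)
  refine Finset.sum_congr rfl fun n _ => Finset.sum_congr rfl fun m _ => ?_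
  have hr : ∀ n : CubicLattice d, (rho n ^ a) ^ 2 = rho n ^ (2 * a) := fun n => by
    rw [← Real.rpow_mul_natCast (rho_pos n).le, mul_comm a]
    norm_num
  rw [norm_mul, norm_mul, Complex.norm_real, Complex.norm_real, norm_propagatorKernel ht, mul_pow,
    mul_pow, Real.norm_eq_abs, Real.norm_eq_abs, sq_abs, sq_abs, hr, hr, rho_rpow, rho_rpow,
    Finset.prod_mul_distrib, Finset.prod_mul_distrib, Finset.prod_pow, ← Finset.abs_prod, sq_abs]

/-! ### Interpolation and conclusion -/

/-- Interpolation with parameter `κ/a` between unitarity and the decay estimate for the weight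
`ρ^a`. -/
theorem formBound_rho_rpow_of_le {d : ℕ} {a t κ : ℝ} (ha : 1 / 2 < a) (ht : t ≠ 0) (h0 : 0 ≤ κ)
    (hκ : κ ≤ a) :
    FormBound (fun n m => ((rho n ^ κ : ℝ) : ℂ) * propagatorKernel d t n m * ((rho m ^ κ : ℝ) : ℂ))
      (decayConst d a t ^ (κ / a)) := by
  have ha' : 0 < a := by linarith
  rcases h0.eq_or_lt with rfl | h0
  · simpa using formBound_propagatorKernel d t
  rcases hκ.eq_or_lt with rfl | hκ
  · simpa [ha'.ne'] using formBound_rho_rpow ha ht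
  have H := FormBound.interpolate (A₀ := fun _ => 1) (B₀ := fun _ => 1) (M₀ := 1) (θ := κ / a)
    (fun _ => zero_le_one) (fun n => Real.rpow_nonneg (rho_pos n).le a) (fun _ => zero_le_one)
    (fun n => Real.rpow_nonneg (rho_pos n).le a) zero_le_one (decayConst_nonneg ha)
    (by positivity) ((div_lt_one ha').2 hκ) (by simpa using formBound_propagatorKernel d t)
    (formBound_rho_rpow ha ht)
  have e : ∀ n : CubicLattice d, (rho n ^ a) ^ (κ / a) = rho n ^ κ := fun n => by
    rw [← Real.rpow_mul (rho_pos n).le, mul_div_cancel₀ _ ha'.ne']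
  simpa only [Real.one_rpow, one_mul, e] using H

/-- Landau's bound controls every entry of the kernel, and weights in the unit ball of `ℓ²` turn
this uniform bound into a Hilbert–Schmidt bound. -/
theorem formBound_of_sum_sq_le_one {d : ℕ} {C t : ℝ} (hC0 : 0 ≤ C)
    (hC : ∀ ν t : ℝ, 0 ≤ ν → 0 < t → |besselJ ν t| ≤ C * t ^ (-(1 / 3) : ℝ)) (ht : t ≠ 0)
    {W V : CubicLattice d → ℝ} (hW : ∀ s : Finset (CubicLattice d), ∑ n ∈ s, W n ^ 2 ≤ 1)
    (hV : ∀ s : Finset (CubicLattice d), ∑ n ∈ s, V n ^ 2 ≤ 1) :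
    FormBound (fun n m => (W n : ℂ) * propagatorKernel d t n m * (V m : ℂ))
      ((C * |t| ^ (-(1 / 3) : ℝ)) ^ d) := by
  have hM : 0 ≤ (C * |t| ^ (-(1 / 3) : ℝ)) ^ d := by positivity
  have hk : ∀ n m, ‖propagatorKernel d t n m‖ ≤ (C * |t| ^ (-(1 / 3) : ℝ)) ^ d := fun n m => by
    rw [norm_propagatorKernel ht]
    refine (Finset.prod_le_prod (fun j _ => abs_nonneg _)
      fun j _ => hC _ _ (Nat.cast_nonneg _) (abs_pos.2 ht)).trans (le_of_eq ?_)
    simp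
  refine FormBound.of_sum_sq_le hM fun s => ?_
  set M := (C * |t| ^ (-(1 / 3) : ℝ)) ^ d
  calc ∑ n ∈ s, ∑ m ∈ s, ‖(W n : ℂ) * propagatorKernel d t n m * (V m : ℂ)‖ ^ 2
      ≤ ∑ n ∈ s, ∑ m ∈ s, M ^ 2 * (W n ^ 2 * V m ^ 2) := by
        refine Finset.sum_le_sum fun n _ => Finset.sum_le_sum fun m _ => ?_
        rw [norm_mul, norm_mul, Complex.norm_real, Complex.norm_real, mul_pow, mul_pow,
          Real.norm_eq_abs, Real.norm_eq_abs, sq_abs, sq_abs, mul_right_comm, mul_comm]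
        have := pow_le_pow_left₀ (norm_nonneg _) (hk n m) 2
        gcongr
    _ = M ^ 2 * ((∑ n ∈ s, W n ^ 2) * ∑ m ∈ s, V m ^ 2) := by
        rw [Finset.sum_mul_sum]
        simp only [Finset.mul_sum]
    _ ≤ M ^ 2 * (1 * 1) := by
        have := hW s
        have := hV s
        have : 0 ≤ ∑ n ∈ s, V n ^ 2 := Finset.sum_nonneg fun _ _ => sq_nonneg _
        gcongr
    _ = M ^ 2 := by ring

/-- Interpolation with parameter `θ = 2/q` between the weights `ρ^{κ/(1-θ)}` and the `ℓ²` weights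
`W^{1/θ}`, `V^{1/θ}`. The condition `κ ≤ a(1 - θ)` says that the first exponent does not exceed `a`.
At `θ = 1` it forces `κ = 0`. -/
theorem formBound_rho_rpow_mul {d : ℕ} {a C t κ θ : ℝ} (ha : 1 / 2 < a) (hC0 : 0 ≤ C)
    (hC : ∀ ν t : ℝ, 0 ≤ ν → 0 < t → |besselJ ν t| ≤ C * t ^ (-(1 / 3) : ℝ)) (ht : t ≠ 0)
    (hκ : 0 ≤ κ) (hκa : κ ≤ a * (1 - θ)) (hθ : 0 < θ) (hθ1 : θ ≤ 1)
    {W V : CubicLattice d → ℝ} (hW0 : ∀ n, 0 ≤ W n) (hV0 : ∀ n, 0 ≤ V n)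
    (hW : ∀ s : Finset (CubicLattice d), ∑ n ∈ s, W n ^ (2 / θ) ≤ 1)
    (hV : ∀ s : Finset (CubicLattice d), ∑ n ∈ s, V n ^ (2 / θ) ≤ 1) :
    FormBound (fun n m => ((rho n ^ κ * W n : ℝ) : ℂ) * propagatorKernel d t n m *
      ((rho m ^ κ * V m : ℝ) : ℂ))
      (decayConst d a t ^ (κ / a) * ((C * |t| ^ (-(1 / 3) : ℝ)) ^ d) ^ θ) := by
  have ha' : 0 < a := by linarith
  rcases hθ1.eq_or_lt with rfl | hθ1
  · have hκ0 : κ = 0 := le_antisymm (by linarith) hκ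
    subst hκ0
    simp only [div_one, Real.rpow_ofNat] at hW hV
    simpa using formBound_of_sum_sq_le_one hC0 hC ht hW hV
  have hθ' : 0 < 1 - θ := by linarith
  have hsq : ∀ x : ℝ, 0 ≤ x → (x ^ (1 / θ)) ^ 2 = x ^ (2 / θ) := fun x hx => by
    rw [← Real.rpow_mul_natCast hx]
    congr 1
    push_cast
    ring
  have H := FormBound.interpolate (θ := θ)
    (fun n => Real.rpow_nonneg (rho_pos n).le (κ / (1 - θ))) (fun n => Real.rpow_nonneg (hW0 n) (1 / θ))
    (fun n => Real.rpow_nonneg (rho_pos n).le (κ / (1 - θ))) (fun n => Real.rpow_nonneg (hV0 n) (1 / θ))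
    (Real.rpow_nonneg (decayConst_nonneg ha) _) (by positivity) hθ hθ1
    (formBound_rho_rpow_of_le (d := d) (κ := κ / (1 - θ)) ha ht (by positivity)
      ((div_le_iff₀ hθ').2 hκa))
    (formBound_of_sum_sq_le_one hC0 hC ht (fun s => by simpa only [hsq _ (hW0 _)] using hW s)
      (fun s => by simpa only [hsq _ (hV0 _)] using hV s))
  have e1 : ∀ n : CubicLattice d, (rho n ^ (κ / (1 - θ))) ^ (1 - θ) = rho n ^ κ := fun n => by
    rw [← Real.rpow_mul (rho_pos n).le, div_mul_cancel₀ _ hθ'.ne']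
  have e2 : ∀ x : ℝ, 0 ≤ x → (x ^ (1 / θ)) ^ θ = x := fun x hx => by
    rw [← Real.rpow_mul hx, one_div_mul_cancel hθ.ne', Real.rpow_one]
  have e3 : (decayConst d a t ^ (κ / (1 - θ) / a)) ^ (1 - θ) = decayConst d a t ^ (κ / a) := by
    rw [← Real.rpow_mul (decayConst_nonneg ha)]
    congr 1
    field_simp
  rw [e3] at H
  simpa only [e1, e2 _ (hW0 _), e2 _ (hV0 _)] using H

/-- Interpolation needs nonnegative weights; the phases and the norm of `w` go into the bounded
factor `α`. For `w = 0` the convention `x/0 = 0` yields `W = 0`. -/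
theorem exists_normalized {ι : Type*} {q : ℝ≥0∞} (hq : 0 < q.toReal) (w : lp (fun _ : ι => ℂ) q) :
    ∃ (W : ι → ℝ) (α : ι → ℂ), (∀ n, 0 ≤ W n) ∧ (∀ n, ‖α n‖ ≤ ‖w‖) ∧ (∀ n, w n = α n * W n) ∧
      ∀ s : Finset ι, ∑ n ∈ s, W n ^ q.toReal ≤ 1 := by
  have hw := lp.norm_nonneg' w
  have hq0 : q ≠ 0 := fun h => by simp [h] at hq
  refine ⟨fun n => ‖w n‖ / ‖w‖, fun n => w n / ((‖w n‖ / ‖w‖ : ℝ) : ℂ), fun n => by positivity,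
    fun n => ?_, fun n => ?_, fun s => ?_⟩
  · by_cases hn : w n = 0
    · simp [hn, hw]
    · have : ‖w n‖ ≠ 0 := norm_ne_zero_iff.2 hn
      rw [norm_div, Complex.norm_real, norm_div, norm_norm, Real.norm_of_nonneg hw,
        div_div_cancel₀ this]
  · by_cases hn : w n = 0
    · simp [hn]
    · have h1 : 0 < ‖w n‖ := norm_pos_iff.2 hn
      have h2 : 0 < ‖w‖ := h1.trans_le (lp.norm_apply_le_norm hq0 w n)
      rw [div_mul_cancel₀]
      exact_mod_cast (div_pos h1 h2).ne'
  · simp only [Real.div_rpow (norm_nonneg _) hw, ← Finset.sum_div]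
    exact div_le_one_of_le₀ (lp.sum_rpow_le_norm_rpow hq w s) (by positivity)

theorem formBound_rho_rpow_mul_lp {d : ℕ} {a C t κ : ℝ} {q : ℝ≥0∞} (ha : 1 / 2 < a) (hC0 : 0 ≤ C)
    (hC : ∀ ν t : ℝ, 0 ≤ ν → 0 < t → |besselJ ν t| ≤ C * t ^ (-(1 / 3) : ℝ)) (ht : t ≠ 0)
    (hq : 2 ≤ q) (hκ : 0 ≤ κ) (hκa : κ ≤ a * (1 - 2 * (1 / q).toReal))
    (w z : lp (fun _ : CubicLattice d => ℂ) q) :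
    FormBound (fun n m => ((rho n ^ κ : ℝ) : ℂ) * w n * propagatorKernel d t n m *
      (((rho m ^ κ : ℝ) : ℂ) * z m))
      (decayConst d a t ^ (κ / a) * ((C * |t| ^ (-(1 / 3) : ℝ)) ^ d) ^ (2 * (1 / q).toReal) *
        ‖w‖ * ‖z‖) := by
  have hD := Real.rpow_nonneg (decayConst_nonneg (d := d) (t := t) ha) (κ / a)
  by_cases hqt : q = ∞
  · subst hqt
    have H := (formBound_rho_rpow_of_le (d := d) ha ht hκ (by simpa using hκa)).mul_mul hD
      (lp.norm_nonneg' w) (lp.norm_nonneg' z) (fun n => lp.norm_apply_le_norm (by simp) w n)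
      (fun n => lp.norm_apply_le_norm (by simp) z n)
    have e : ∀ n m, w n * (((rho n ^ κ : ℝ) : ℂ) * propagatorKernel d t n m * ((rho m ^ κ : ℝ) : ℂ)) *
        z m = ((rho n ^ κ : ℝ) : ℂ) * w n * propagatorKernel d t n m *
          (((rho m ^ κ : ℝ) : ℂ) * z m) := fun n m => by ring
    simp only [e] at H
    simpa using H
  · have hp : 2 ≤ q.toReal := by
      simpa using ENNReal.toReal_mono hqt hq
    have hr : (1 / q).toReal = 1 / q.toReal := by simp
    have h2 : 2 / (2 * (1 / q).toReal) = q.toReal := by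
      rw [hr]
      field_simp
    obtain ⟨W, α, hW0, hα, hwα, hW⟩ := exists_normalized (by linarith) w
    obtain ⟨V, β, hV0, hβ, hzβ, hV⟩ := exists_normalized (by linarith) z
    have H := (formBound_rho_rpow_mul (d := d) ha hC0 hC ht hκ hκa
      (by rw [hr]; positivity) (by rw [hr, ← div_eq_mul_one_div, div_le_one (by linarith)]; exact hp)
      hW0 hV0 (by rwa [h2]) (by rwa [h2])).mul_mul (mul_nonneg hD (by positivity))
      (lp.norm_nonneg' w) (lp.norm_nonneg' z) hα hβ
    have e : ∀ n m, α n * (((rho n ^ κ * W n : ℝ) : ℂ) * propagatorKernel d t n m *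
        ((rho m ^ κ * V m : ℝ) : ℂ)) * β m = ((rho n ^ κ : ℝ) : ℂ) * w n * propagatorKernel d t n m *
          (((rho m ^ κ : ℝ) : ℂ) * z m) := fun n m => by
      rw [hwα, hzβ]
      push_cast
      ring
    simpa only [e] using H

theorem decayConst_rpow_mul {d : ℕ} {a C t κ r : ℝ} (ha : 1 / 2 < a) (hC0 : 0 ≤ C) (ht : t ≠ 0) :
    decayConst d a t ^ (κ / a) * ((C * |t| ^ (-(1 / 3) : ℝ)) ^ d) ^ (2 * r) =
      C ^ (2 * d * r) * (3 * (1 + 2 * a / (2 * a - 1))) ^ (d * κ / a) *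
        |t| ^ (-(d * (2 / 3 * r + κ / (2 * a)))) := by
  have ht' : 0 < |t| := abs_pos.2 ht
  have hc := weightConst_pos ha
  have hp : ∀ x : ℝ, 0 ≤ |t| ^ x := fun x => by positivity
  rw [decayConst, ← Real.rpow_natCast, ← Real.rpow_natCast, ← Real.rpow_mul (by positivity),
    ← Real.rpow_mul (by positivity), Real.mul_rpow hc.le (hp _), Real.mul_rpow hC0 (hp _),
    ← Real.rpow_mul ht'.le, ← Real.rpow_mul ht'.le,
    show -(d * (2 / 3 * r + κ / (2 * a))) = -(1 / 2) * (d * (κ / a)) + -(1 / 3) * (d * (2 * r)) by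
      field_simp; ring,
    Real.rpow_add ht', show (2 * d * r : ℝ) = d * (2 * r) by ring,
    show d * κ / a = d * (κ / a) by ring]
  ring

theorem theorem1p1 :
    ∃ C : ℝ, IsLandauConstant C ∧ C < 4 / 5 ∧
      ∀ d : ℕ, 1 ≤ d →
        (∀ q : ℝ≥0∞, 2 ≤ q → ∀ t : ℝ, 1 ≤ |t| →
          ∀ u v : lp (fun _ : CubicLattice d => ℂ) q,
            ‖mulOp u ((lp.memℓp u).of_exponent_ge le_top) ∘L propagator d t ∘L
                mulOp v ((lp.memℓp v).of_exponent_ge le_top)‖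
              ≤ C ^ (2 * d * (1 / q).toReal) * |t| ^ (-(2 * d / 3 * (1 / q).toReal)) *
                ‖u‖ * ‖v‖) ∧
        (∀ a : ℝ, 1 / 2 < a → ∀ q : ℝ≥0∞, 2 ≤ q →
          ∀ (κ : ℝ) (hκ : 0 ≤ κ), κ ≤ a * (1 - 2 * (1 / q).toReal) →
          ∀ t : ℝ, 1 ≤ |t| →
          ∀ (u v : CubicLattice d → ℂ) (hu : MemWeighted q κ u) (hv : MemWeighted q κ v),
            ‖mulOp u (hu.bounded hκ) ∘L propagator d t ∘L mulOp v (hv.bounded hκ)‖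
              ≤ C ^ (2 * d * (1 / q).toReal) *
                (3 * (1 + 2 * a / (2 * a - 1))) ^ (d * κ / a) *
                |t| ^ (-(d * (2 / 3 * (1 / q).toReal + κ / (2 * a)))) *
                weightedNorm q κ u hu * weightedNorm q κ v hv) := by
  obtain ⟨C, hC, hC0, hC1⟩ := isLandauConstant_exists
  refine ⟨C, hC, hC1, fun d _ => ⟨fun q hq t ht u v => ?_, fun a ha q hq κ hκ hκa t ht u v hu hv => ?_⟩⟩
  · have ht0 : t ≠ 0 := abs_pos.1 (by linarith)
    have hr : 2 * (1 / q).toReal ≤ 1 := by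
      have h := ENNReal.toReal_mono (by simp) (ENNReal.inv_le_inv.2 hq)
      rw [ENNReal.toReal_inv 2, ENNReal.toReal_ofNat] at h
      rw [one_div]
      linarith
    -- With `κ = 0` the weights and the constant `C_a` enter with exponent zero, so any `a > 1/2`
    -- serves; here `a = 1`.
    have H := formBound_rho_rpow_mul_lp (d := d) (a := 1) (κ := 0) (by norm_num) hC0 hC.1 ht0 hq le_rfl
      (by linarith) u v
    rw [decayConst_rpow_mul (by norm_num) hC0 ht0] at H
    have e : -(2 * d / 3 * (1 / q).toReal) = -(d * (2 / 3 * (1 / q).toReal + 0 / (2 * 1))) := by ring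
    rw [e]
    refine norm_mulOp_comp_propagator_le _ _ ?_ ?_
    · have := lp.norm_nonneg' u
      have := lp.norm_nonneg' v
      positivity
    · simpa using H
  · have ht0 : t ≠ 0 := abs_pos.1 (by linarith)
    have H := formBound_rho_rpow_mul_lp (d := d) ha hC0 hC.1 ht0 hq hκ hκa ⟨weighted κ u, hu⟩
      ⟨weighted κ v, hv⟩
    rw [decayConst_rpow_mul ha hC0 ht0] at H
    have e : ∀ (u : CubicLattice d → ℂ) n, ((rho n ^ κ : ℝ) : ℂ) * weighted κ u n = u n := fun u n => by
      rw [weighted, ← mul_assoc, ← Complex.ofReal_mul, ← Real.rpow_add (rho_pos n), add_neg_cancel,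
        Real.rpow_zero, Complex.ofReal_one, one_mul]
    simp only [e] at H
    refine norm_mulOp_comp_propagator_le _ _ ?_ H
    have := lp.norm_nonneg' (⟨weighted κ u, hu⟩ : lp (fun _ : CubicLattice d => ℂ) q)
    have := lp.norm_nonneg' (⟨weighted κ v, hv⟩ : lp (fun _ : CubicLattice d => ℂ) q)
    have := (weightConst_pos ha).le
    positivity
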